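/- **Setting.** Let $\mathcal H$ be a smooth $m$-dimensional manifold. *Hypersurface data* $\mathcal D=\{\mathcal H,\gamma,\ell,\ell^{(2)},Y\}$ consist of smooth symmetric two-covariant tensors $\gamma,Y$, a one-form $\ell$ and a function $\ell^{(2)}$ on $\mathcal H$ such that $\mathcal A((W,a),(Z,b))=\gamma(W,Z)+a\,\ell(Z)+b\,\ell(W)+ab\,\ell^{(2)}$ is non-degenerate on $T_p\mathcal H\times\mathbb R$ for every $p$. Its inverse is written $\mathcal A^\sharp((\alpha,a),(\beta,b))=P(\alpha,\beta)+a\,n(\beta)+b\,n(\alpha)+ab\,n^{(2)}$, which defines a symmetric two-contravariant tensor $P$, a vector field $n$ and a function $n^{(2)}$. Put $$K=n^{(2)}Y+\tfrac12\mathcal L_n\gamma+\ell\otimes_s dn^{(2)},\qquad F=\tfrac12 d\ell,\qquad \omega=\tfrac12Y(n,n),\qquad \operatorname{tr}_PK=P^{ab}K_{ab},$$ and let $\overline\nabla$ be the torsion-free connection with $(\overline\nabla_X\gamma)(Z,W)=-\ell(Z)K(X,W)-\ell(W)K(X,Z)$ and $(\overline\nabla_X\ell)(Z)=Y(X,Z)+F(X,Z)-\ell^{(2)}K(X,Z)$.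 Write $\square_Pf=P^{ab}\overline\nabla_a\overline\nabla_bf$. $\mathcal D$ is *characteristic hypersurface data* if $\operatorname{Rad}(\gamma)\neq\{0\}$ at every point, $\gamma$ is positive semi-definite, and there is a smooth function $\underline u$ with $n(\underline u)\ne0$ everywhere whose level sets are all diffeomorphic. For a smooth nowhere vanishing function $z$ and a smooth vector field $\zeta$ (gauge parameters) the gauge transformed data $\mathcal G_{(z,\zeta)}\mathcal D$ are $$\gamma'=\gamma,\quad \ell'=z(\ell+\gamma(\zeta,\cdot)),\quad \ell'^{(2)}=z^2(\ell^{(2)}+2\ell(\zeta)+\gamma(\zeta,\zeta)),\quad Y'=zY+\ell\otimes_s dz+\tfrac12\mathcal L_{z\zeta}\gamma .$$ Let $x^{1},\dots,x^{m}$ be smooth functions on $\mathcal H$ whose differentials are linearly independent at every point, and let $V$ be the vector field with $dx^{a}(V)=\square_Px^{a}$ for all $a$, i.e. $V^c=\Xi^c{}_{a}\square_Px^{a}$, where $\Xi^c{}_{a}$ is the inverse of $\Xi_c{}^{a}=e_c(x^{a})$. A *section* is an embedded hypersurface $\mathcal S\subset\mathcal H$, transverse to $n$, that meets every maximal integral curve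 of $n$ exactly once. **Theorem.** Let $\mathcal D$ be characteristic hypersurface data of dimension $m$, $\{x^{a}\}_{a=1}^m$ functions as above, $\mathcal S\subset\mathcal H$ a section, $z_0$ a smooth nowhere vanishing function on $\mathcal S$ and $\zeta_0$ a smooth vector field of $\mathcal H$ along $\mathcal S$ (not necessarily tangent to $\mathcal S$). Then there is a unique pair of gauge parameters $(z,\zeta)$ on $\mathcal H$ with $(z,\zeta)|_{\mathcal S}=(z_0,\zeta_0)$ such that the data $\mathcal G_{(z,\zeta)}\mathcal D$ satisfy, on all of $\mathcal H$, $$\operatorname{tr}_PK-4\omega=0,\qquad 2P(\overline\nabla_n\ell,\cdot)+n(\ell^{(2)})\,n=V,$$ where all quantities ($P,n,K,\omega,\overline\nabla,\ell,\ell^{(2)},V$) are those of $\mathcal G_{(z,\zeta)}\mathcal D$. -/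

import Mathlib

open scoped Manifold ContDiff Bundle

noncomputable section

/-! ### Tensor fields on a smooth `m`-dimensional manifold `M` -/

/-- The tangent space `T_p M`. -/
abbrev TS (m : ℕ) {M : Type*} [TopologicalSpace M] [ChartedSpace (EuclideanSpace ℝ (Fin m)) M]
    (p : M) : Type :=
  TangentSpace (𝓡 m) p

/-- Vector fields (not necessarily smooth). -/
abbrev VField (m : ℕ) (M : Type*) [TopologicalSpace M]
    [ChartedSpace (EuclideanSpace ℝ (Fin m)) M] : Type _ :=
  (p : M) → TS m p

/-- One-forms (not necessarily smooth). -/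
abbrev Form1 (m : ℕ) (M : Type*) [TopologicalSpace M]
    [ChartedSpace (EuclideanSpace ℝ (Fin m)) M] : Type _ :=
  (p : M) → (TS m p →L[ℝ] ℝ)

/-- Two-covariant tensor fields (not necessarily smooth). -/
abbrev Tensor2 (m : ℕ) (M : Type*) [TopologicalSpace M]
    [ChartedSpace (EuclideanSpace ℝ (Fin m)) M] : Type _ :=
  (p : M) → (TS m p →L[ℝ] TS m p →L[ℝ] ℝ)

section Tensors

variable {m : ℕ} {M : Type*} [TopologicalSpace M] [ChartedSpace (EuclideanSpace ℝ (Fin m)) M]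

/-- Smoothness along a subset `S` (as a section of the tangent bundle) of a vector field. -/
def VField.SmoothOn [IsManifold (𝓡 m) ∞ M] (X : VField m M) (S : Set M) : Prop :=
  ContMDiffOn (𝓡 m) ((𝓡 m).prod 𝓘(ℝ, EuclideanSpace ℝ (Fin m))) ∞
    (fun p => Bundle.TotalSpace.mk' (EuclideanSpace ℝ (Fin m)) p (X p)) S

/-- Smoothness of a vector field. -/
def VField.Smooth [IsManifold (𝓡 m) ∞ M] (X : VField m M) : Prop :=
  ContMDiff (𝓡 m) ((𝓡 m).prod 𝓘(ℝ, EuclideanSpace ℝ (Fin m))) ∞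
    (fun p => Bundle.TotalSpace.mk' (EuclideanSpace ℝ (Fin m)) p (X p))

/-- A vector field is differentiable at the point `p`. -/
def VField.DiffAt [IsManifold (𝓡 m) ∞ M] (X : VField m M) (p : M) : Prop :=
  MDifferentiableAt (𝓡 m) ((𝓡 m).prod 𝓘(ℝ, EuclideanSpace ℝ (Fin m)))
    (fun q => Bundle.TotalSpace.mk' (EuclideanSpace ℝ (Fin m)) q (X q)) p

/-- Smoothness of a one-form (as a section of the cotangent bundle). -/
def Form1.Smooth [IsManifold (𝓡 m) ∞ M] (α : Form1 m M) : Prop :=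
  ContMDiff (𝓡 m) ((𝓡 m).prod 𝓘(ℝ, EuclideanSpace ℝ (Fin m) →L[ℝ] ℝ)) ∞
    (fun p => Bundle.TotalSpace.mk' (EuclideanSpace ℝ (Fin m) →L[ℝ] ℝ)
      (E := fun q : M => TS m q →L[ℝ] Bundle.Trivial M ℝ q) p (α p))

/-- Smoothness of a two-covariant tensor field. -/
def Tensor2.Smooth [IsManifold (𝓡 m) ∞ M] (T : Tensor2 m M) : Prop :=
  ContMDiff (𝓡 m)
    ((𝓡 m).prod 𝓘(ℝ, EuclideanSpace ℝ (Fin m) →L[ℝ] EuclideanSpace ℝ (Fin m) →L[ℝ] ℝ)) ∞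
    (fun p => Bundle.TotalSpace.mk'
      (EuclideanSpace ℝ (Fin m) →L[ℝ] EuclideanSpace ℝ (Fin m) →L[ℝ] ℝ)
      (E := fun q : M => TS m q →L[ℝ] TS m q →L[ℝ] Bundle.Trivial M ℝ q) p (T p))

/-- Smooth scalar functions on `M`. -/
def SmoothFun (m : ℕ) {M : Type*} [TopologicalSpace M]
    [ChartedSpace (EuclideanSpace ℝ (Fin m)) M] (f : M → ℝ) : Prop :=
  ContMDiff (𝓡 m) 𝓘(ℝ) ∞ f

/-- The differential `df` of a function. -/
def dif (m : ℕ) {M : Type*} [TopologicalSpace M]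
    [ChartedSpace (EuclideanSpace ℝ (Fin m)) M] (f : M → ℝ) : Form1 m M :=
  fun p => mvfderiv (𝓡 m) f p

/-- The symmetrized product `α ⊗ₛ β = ½ (α ⊗ β + β ⊗ α)` at a point. -/
def symProd {p : M} (α β : TS m p →L[ℝ] ℝ) : TS m p →L[ℝ] TS m p →L[ℝ] ℝ :=
  (1 / 2 : ℝ) • (α.smulRight β + β.smulRight α)

variable [IsManifold (𝓡 m) ∞ M]

open Classical in
/-- The two-covariant tensor at `p` determined by an operation on vector fields that is tensorial
at `p` in both slots (and `0` if the operation is not tensorial at `p`). -/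
def tensorAt (p : M) (Φ : VField m M → VField m M → ℝ) : TS m p →L[ℝ] TS m p →L[ℝ] ℝ :=
  if h : (∀ Z : VField m M, Z.DiffAt p →
        TensorialAt (𝓡 m) (EuclideanSpace ℝ (Fin m)) (fun X => Φ X Z) p) ∧
      (∀ X : VField m M, X.DiffAt p →
        TensorialAt (𝓡 m) (EuclideanSpace ℝ (Fin m)) (Φ X) p) then
    TensorialAt.mkHom₂ Φ p h.1 h.2
  else 0

/-- The Lie derivative `ℒ_X T` of a two-covariant tensor field:
`(ℒ_X T)(Z, W) = X(T(Z, W)) - T([X, Z], W) - T(Z, [X, W])`. -/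
def lieDeriv (X : VField m M) (T : Tensor2 m M) : Tensor2 m M := fun p =>
  tensorAt p fun Z W =>
    dif m (fun q => T q (Z q) (W q)) p (X p)
      - T p (VectorField.mlieBracket (𝓡 m) X Z p) (W p)
      - T p (Z p) (VectorField.mlieBracket (𝓡 m) X W p)

/-- The exterior derivative `dα` of a one-form:
`dα(Z, W) = Z(α(W)) - W(α(Z)) - α([Z, W])`. -/
def extD (α : Form1 m M) : Tensor2 m M := fun p =>
  tensorAt p fun Z W =>
    dif m (fun q => α q (W q)) p (Z p) - dif m (fun q => α q (Z q)) p (W p)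
      - α p (VectorField.mlieBracket (𝓡 m) Z W p)

/-- Affine connections on `M`; `∇ Z p v` is the covariant derivative `∇_v Z` at `p`. -/
abbrev Conn (m : ℕ) (M : Type*) [TopologicalSpace M]
    [ChartedSpace (EuclideanSpace ℝ (Fin m)) M] [IsManifold (𝓡 m) ∞ M] : Type _ :=
  CovariantDerivative (𝓡 m) (EuclideanSpace ℝ (Fin m)) (TangentSpace (𝓡 m) : M → Type _)

/-- The covariant derivative of a one-form, `(X, Z) ↦ (∇_X α)(Z) = X(α(Z)) - α(∇_X Z)`. -/
def covForm (D : Conn m M) (α : Form1 m M) : Tensor2 m M := fun p =>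
  tensorAt p fun X Z =>
    dif m (fun q => α q (Z q)) p (X p) - α p (D Z p (X p))

/-- `(∇_v T)(Z, W) = v(T(Z, W)) - T(∇_v Z, W) - T(Z, ∇_v W)` for a two-covariant tensor field `T`,
a vector `v ∈ T_p M` and vector fields `Z`, `W`. -/
def covTensor (D : Conn m M) (T : Tensor2 m M) (p : M) (v : TS m p) (Z W : VField m M) : ℝ :=
  dif m (fun q => T q (Z q) (W q)) p v - T p (D Z p v) (W p) - T p (Z p) (D W p v)

/-- Evaluation on vector fields of the tensor determined by a tensorial operation. -/
theorem tensorAt_apply {p : M} {Φ : VField m M → VField m M → ℝ}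
    (h₁ : ∀ Z : VField m M, Z.DiffAt p →
      TensorialAt (𝓡 m) (EuclideanSpace ℝ (Fin m)) (fun X => Φ X Z) p)
    (h₂ : ∀ X : VField m M, X.DiffAt p →
      TensorialAt (𝓡 m) (EuclideanSpace ℝ (Fin m)) (Φ X) p)
    {X Z : VField m M} (hX : X.DiffAt p) (hZ : Z.DiffAt p) :
    tensorAt p Φ (X p) (Z p) = Φ X Z := by
  unfold tensorAt
  rw [dif_pos ⟨h₁, h₂⟩]
  exact TensorialAt.mkHom₂_apply h₁ h₂ hX hZ

theorem VField.Smooth.diffAt {X : VField m M} (hX : X.Smooth) (p : M) : X.DiffAt p :=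
  (hX p).mdifferentiableAt (by simp)

theorem Form1.Smooth.apply_mdiff {α : Form1 m M} (hα : α.Smooth) {Z : VField m M} {p : M}
    (hZ : Z.DiffAt p) : MDifferentiableAt (𝓡 m) 𝓘(ℝ) (fun q => α q (Z q)) p := by
  have h := MDifferentiableAt.clm_bundle_apply ((hα p).mdifferentiableAt (by simp)) hZ
  simpa [mdifferentiableAt_section] using h

theorem Tensor2.Smooth.apply_mdiff {T : Tensor2 m M} (hT : T.Smooth) {Z W : VField m M} {p : M}
    (hZ : Z.DiffAt p) (hW : W.DiffAt p) :
    MDifferentiableAt (𝓡 m) 𝓘(ℝ) (fun q => T q (Z q) (W q)) p := by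
  have h := MDifferentiableAt.clm_bundle_apply₂ ((hT p).mdifferentiableAt (by simp)) hZ hW
  simpa [mdifferentiableAt_section] using h

theorem covForm_apply (D : Conn m M) {α : Form1 m M} (hα : α.Smooth) {X Z : VField m M} {p : M}
    (hX : X.DiffAt p) (hZ : Z.DiffAt p) :
    covForm D α p (X p) (Z p) = dif m (fun q => α q (Z q)) p (X p) - α p (D Z p (X p)) := by
  refine tensorAt_apply (Φ := fun X Z : VField m M =>
    dif m (fun q => α q (Z q)) p (X p) - α p (D Z p (X p))) (fun Z hZ => ⟨?_, ?_⟩)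
    (fun X hX => ⟨?_, ?_⟩) hX hZ
  · intro f X hf hX
    simp; ring
  · intro X X' hX hX'
    simp; ring
  · intro f Z hf hZ
    have h := D.isCovariantDerivativeOnUniv.leibniz hZ hf (Set.mem_univ p)
    have h' := mvfderiv_fun_mul hf (hα.apply_mdiff hZ)
    simp only [dif, Pi.smul_apply', map_smul, smul_eq_mul, h, h']
    simp; ring
  · intro Z Z' hZ hZ'
    have h := D.isCovariantDerivativeOnUniv.add hZ hZ' (Set.mem_univ p)
    have h' := mvfderiv_fun_add (hα.apply_mdiff hZ) (hα.apply_mdiff hZ')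
    simp only [dif, Pi.add_apply, map_add, h, h']
    simp; ring

theorem extD_apply {α : Form1 m M} (hα : α.Smooth) {Z W : VField m M} {p : M}
    (hZ : Z.DiffAt p) (hW : W.DiffAt p) :
    extD α p (Z p) (W p) = dif m (fun q => α q (W q)) p (Z p)
      - dif m (fun q => α q (Z q)) p (W p) - α p (VectorField.mlieBracket (𝓡 m) Z W p) := by
  refine tensorAt_apply (Φ := fun Z W : VField m M => dif m (fun q => α q (W q)) p (Z p)
      - dif m (fun q => α q (Z q)) p (W p) - α p (VectorField.mlieBracket (𝓡 m) Z W p))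
    (fun W hW => ⟨?_, ?_⟩) (fun Z hZ => ⟨?_, ?_⟩) hZ hW
  · intro f Z hf hZ
    have h' := mvfderiv_fun_mul hf (hα.apply_mdiff hZ)
    simp only [dif, Pi.smul_apply', map_smul, smul_eq_mul, h',
      VectorField.mlieBracket_smul_left hf hZ]
    simp [mvfderiv]; ring
  · intro Z Z' hZ hZ'
    have h' := mvfderiv_fun_add (hα.apply_mdiff hZ) (hα.apply_mdiff hZ')
    simp only [dif, Pi.add_apply, map_add, h', VectorField.mlieBracket_add_left hZ hZ']
    simp; ring
  · intro f W hf hW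
    have h' := mvfderiv_fun_mul hf (hα.apply_mdiff hW)
    simp only [dif, Pi.smul_apply', map_smul, smul_eq_mul, h',
      VectorField.mlieBracket_smul_right hf hW]
    simp [mvfderiv]; ring
  · intro W W' hW hW'
    have h' := mvfderiv_fun_add (hα.apply_mdiff hW) (hα.apply_mdiff hW')
    simp only [dif, Pi.add_apply, map_add, h', VectorField.mlieBracket_add_right hW hW']
    simp; ring

theorem lieDeriv_apply {X : VField m M} {T : Tensor2 m M} (hT : T.Smooth) {Z W : VField m M}
    {p : M} (hZ : Z.DiffAt p) (hW : W.DiffAt p) :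
    lieDeriv X T p (Z p) (W p) = dif m (fun q => T q (Z q) (W q)) p (X p)
      - T p (VectorField.mlieBracket (𝓡 m) X Z p) (W p)
      - T p (Z p) (VectorField.mlieBracket (𝓡 m) X W p) := by
  refine tensorAt_apply (Φ := fun Z W : VField m M => dif m (fun q => T q (Z q) (W q)) p (X p)
      - T p (VectorField.mlieBracket (𝓡 m) X Z p) (W p)
      - T p (Z p) (VectorField.mlieBracket (𝓡 m) X W p))
    (fun W hW => ⟨?_, ?_⟩) (fun Z hZ => ⟨?_, ?_⟩) hZ hW
  · intro f Z hf hZ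
    have h' := mvfderiv_fun_mul hf (hT.apply_mdiff hZ hW)
    simp only [dif, Pi.smul_apply', map_smul, smul_eq_mul, h', smul_apply,
      VectorField.mlieBracket_smul_right hf hZ]
    simp [mvfderiv]; ring
  · intro Z Z' hZ hZ'
    have h' := mvfderiv_fun_add (hT.apply_mdiff hZ hW) (hT.apply_mdiff hZ' hW)
    simp only [dif, Pi.add_apply, map_add, h', add_apply,
      VectorField.mlieBracket_add_right hZ hZ']
    ring
  · intro f W hf hW
    have h' := mvfderiv_fun_mul hf (hT.apply_mdiff hZ hW)
    simp only [dif, Pi.smul_apply', map_smul, smul_eq_mul, h',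
      VectorField.mlieBracket_smul_right hf hW]
    simp [mvfderiv]; ring
  · intro W W' hW hW'
    have h' := mvfderiv_fun_add (hT.apply_mdiff hZ hW) (hT.apply_mdiff hZ hW')
    simp only [dif, Pi.add_apply, map_add, h', VectorField.mlieBracket_add_right hW hW']
    simp; ring

end Tensors

/-! ### Hypersurface data -/

/-- The tensors `γ, ℓ, ℓ⁽²⁾, Y` on `M` out of which hypersurface data is made. The requirements on
them are in `HData.IsHypersurfaceData` and `HData.IsCHD`. -/
structure HData (m : ℕ) (M : Type*) [TopologicalSpace M]
    [ChartedSpace (EuclideanSpace ℝ (Fin m)) M] where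
  /-- the symmetric two-covariant tensor `γ` -/
  γ : Tensor2 m M
  /-- the one-form `ℓ` -/
  ℓ : Form1 m M
  /-- the scalar `ℓ⁽²⁾` -/
  ℓ2 : M → ℝ
  /-- the symmetric two-covariant tensor `Y` -/
  Y : Tensor2 m M

namespace HData

variable {m : ℕ} {M : Type*} [TopologicalSpace M] [ChartedSpace (EuclideanSpace ℝ (Fin m)) M]

/-- The bilinear form
`𝒜((W, a), (Z, b)) = γ(W, Z) + a ℓ(Z) + b ℓ(W) + a b ℓ⁽²⁾` on `T_p M × ℝ`. -/
def A (D : HData m M) (p : M) : LinearMap.BilinForm ℝ (TS m p × ℝ) :=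
  LinearMap.mk₂ ℝ
    (fun v w => D.γ p v.1 w.1 + v.2 * D.ℓ p w.1 + w.2 * D.ℓ p v.1 + v.2 * w.2 * D.ℓ2 p)
    (by intro v v' w; simp; ring) (by intro c v w; simp; ring)
    (by intro v w w'; simp; ring) (by intro c v w; simp; ring)

open Classical in
/-- The inverse `𝒜♯` of `𝒜`, as a map from covectors on `T_p M × ℝ` to vectors
(`𝒜(𝒜♯ φ, ·) = φ`). -/
def Asharp (D : HData m M) (p : M) : Module.Dual ℝ (TS m p × ℝ) →ₗ[ℝ] TS m p × ℝ :=
  haveI : FiniteDimensional ℝ (TS m p) :=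
    inferInstanceAs (FiniteDimensional ℝ (EuclideanSpace ℝ (Fin m)))
  if h : (D.A p).Nondegenerate then ((D.A p).toDual h).symm.toLinearMap else 0

/-- The covector `(α, a)` on `T_p M × ℝ`, i.e. `(W, b) ↦ α(W) + a b`. -/
def covec {p : M} (α : TS m p →L[ℝ] ℝ) (a : ℝ) : Module.Dual ℝ (TS m p × ℝ) :=
  LinearMap.coprod α.toLinearMap (a • LinearMap.id)

/-- The vector field `n`, where
`𝒜♯((α, a), (β, b)) = P(α, β) + a n(β) + b n(α) + a b n⁽²⁾`. -/
def n (D : HData m M) : VField m M := fun p => (D.Asharp p (covec 0 1)).1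

/-- The scalar `n⁽²⁾`. -/
def n2 (D : HData m M) : M → ℝ := fun p => (D.Asharp p (covec 0 1)).2

/-- The two-contravariant tensor `P`, as the map `α ↦ P(α, ·)` from covectors to vectors. -/
def P (D : HData m M) (p : M) : (TS m p →L[ℝ] ℝ) →ₗ[ℝ] TS m p where
  toFun α := (D.Asharp p (covec α 0)).1
  map_add' α β := by
    have h : covec (α + β) 0 = covec α 0 + covec β 0 := by
      ext <;> simp [covec]
    rw [h, map_add, Prod.fst_add]
  map_smul' c α := by
    have h : covec (c • α) 0 = c • covec α 0 := by
      ext <;> simp [covec]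
    rw [h, map_smul, Prod.smul_fst, RingHom.id_apply]

/-- The trace `tr_P T = P^{ab} T_{ab}`. -/
def trP (D : HData m M) (p : M) (T : TS m p →L[ℝ] TS m p →L[ℝ] ℝ) : ℝ :=
  LinearMap.trace ℝ (TS m p) ((D.P p).comp T.toLinearMap)

/-- The leaf through `p` of the foliation by the level sets of `u`. -/
def leaf (u : M → ℝ) (p : M) : Set M := {q | u q = u p}

/-- The functions `x¹, …, xᵐ` are smooth and their differentials are linearly independent at
every point. -/
def IsIndep (x : Fin m → M → ℝ) : Prop :=
  (∀ a, SmoothFun m (x a)) ∧ ∀ p, LinearIndependent ℝ (fun a => dif m (x a) p)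

/-- The matrix `Ξ_c^a = e_c(x^a)`, as the map `v ↦ (v(x¹), …, v(xᵐ))`. -/
def Xi (x : Fin m → M → ℝ) (p : M) : TS m p →ₗ[ℝ] (Fin m → ℝ) :=
  LinearMap.pi fun a => (dif m (x a) p).toLinearMap

variable [IsManifold (𝓡 m) ∞ M]

/-- Hypersurface data: smooth tensors `γ, ℓ, ℓ⁽²⁾, Y`, with `γ` and `Y` symmetric, such that `𝒜` is
non-degenerate at every point. -/
structure IsHypersurfaceData (D : HData m M) : Prop where
  smooth_γ : D.γ.Smooth
  smooth_ℓ : D.ℓ.Smooth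
  smooth_ℓ2 : SmoothFun m D.ℓ2
  smooth_Y : D.Y.Smooth
  symm_γ : ∀ p v w, D.γ p v w = D.γ p w v
  symm_Y : ∀ p v w, D.Y p v w = D.Y p w v
  nondeg : ∀ p, (D.A p).Nondegenerate

/-- Characteristic hypersurface data. The level sets of the foliation function are embedded
hypersurfaces, and smooth maps between them are maps that are smooth along these subsets. -/
structure IsCHD (D : HData m M) : Prop extends D.IsHypersurfaceData where
  rad_ne : ∀ p, ∃ v : TS m p, v ≠ 0 ∧ D.γ p v = 0
  semipos : ∀ p v, 0 ≤ D.γ p v v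
  foliation : ∃ u : M → ℝ, SmoothFun m u ∧ (∀ p, dif m u p (D.n p) ≠ 0) ∧
    ∀ p q : M, ∃ f g : M → M,
      ContMDiffOn (𝓡 m) (𝓡 m) ∞ f (leaf u p) ∧ ContMDiffOn (𝓡 m) (𝓡 m) ∞ g (leaf u q) ∧
      Set.MapsTo f (leaf u p) (leaf u q) ∧ Set.MapsTo g (leaf u q) (leaf u p) ∧
      Set.InvOn g f (leaf u p) (leaf u q)

/-- `K = n⁽²⁾ Y + ½ ℒ_n γ + ℓ ⊗ₛ dn⁽²⁾`. -/
def K (D : HData m M) : Tensor2 m M := fun p =>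
  D.n2 p • D.Y p + (1 / 2 : ℝ) • lieDeriv D.n D.γ p + symProd (D.ℓ p) (dif m D.n2 p)

/-- `F = ½ dℓ`. -/
def F (D : HData m M) : Tensor2 m M := fun p => (1 / 2 : ℝ) • extD D.ℓ p

/-- `ω = ½ Y(n, n)`. -/
def omega (D : HData m M) : M → ℝ := fun p => (1 / 2 : ℝ) * D.Y p (D.n p) (D.n p)

/-- The gauge transformation `𝒢_{(z, ζ)}`. -/
def gauge (D : HData m M) (z : M → ℝ) (ζ : VField m M) : HData m M where
  γ := D.γ
  ℓ := fun p => z p • (D.ℓ p + D.γ p (ζ p))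
  ℓ2 := fun p => z p ^ 2 * (D.ℓ2 p + 2 * D.ℓ p (ζ p) + D.γ p (ζ p) (ζ p))
  Y := fun p => z p • D.Y p + symProd (D.ℓ p) (dif m z p)
    + (1 / 2 : ℝ) • lieDeriv (fun q => z q • ζ q) D.γ p

/-- `N` is the hypersurface data connection `∇̄`: the torsion-free connection with
`(∇̄_X γ)(Z, W) = -ℓ(Z) K(X, W) - ℓ(W) K(X, Z)` and
`(∇̄_X ℓ)(Z) = Y(X, Z) + F(X, Z) - ℓ⁽²⁾ K(X, Z)`. -/
structure IsConnection (D : HData m M) (N : Conn m M) : Prop where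
  torsion_free : N.torsion = 0
  nabla_γ : ∀ (p : M) (v : TS m p) (Z W : VField m M), Z.DiffAt p → W.DiffAt p →
    covTensor N D.γ p v Z W = -D.ℓ p (Z p) * D.K p v (W p) - D.ℓ p (W p) * D.K p v (Z p)
  nabla_ℓ : ∀ (p : M) (v w : TS m p),
    covForm N D.ℓ p v w = D.Y p v w + D.F p v w - D.ℓ2 p * D.K p v w

/-- `□_P f = P^{ab} ∇̄_a ∇̄_b f`. -/
def box (D : HData m M) (N : Conn m M) (f : M → ℝ) : M → ℝ := fun p =>
  D.trP p (covForm N (dif m f) p)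

open Classical in
/-- The vector field `V^c = Ξ^c_a □_P x^a`, where `Ξ^c_a` is the inverse of `Ξ_c^a`. -/
def V (D : HData m M) (N : Conn m M) (x : Fin m → M → ℝ) : VField m M := fun p =>
  if h : Function.Bijective (Xi x p) then
    (LinearEquiv.ofBijective (Xi x p) h).symm fun a => D.box N (x a) p
  else 0

/-- The data is written in the harmonic gauge with respect to the functions `x^a`:
`tr_P K - 4ω = 0` and `2 P(∇̄_n ℓ, ·) + n(ℓ⁽²⁾) n = V`, where `∇̄` is the hypersurface data
connection. -/
def IsHarmonic (D : HData m M) (x : Fin m → M → ℝ) : Prop :=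
  ∃ N : Conn m M, D.IsConnection N ∧
    (∀ p, D.trP p (D.K p) - 4 * D.omega p = 0) ∧
    ∀ p, (2 : ℝ) • D.P p (covForm N D.ℓ p (D.n p)) + dif m D.ℓ2 p (D.n p) • D.n p = D.V N x p

/-- `S` is a section: an embedded hypersurface transverse to `n` (locally the zero set of a smooth
function `f` with `n(f) ≠ 0`) that meets every maximal integral curve of `n` exactly once. -/
structure IsSection (D : HData m M) (S : Set M) : Prop where
  hypersurface : ∀ p ∈ S, ∃ (U : Set M) (f : M → ℝ), IsOpen U ∧ p ∈ U ∧
    ContMDiffOn (𝓡 m) 𝓘(ℝ) ∞ f U ∧ S ∩ U = {q ∈ U | f q = 0} ∧ dif m f p (D.n p) ≠ 0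
  meets : ∀ p : M, ∃ (c : ℝ → M) (a b t : ℝ), (0 : ℝ) ∈ Set.Ioo a b ∧ t ∈ Set.Ioo a b ∧
    IsMIntegralCurveOn (I := 𝓡 m) c D.n (Set.Ioo a b) ∧ c 0 = p ∧ c t ∈ S
  meets_once : ∀ (c : ℝ → M) (a b s t : ℝ), s ∈ Set.Ioo a b → t ∈ Set.Ioo a b →
    IsMIntegralCurveOn (I := 𝓡 m) c D.n (Set.Ioo a b) → c s ∈ S → c t ∈ S → s = t

end HData

/-- Gauge parameters: a smooth nowhere vanishing function `z` and a smooth vector field `ζ`. -/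
structure IsGaugeParam {m : ℕ} {M : Type*} [TopologicalSpace M]
    [ChartedSpace (EuclideanSpace ℝ (Fin m)) M] [IsManifold (𝓡 m) ∞ M]
    (z : M → ℝ) (ζ : VField m M) : Prop where
  smooth_z : SmoothFun m z
  ne_zero : ∀ p, z p ≠ 0
  smooth_ζ : ζ.Smooth

end

/-! Written for the transformed data, the two harmonic conditions are linear transport equations
along the integral curves of `n`, and a section is the right place for their initial values.

Algebra: since `γ` has a radical and `𝒜` is non-degenerate, `n` spans the radical, `ℓ(n) = 1` and
`n⁽²⁾ = 0`. Hence `K = ½ ℒ_n γ` and `K(n, ·) = 0`. The gauge laws become `n' = z⁻¹ n`, `P' = P - ζ ⊗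
n - n ⊗ ζ`, `K' = z⁻¹ K`, `∇' = ∇̄ + K ⊗ ζ`, and `tr_P' K' - 4ω' = z⁻¹ (tr_P K - 4ω) - 2 z⁻² n(z)`.
With `E = 2 P(∇̄_n ℓ, ·) + n(ℓ⁽²⁾) n` (`ellVec`) and `ζᵃ = dxᵃ(ζ)` one finds `E' = E + 2 ∇̄_n ζ - 4ω
ζ` and `□'xᵃ = □xᵃ - 2 n(ζᵃ) + 2 dxᵃ(∇̄_n ζ) - (tr_P K) ζᵃ`. In `dxᵃ(E') = □'xᵃ` the terms in `∇̄_n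
ζ` cancel. Put `r = ½ (tr_P K - 4ω)` and `kᵃ = ½ (□xᵃ - dxᵃ(E))`; the conditions are `n(z) = r z`
and `n(ζᵃ) = kᵃ - r ζᵃ` (`gauge_isHarmonic_iff`), and the second one is `n(z ζᵃ) = z kᵃ`. Every
integral curve meets `S` exactly once when prolonged, so integration along the curves yields one and
only one solution.

Analysis: these solutions must be smooth. Dependence of the flow on its initial point comes from the
implicit function theorem in a space of curves (`exists_contDiffOn_local_flow`); transversality of
`S` gives regularity near `S`, and the flow carries it along the curves (`transport_smooth`).

Geometry: the `dxᵃ` provide a global commuting frame. It reduces smoothness of `n`, `P`, traces and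
Christoffel symbols to inverting a Gram matrix (`Asharp_smooth`), and it allows `∇̄` to be built by
a Koszul formula (`IsNull.isConnection`). -/

section

open Set Filter Topology

/-! ### Smoothness of superposition operators and of local flows -/

section Superposition

universe u

set_option synthInstance.maxHeartbeats 200000 in
/-- Pointwise application of a continuous family of operators to a continuous curve. -/
noncomputable def ContinuousMap.clmApply (K : Type*) [TopologicalSpace K] [CompactSpace K]
    (E : Type*) [NormedAddCommGroup E] [NormedSpace ℝ E]
    (F : Type*) [NormedAddCommGroup F] [NormedSpace ℝ F] :
    C(K, E →L[ℝ] F) →L[ℝ] C(K, E) →L[ℝ] C(K, F) :=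
  LinearMap.mkContinuous₂
    (LinearMap.mk₂ ℝ
      (fun (A : C(K, E →L[ℝ] F)) (β : C(K, E)) => (⟨fun t => A t (β t), by fun_prop⟩ : C(K, F)))
      (fun A A' β => by ext; simp) (fun c A β => by ext; simp)
      (fun A β β' => by ext; simp) (fun c A β => by ext; simp)) 1
    (fun A β => by
      rw [one_mul, ContinuousMap.norm_le _ (by positivity)]
      intro t
      exact (A t).le_of_opNorm_le_of_le (A.norm_coe_le_norm t) (β.norm_coe_le_norm t))

variable {K : Type*} [TopologicalSpace K] [CompactSpace K]
  {E : Type u} [NormedAddCommGroup E] [NormedSpace ℝ E]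

/-- The range of `α` is compact, so one radius `δ` controls the variation of `fderiv ℝ v` around all
its points; the mean value inequality on these balls bounds the remainder uniformly in `t`. -/
theorem ContinuousMap.hasFDerivAt_comp {F : Type*} [NormedAddCommGroup F] [NormedSpace ℝ F]
    (v : C(E, F)) (hv : ContDiff ℝ 1 v) (α : C(K, E)) :
    HasFDerivAt (fun β : C(K, E) => v.comp β)
      (ContinuousMap.clmApply K E F
        ((⟨fderiv ℝ v, hv.continuous_fderiv one_ne_zero⟩ : C(E, E →L[ℝ] F)).comp α)) α := by
  rw [hasFDerivAt_iff_isLittleO_nhds_zero, Asymptotics.isLittleO_iff]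
  intro ε hε
  have hc : IsCompact (range α) := isCompact_range α.continuous
  have hu := hc.uniformContinuousAt_of_continuousAt (fderiv ℝ v)
    (fun a _ => (hv.continuous_fderiv one_ne_zero).continuousAt) (Metric.dist_mem_uniformity hε)
  obtain ⟨δ, hδ, hδ'⟩ := Metric.mem_uniformity_dist.1 hu
  filter_upwards [Metric.ball_mem_nhds (0 : C(K, E)) hδ] with h hh
  rw [mem_ball_zero_iff] at hh
  rw [ContinuousMap.norm_le _ (by positivity)]
  intro t
  have key := (convex_ball (α t) δ).norm_image_sub_le_of_norm_fderiv_le' (f := v) (𝕜 := ℝ)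
    (φ := fderiv ℝ v (α t)) (C := ε) (x := α t) (y := α t + h t)
    (fun x _ => hv.differentiable one_ne_zero x) (fun y hy => by
      have h1 : dist (α t) y < δ := by rw [dist_comm]; exact hy
      have h3 : dist (fderiv ℝ v (α t)) (fderiv ℝ v y) < ε := hδ' h1 (mem_range_self t)
      rw [dist_comm, dist_eq_norm] at h3
      exact h3.le) (Metric.mem_ball_self hδ) (by
      rw [Metric.mem_ball, dist_eq_norm, add_sub_cancel_left]
      exact (h.norm_coe_le_norm t).trans_lt hh)
  rw [add_sub_cancel_left] at key
  exact key.trans (mul_le_mul_of_nonneg_left (h.norm_coe_le_norm t) hε.le)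

/-- Induction on `n`: the derivative of superposition by `v` is superposition by `fderiv ℝ v`
followed by the linear map `clmApply`. The target `F` must vary, and it stays in the universe of `E`
so that `E →L[ℝ] F` is again admissible. -/
theorem ContinuousMap.contDiff_comp_nat (n : ℕ) {F : Type u} [NormedAddCommGroup F]
    [NormedSpace ℝ F] (v : C(E, F)) (hv : ContDiff ℝ n v) :
    ContDiff ℝ n (fun β : C(K, E) => v.comp β) := by
  induction n generalizing F with
  | zero =>
    rw [Nat.cast_zero, contDiff_zero]
    exact ContinuousMap.continuous_postcomp _
  | succ n ih =>
    have h1 : ContDiff ℝ 1 v := hv.of_le (by simp)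
    rw [Nat.cast_succ, contDiff_succ_iff_hasFDerivAt] at hv ⊢
    have h2 : ContDiff ℝ n (fderiv ℝ v) := by
      obtain ⟨v', hv', hd⟩ := hv
      rwa [show fderiv ℝ v = v' from funext fun x => (hd x).fderiv]
    exact ⟨fun α => ContinuousMap.clmApply K E F
        ((⟨fderiv ℝ v, h1.continuous_fderiv one_ne_zero⟩ : C(E, E →L[ℝ] F)).comp α),
      ContDiff.comp (g := ContinuousMap.clmApply K E F) (ContinuousLinearMap.contDiff _)
        (ih ⟨fderiv ℝ v, h1.continuous_fderiv one_ne_zero⟩ h2),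
      fun α => ContinuousMap.hasFDerivAt_comp v h1 α⟩

end Superposition

/-! ### Local flows in a Banach space, by the implicit function theorem -/

section Flow

variable {E : Type*} [NormedAddCommGroup E] [NormedSpace ℝ E]

/-- The primitive vanishing at `0` of a curve on `[-1, 1]`. -/
noncomputable def ContinuousMap.primitive [CompleteSpace E] :
    C(Icc (-1 : ℝ) 1, E) →L[ℝ] C(Icc (-1 : ℝ) 1, E) :=
  LinearMap.mkContinuous
    { toFun := fun β => ⟨fun t => ∫ s in (0 : ℝ)..t, IccExtend (by norm_num) β s, by
        have h : Continuous fun t : ℝ => ∫ s in (0 : ℝ)..t, IccExtend (by norm_num) β s :=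
          intervalIntegral.continuous_primitive
            (fun a b => (β.continuous.Icc_extend' (h := by norm_num)).intervalIntegrable a b) 0
        exact h.comp continuous_subtype_val⟩
      map_add' := fun β β' => by
        ext t
        exact intervalIntegral.integral_add
          ((β.continuous.Icc_extend' (h := by norm_num)).intervalIntegrable _ _)
          ((β'.continuous.Icc_extend' (h := by norm_num)).intervalIntegrable _ _)
      map_smul' := fun c β => by
        ext t
        exact intervalIntegral.integral_smul c _ } 1
    (fun β => by
      rw [ContinuousMap.norm_le _ (by positivity)]
      intro t
      have h := intervalIntegral.norm_integral_le_of_norm_le_const (a := (0 : ℝ)) (b := t)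
        (f := IccExtend (by norm_num) β) (C := ‖β‖) (fun s _ => β.norm_coe_le_norm _)
      refine h.trans ?_
      rw [mul_comm, sub_zero]
      gcongr
      exact abs_le.2 ⟨t.2.1, t.2.2⟩)

/-- The equation `α(t) = x + ε ∫₀ᵗ v(α)` on `[-1, 1]`, as an equation in the space of curves. -/
noncomputable def flowEquation [CompleteSpace E] (v : C(E, E))
    (p : (ℝ × E) × C(Icc (-1 : ℝ) 1, E)) : C(Icc (-1 : ℝ) 1, E) :=
  p.2 - ContinuousLinearMap.const ℝ (Icc (-1 : ℝ) 1) p.1.2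
    - p.1.1 • ContinuousMap.primitive (v.comp p.2)

theorem flowEquation_apply [CompleteSpace E] (v : C(E, E)) (ε : ℝ) (x : E)
    (α : C(Icc (-1 : ℝ) 1, E)) (t : Icc (-1 : ℝ) 1) :
    flowEquation v ((ε, x), α) t =
      α t - x - ε • ∫ s in (0 : ℝ)..t, IccExtend (by norm_num) (v.comp α) s := rfl

theorem contDiff_flowEquation [CompleteSpace E] (n : ℕ) (v : C(E, E)) (hv : ContDiff ℝ n v) :
    ContDiff ℝ n (flowEquation v) := by
  have h := (ContinuousMap.contDiff_comp_nat (K := Icc (-1 : ℝ) 1) n v hv).comp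
    (contDiff_snd (E := ℝ × E))
  have h2 := (ContinuousLinearMap.const ℝ (M := E) (Icc (-1 : ℝ) 1)).contDiff (n := n) |>.comp
    ((contDiff_snd (E := ℝ) (F := E)).comp (contDiff_fst (F := C(Icc (-1 : ℝ) 1, E))))
  exact (contDiff_snd.sub h2).sub
    ((contDiff_fst.comp contDiff_fst).smul (ContDiff.comp (g := ContinuousMap.primitive)
      (ContinuousLinearMap.contDiff _) h))

/-- Multiplication by `s ∈ [-1, 1]` on `[-1, 1]`. -/
def scaleIcc (s : Icc (-1 : ℝ) 1) : C(Icc (-1 : ℝ) 1, Icc (-1 : ℝ) 1) where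
  toFun t := ⟨s * t, abs_le.1 (by
    rw [abs_mul]
    exact mul_le_one₀ (abs_le.2 s.2) (abs_nonneg _) (abs_le.2 t.2))⟩
  continuous_toFun := by fun_prop

/-- Substitution `σ = s τ` in the integral: running a solution at the fraction `s` of its speed
solves the equation with time scale `ε s`. -/
theorem flowEquation_rescale [CompleteSpace E] (v : C(E, E)) {ε : ℝ} {x : E}
    {α : C(Icc (-1 : ℝ) 1, E)} (h : flowEquation v ((ε, x), α) = 0) (s : Icc (-1 : ℝ) 1) :
    flowEquation v ((ε * s, x), α.comp (scaleIcc s)) = 0 := by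
  ext t
  have h1 := congrArg (fun β => β (scaleIcc s t)) h
  simp only [flowEquation_apply, ContinuousMap.zero_apply] at h1
  rw [flowEquation_apply, ContinuousMap.zero_apply, ← h1, mul_smul]
  simp only [ContinuousMap.comp_apply]
  congr 2
  have h2 := intervalIntegral.smul_integral_comp_mul_left (a := (0 : ℝ)) (b := t)
    (IccExtend (by norm_num : (-1 : ℝ) ≤ 1) (v.comp α)) (s : ℝ)
  rw [mul_zero] at h2
  rw [show (scaleIcc s t : ℝ) = s * t from rfl, ← h2]
  congr 1
  refine intervalIntegral.integral_congr fun τ hτ => ?_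
  have hτ' : τ ∈ Icc (-1 : ℝ) 1 := by
    rcases le_total (0 : ℝ) t with h0 | h0
    · rw [uIcc_of_le h0] at hτ
      exact ⟨by linarith [hτ.1], hτ.2.trans t.2.2⟩
    · rw [uIcc_of_ge h0] at hτ
      exact ⟨t.2.1.trans hτ.1, by linarith [hτ.2]⟩
  have hs' : (s : ℝ) * τ ∈ Icc (-1 : ℝ) 1 := (scaleIcc s ⟨τ, hτ'⟩).2
  simp only [IccExtend_of_mem _ _ hτ', IccExtend_of_mem _ _ hs']
  rfl

/-- The local flow of a smooth vector field is of class `C^n`, for every finite `n`. -/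
theorem exists_contDiffOn_local_flow [CompleteSpace E] {v : E → E} {n : ℕ}
    (hv : ContDiff ℝ n v) (x₀ : E)
    (hn : n ≠ 0) : ∃ δ > 0, ∃ U ∈ 𝓝 x₀, ∃ Ψ : ℝ × E → E,
      ContDiffOn ℝ n Ψ (Ioo (-δ) δ ×ˢ U) ∧ (∀ x ∈ U, Ψ (0, x) = x) ∧
      ∀ x ∈ U, ∀ t ∈ Ioo (-δ) δ, HasDerivAt (fun s => Ψ (s, x)) (v (Ψ (t, x))) t := by
  let w : C(E, E) := ⟨v, hv.continuous⟩
  have hw : ContDiff ℝ n w := hv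
  let c := ContinuousLinearMap.const ℝ (M := E) (Icc (-1 : ℝ) 1)
  let u : (ℝ × E) × C(Icc (-1 : ℝ) 1, E) := ((0, x₀), c x₀)
  have hu : flowEquation w u = 0 := by
    ext t
    simp [u, c, flowEquation_apply]
  have hn' : (n : WithTop ℕ∞) ≠ 0 := by exact_mod_cast hn
  have cdf : ContDiffAt ℝ n (flowEquation w) u := (contDiff_flowEquation n w hw).contDiffAt
  -- At `ε = 0` the integral term disappears, so the partial derivative in the curve is the
  -- identity.
  have hinv : (fderiv ℝ (flowEquation w) u ∘L .inr ℝ _ _).IsInvertible := by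
    have h1 : HasFDerivAt (fun α => flowEquation w (u.1, α))
        (fderiv ℝ (flowEquation w) u ∘L .inr ℝ _ _) u.2 :=
      (cdf.differentiableAt hn').hasFDerivAt.comp u.2 (hasFDerivAt_prodMk_right u.1 u.2)
    have h2 : HasFDerivAt (fun α => flowEquation w (u.1, α))
        (ContinuousLinearMap.id ℝ C(Icc (-1 : ℝ) 1, E)) u.2 := by
      have h3 : (fun α => flowEquation w (u.1, α)) = fun α => α - c x₀ := by
        ext α t
        simp [u, c, flowEquation_apply]
      rw [h3]
      exact (hasFDerivAt_id _).sub_const _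
    rw [h1.unique h2]
    exact ⟨ContinuousLinearEquiv.refl ℝ _, rfl⟩
  let g := cdf.implicitFunction hn' hinv
  have hg0 : g (0, x₀) = c x₀ := cdf.implicitFunction_apply_self hn' hinv
  have hgc : ContDiffAt ℝ n g (0, x₀) := cdf.contDiffAt_implicitFunction hn' hinv
  have ev1 : ∀ᶠ y in 𝓝 ((0 : ℝ), x₀), flowEquation w (y, g y) = 0 := by
    have := cdf.eventually_apply_implicitFunction hn' hinv
    rwa [hu] at this
  -- Local uniqueness: near `u` every zero of the equation lies on the graph of `g`.
  have ev2 : ∀ᶠ p in 𝓝 u, flowEquation w p = 0 → g p.1 = p.2 := by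
    filter_upwards [cdf.eventually_apply_eq_iff_implicitFunction hn' hinv] with p hp h
    exact hp.1 (h.trans hu.symm)
  obtain ⟨W, hW, B, hB, hWB⟩ := mem_nhds_prod_iff.1 ev2
  obtain ⟨r, hr, hrB⟩ := Metric.mem_nhds_iff.1 hB
  have ev3 : ∀ᶠ y in 𝓝 ((0 : ℝ), x₀), g y ∈ Metric.ball (c x₀) r := by
    refine hgc.continuousAt.eventually_mem ?_
    rw [hg0]
    exact Metric.ball_mem_nhds _ hr
  have ev4 : ∀ᶠ y in 𝓝 ((0 : ℝ), x₀), ContDiffAt ℝ n g y :=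
    hgc.eventually (by simp)
  obtain ⟨T, hT, U, hU, hTU⟩ := mem_nhds_prod_iff.1 (ev1.and (ev3.and (ev4.and hW)))
  obtain ⟨δ, hδ, hδT⟩ := Metric.mem_nhds_iff.1 hT
  rw [Real.ball_eq_Ioo, zero_sub, zero_add] at hδT
  have one : (1 : ℝ) ∈ Icc (-1 : ℝ) 1 := by norm_num
  -- solutions for different time scales are reparametrizations of each other
  have scale : ∀ x ∈ U, ∀ ε ∈ Ioo (-δ) δ, ∀ s : Icc (-1 : ℝ) 1,
      g (ε * s, x) ⟨1, one⟩ = g (ε, x) s := by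
    intro x hx ε hε s
    have hεs : ε * s ∈ Ioo (-δ) δ := by
      rw [mem_Ioo, ← abs_lt] at hε ⊢
      rw [abs_mul]
      exact (mul_le_of_le_one_right (abs_nonneg _) (abs_le.2 s.2)).trans_lt hε
    obtain ⟨h1, h2, -⟩ := hTU (mk_mem_prod (hδT hε) hx)
    obtain ⟨-, -, -, h3⟩ := hTU (mk_mem_prod (hδT hεs) hx)
    have h4 := flowEquation_rescale w h1 s
    have h5 : (g (ε, x)).comp (scaleIcc s) ∈ Metric.ball (c x₀) r := by
      rw [Metric.mem_ball] at h2 ⊢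
      refine lt_of_le_of_lt ?_ h2
      rw [ContinuousMap.dist_le dist_nonneg]
      exact fun t => ContinuousMap.dist_apply_le_dist (f := g (ε, x)) (g := c x₀) (scaleIcc s t)
    -- The rescaled curve is as close to the constant curve as the original one, so local uniqueness
    -- applies to it.
    have h6 : g (ε * s, x) = (g (ε, x)).comp (scaleIcc s) :=
      hWB (mk_mem_prod h3 (hrB h5)) h4
    rw [h6]
    simp only [ContinuousMap.comp_apply]
    congr 1
    ext
    simp [scaleIcc]
  have hδ2 : δ / 2 ∈ Ioo (-δ) δ := ⟨by linarith, by linarith⟩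
  -- All small times are read off the single curve `g (δ / 2, x)`, which is a primitive; this is
  -- what makes the time derivative computable.
  have formula : ∀ x ∈ U, ∀ t ∈ Ioo (-(δ / 2)) (δ / 2), g (t, x) ⟨1, one⟩ =
      x + (δ / 2) • ∫ s in (0 : ℝ)..(t / (δ / 2)),
        IccExtend (by norm_num : (-1 : ℝ) ≤ 1) (w.comp (g (δ / 2, x))) s := by
    intro x hx t ht
    have ht' : t / (δ / 2) ∈ Icc (-1 : ℝ) 1 := by
      rw [mem_Icc, le_div_iff₀ (by linarith), div_le_iff₀ (by linarith)]
      constructor <;> linarith [ht.1, ht.2]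
    have h1 := scale x hx (δ / 2) hδ2 ⟨_, ht'⟩
    rw [show (δ / 2) * (t / (δ / 2)) = t by field_simp] at h1
    rw [h1]
    have h2 := congrArg (fun β => β ⟨_, ht'⟩) (hTU (mk_mem_prod (hδT hδ2) hx)).1
    simp only [flowEquation_apply, ContinuousMap.zero_apply] at h2
    rw [sub_sub, sub_eq_zero] at h2
    exact h2
  -- The flow at time `t` is the endpoint, at parameter `1`, of the solution with time scale `t`. It
  -- is as regular as `g`, evaluation being linear.
  refine ⟨δ / 2, by positivity, U, hU, fun y => g y ⟨1, one⟩, ?_, ?_, ?_⟩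
  · rintro ⟨t, x⟩ ⟨ht, hx⟩
    have ht' : t ∈ Ioo (-δ) δ := ⟨by linarith [ht.1], by linarith [ht.2]⟩
    obtain ⟨-, -, h, -⟩ := hTU (mk_mem_prod (hδT ht') hx)
    exact ((ContinuousMap.evalCLM ℝ (⟨1, one⟩ : Icc (-1 : ℝ) 1)).contDiff.contDiffAt.comp _
      h).contDiffWithinAt
  · intro x hx
    refine (formula x hx 0 ⟨by linarith, by linarith⟩).trans ?_
    simp
  · intro x hx t ht
    have ht' : t / (δ / 2) ∈ Icc (-1 : ℝ) 1 := by
      rw [mem_Icc, le_div_iff₀ (by linarith), div_le_iff₀ (by linarith)]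
      constructor <;> linarith [ht.1, ht.2]
    have hc : Continuous (IccExtend (by norm_num : (-1 : ℝ) ≤ 1) (w.comp (g (δ / 2, x)))) :=
      (w.comp (g (δ / 2, x))).continuous.Icc_extend'
    have h2 : HasDerivAt (fun t => ∫ s in (0 : ℝ)..(t / (δ / 2)),
        IccExtend (by norm_num : (-1 : ℝ) ≤ 1) (w.comp (g (δ / 2, x))) s) _ t :=
      (hc.integral_hasStrictDerivAt 0 (t / (δ / 2))).hasDerivAt.scomp
        (h := fun t => t / (δ / 2)) t ((hasDerivAt_id t).div_const (δ / 2))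
    have h3 := (h2.const_smul (δ / 2)).const_add x
    have h4 : (fun s => g (s, x) ⟨1, one⟩) =ᶠ[𝓝 t] fun t => x + (δ / 2) •
        ∫ s in (0 : ℝ)..(t / (δ / 2)),
          IccExtend (by norm_num : (-1 : ℝ) ≤ 1) (w.comp (g (δ / 2, x))) s := by
      filter_upwards [Ioo_mem_nhds ht.1 ht.2] with s hs using formula x hx s hs
    refine (h3.congr_of_eventuallyEq h4).congr_deriv ?_
    rw [smul_smul, mul_one_div_cancel (by linarith), one_smul, IccExtend_of_mem _ _ ht']
    have h5 := scale x hx (δ / 2) hδ2 ⟨_, ht'⟩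
    rw [show (δ / 2) * (t / (δ / 2)) = t by field_simp] at h5
    simp only [h5]
    rfl

end Flow

/-- The flow theorem wants a field on the whole space; a bump function extends a chart expression
without changing it near the point. -/
theorem ContDiffAt.exists_contDiff_eventuallyEq {E F : Type*} [NormedAddCommGroup E]
    [NormedSpace ℝ E] [HasContDiffBump E] [NormedAddCommGroup F] [NormedSpace ℝ F] {f : E → F}
    {x : E} {n : ℕ} (hf : ContDiffAt ℝ n f x) : ∃ g : E → F, ContDiff ℝ n g ∧ g =ᶠ[𝓝 x] f := by
  have h := hf.eventually (by simp)
  obtain ⟨r, hr, hr'⟩ := Metric.mem_nhds_iff.1 h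
  let ρ : ContDiffBump x := ⟨r / 3, r / 2, by positivity, by linarith⟩
  refine ⟨fun y => ρ y • f y, ?_, ?_⟩
  · rw [contDiff_iff_contDiffAt]
    intro y
    by_cases hy : y ∈ Metric.ball x r
    · exact ρ.contDiffAt.smul (hr' hy)
    · have hy' : y ∉ tsupport ρ := by
        rw [ρ.tsupport_eq, Metric.mem_closedBall]
        rw [Metric.mem_ball, not_lt] at hy
        rw [not_le]
        exact (half_lt_self hr).trans_le hy
      have h0 : (fun y => ρ y • f y) =ᶠ[𝓝 y] fun _ => 0 := by
        filter_upwards [notMem_tsupport_iff_eventuallyEq.1 hy'] with z hz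
        simp [hz]
      exact contDiffAt_const.congr_of_eventuallyEq h0
  · filter_upwards [ρ.eventuallyEq_one] with y hy
    simp [hy]

/-! ### Local flows on a manifold -/

section

variable {m : ℕ} {M : Type*} [TopologicalSpace M] [ChartedSpace (EuclideanSpace ℝ (Fin m)) M]
  [IsManifold (𝓡 m) ∞ M]

/-- The expression of a vector field in the chart at `p₀`. -/
noncomputable def VField.inChart (X : VField m M) (p₀ : M) (y : EuclideanSpace ℝ (Fin m)) :
    EuclideanSpace ℝ (Fin m) :=
  tangentCoordChange (𝓡 m) ((extChartAt (𝓡 m) p₀).symm y) p₀ ((extChartAt (𝓡 m) p₀).symm y)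
    (X ((extChartAt (𝓡 m) p₀).symm y))

theorem VField.Smooth.contDiffAt_inChart {X : VField m M} (hX : X.Smooth) (p₀ : M) (n : ℕ) :
    ContDiffAt ℝ n (X.inChart p₀) (extChartAt (𝓡 m) p₀ p₀) := by
  have h := (hX p₀).of_le (m := n) (mod_cast le_top)
  rw [contMDiffAt_iff] at h
  have h2 := h.2.contDiffAt (by simp)
  exact h2.snd

/-- The curve solves its equation in the chart at `p₀`, while its manifold derivative at `t` is read
in the chart at the current point `q`; the cocycle identity for tangent coordinate changes
reconciles the two. -/
theorem hasMFDerivAt_extChartAt_symm_comp (X : VField m M) (p₀ : M)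
    {c : ℝ → EuclideanSpace ℝ (Fin m)} {t : ℝ} (hc : c t ∈ (extChartAt (𝓡 m) p₀).target)
    (h : HasDerivAt c (X.inChart p₀ (c t)) t) :
    HasMFDerivAt 𝓘(ℝ, ℝ) (𝓡 m) ((extChartAt (𝓡 m) p₀).symm ∘ c) t
      ((1 : ℝ →L[ℝ] ℝ).smulRight (X ((extChartAt (𝓡 m) p₀).symm (c t)))) := by
  set q : M := (extChartAt (𝓡 m) p₀).symm (c t) with hq
  have hq1 : q ∈ (extChartAt (𝓡 m) p₀).source := (extChartAt (𝓡 m) p₀).map_target hc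
  have hq2 := mem_extChartAt_source (I := 𝓡 m) q
  refine ⟨(continuousAt_extChartAt_symm'' hc).comp h.continuousAt,
    ?_⟩


  have h2 := hasFDerivWithinAt_tangentCoordChange (I := 𝓡 m) (x := p₀) (y := q) (z := q) ⟨hq1, hq2⟩
  rw [(extChartAt (𝓡 m) p₀).right_inv hc] at h2
  have h3 : HasDerivAt ((extChartAt (𝓡 m) q ∘ (extChartAt (𝓡 m) p₀).symm) ∘ c)
      (tangentCoordChange (𝓡 m) p₀ q q (X.inChart p₀ (c t))) t :=
    (h2.hasFDerivAt (by simp)).comp_hasDerivAt t h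
  have h4 : tangentCoordChange (𝓡 m) p₀ q q (X.inChart p₀ (c t)) = X q :=
    (tangentCoordChange_comp (I := 𝓡 m) (w := q) (x := p₀) (y := q) (z := q) (v := X q)
      ⟨⟨hq2, hq1⟩, hq2⟩).trans (tangentCoordChange_self (I := 𝓡 m) (x := q) (z := q) (v := X q) hq2)
  have h6 (w : EuclideanSpace ℝ (Fin m)) : ContinuousLinearMap.toSpanSingleton ℝ w =
      (1 : ℝ →L[ℝ] ℝ).smulRight w := by ext; simp
  have h5 : HasFDerivAt (𝕜 := ℝ) (E := ℝ) (F := EuclideanSpace ℝ (Fin m))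
      ((extChartAt (𝓡 m) q ∘ (extChartAt (𝓡 m) p₀).symm) ∘ c)
      ((1 : ℝ →L[ℝ] ℝ).smulRight (X q)) t :=
    (h3.congr_deriv h4).hasFDerivAt.congr_fderiv (h6 _)
  exact h5.hasFDerivWithinAt

/-- Local flow of a smooth vector field `X` together with the integral of a function `h` along
it. -/
theorem exists_local_flow {X : VField m M} (hX : X.Smooth) {h : M → ℝ} (hh : SmoothFun m h)
    (p₀ : M) {n : ℕ} (hn : n ≠ 0) :
    ∃ δ > 0, ∃ U : Set M, IsOpen U ∧ p₀ ∈ U ∧ ∃ (Φ : ℝ → M → M) (H : ℝ → M → ℝ),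
      ContMDiffOn (𝓘(ℝ, ℝ).prod (𝓡 m)) (𝓡 m) n (fun q : ℝ × M => Φ q.1 q.2)
        (Ioo (-δ) δ ×ˢ U) ∧
      ContMDiffOn (𝓘(ℝ, ℝ).prod (𝓡 m)) 𝓘(ℝ) n (fun q : ℝ × M => H q.1 q.2)
        (Ioo (-δ) δ ×ˢ U) ∧
      (∀ q ∈ U, Φ 0 q = q ∧ H 0 q = 0 ∧
        IsMIntegralCurveOn (I := 𝓡 m) (fun t => Φ t q) X (Ioo (-δ) δ) ∧
        ∀ t ∈ Ioo (-δ) δ, HasDerivAt (fun s => H s q) (h (Φ t q)) t) := by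
  set φ := extChartAt (𝓡 m) p₀ with hφ
  have htgt : IsOpen φ.target := isOpen_extChartAt_target p₀
  have hp₀ : p₀ ∈ φ.source := mem_extChartAt_source p₀
  obtain ⟨v, hv, hv'⟩ := (hX.contDiffAt_inChart p₀ n).exists_contDiff_eventuallyEq
  have hh' : ContDiffAt ℝ n (h ∘ φ.symm) (φ p₀) := by
    have h1 := ((hh.contMDiffAt (x := φ.symm (φ p₀))).comp (φ p₀)
      ((contMDiffOn_extChartAt_symm (n := ∞) p₀).contMDiffAt
        (htgt.mem_nhds (φ.map_source hp₀))))
    exact h1.contDiffAt.of_le (mod_cast le_top)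
  obtain ⟨k, hk, hk'⟩ := hh'.exists_contDiff_eventuallyEq
  -- The integral of `h` is adjoined as one more coordinate, so a single flow yields both `Φ` and
  -- `H`.
  let w : EuclideanSpace ℝ (Fin m) × ℝ → EuclideanSpace ℝ (Fin m) × ℝ := fun y => (v y.1, k y.1)
  have hw : ContDiff ℝ n w := (hv.comp contDiff_fst).prodMk (hk.comp contDiff_fst)
  obtain ⟨δ₀, hδ₀, U₀, hU₀, Ψ, hΨ, hΨ0, hΨd⟩ := exists_contDiffOn_local_flow hw (φ p₀, 0) hn
  have hgood : ∀ᶠ y in 𝓝 (φ p₀), y ∈ φ.target ∧ v y = X.inChart p₀ y ∧ k y = h (φ.symm y) :=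
    (htgt.eventually_mem (φ.map_source hp₀)).and (hv'.and hk')
  have hcont : ContinuousAt Ψ (0, (φ p₀, 0)) :=
    hΨ.continuousOn.continuousAt (prod_mem_nhds (Ioo_mem_nhds (by linarith) hδ₀) hU₀)
  -- For short times the flow stays where the cut-off expressions `v`, `k` agree with the original
  -- ones.
  have hev : ∀ᶠ z in 𝓝 ((0 : ℝ), (φ p₀, (0 : ℝ))), z ∈ Ioo (-δ₀) δ₀ ×ˢ U₀ ∧
      ((Ψ z).1 ∈ φ.target ∧ v (Ψ z).1 = X.inChart p₀ (Ψ z).1 ∧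
        k (Ψ z).1 = h (φ.symm (Ψ z).1)) := by
    refine Filter.Eventually.and (prod_mem_nhds (Ioo_mem_nhds (by linarith) hδ₀) hU₀) ?_
    have h1 : ContinuousAt (fun z => (Ψ z).1) ((0 : ℝ), (φ p₀, (0 : ℝ))) :=
      continuousAt_fst.comp hcont
    have h2 : (Ψ (0, (φ p₀, 0))).1 = φ p₀ := by rw [hΨ0 _ (mem_of_mem_nhds hU₀)]
    rw [← h2] at hgood
    exact h1.eventually hgood
  have hcφ : ContinuousAt (fun q : ℝ × M => (q.1, (φ q.2, (0 : ℝ)))) (0, p₀) := by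
    have : ContinuousAt (fun q : ℝ × M => φ q.2) (0, p₀) :=
      ContinuousAt.comp (f := Prod.snd) (continuousAt_extChartAt p₀) continuousAt_snd
    exact continuousAt_fst.prodMk (this.prodMk continuousAt_const)
  have hev2 : ∀ᶠ q in 𝓝 ((0 : ℝ), p₀), q.2 ∈ φ.source ∧ _ :=
    (continuousAt_snd.eventually_mem (extChartAt_source_mem_nhds p₀)).and (hcφ.eventually hev)
  obtain ⟨T, hT, U, hU, hTU⟩ := mem_nhds_prod_iff.1 hev2
  obtain ⟨δ, hδ, hδT⟩ := Metric.mem_nhds_iff.1 hT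
  rw [Real.ball_eq_Ioo, zero_sub, zero_add] at hδT
  obtain ⟨U', hU'U, hU'o, hpU'⟩ := mem_nhds_iff.1 hU
  have key : ∀ t ∈ Ioo (-δ) δ, ∀ q ∈ U', q ∈ φ.source ∧
      (t, (φ q, (0 : ℝ))) ∈ Ioo (-δ₀) δ₀ ×ˢ U₀ ∧
      ((Ψ (t, (φ q, 0))).1 ∈ φ.target ∧
        v (Ψ (t, (φ q, 0))).1 = X.inChart p₀ (Ψ (t, (φ q, 0))).1 ∧
        k (Ψ (t, (φ q, 0))).1 = h (φ.symm (Ψ (t, (φ q, 0))).1)) :=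
    fun t ht q hq => hTU (mk_mem_prod (hδT ht) (hU'U hq))
  have h0 : (0 : ℝ) ∈ Ioo (-δ) δ := ⟨by linarith, hδ⟩
  have hsmooth : ContMDiffOn (𝓘(ℝ, ℝ).prod (𝓡 m)) (𝓘(ℝ, EuclideanSpace ℝ (Fin m) × ℝ)) n
      (fun q : ℝ × M => Ψ (q.1, (φ q.2, 0))) (Ioo (-δ) δ ×ˢ U') := by
    have h1 : ContMDiffOn (𝓘(ℝ, ℝ).prod (𝓡 m))
        (𝓘(ℝ, ℝ × EuclideanSpace ℝ (Fin m) × ℝ)) n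
        (fun q : ℝ × M => (q.1, (φ q.2, (0 : ℝ)))) (Ioo (-δ) δ ×ˢ U') := by
      have h2 : ContMDiffOn (𝓘(ℝ, ℝ).prod (𝓡 m)) (𝓡 m) n
          (fun q : ℝ × M => φ q.2) (Ioo (-δ) δ ×ˢ U') :=
        ((contMDiffOn_extChartAt (I := 𝓡 m) (n := ∞) (x := p₀)).of_le (mod_cast le_top)).comp
          contMDiffOn_snd (fun q hq => by
            have := (key q.1 hq.1 q.2 hq.2).1
            rwa [extChartAt_source] at this)
      exact contMDiffOn_fst.prodMk_space (h2.prodMk_space contMDiffOn_const)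
    exact hΨ.contMDiffOn.comp h1 (fun q hq => (key q.1 hq.1 q.2 hq.2).2.1)
  refine ⟨δ, hδ, U', hU'o, hpU', fun t q => φ.symm (Ψ (t, (φ q, 0))).1,
    fun t q => (Ψ (t, (φ q, 0))).2, ?_, ?_, ?_⟩
  · have h1 := contDiff_fst.contMDiff.comp_contMDiffOn hsmooth
    exact ((contMDiffOn_extChartAt_symm (n := ∞) p₀).of_le (mod_cast le_top)).comp h1
      (fun q hq => (key q.1 hq.1 q.2 hq.2).2.2.1)
  · exact contDiff_snd.contMDiff.comp_contMDiffOn hsmooth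
  · intro q hq
    have hd : ∀ t ∈ Ioo (-δ) δ, HasDerivAt (fun s => Ψ (s, (φ q, 0)))
        (w (Ψ (t, (φ q, 0)))) t := fun t ht =>
      hΨd _ (key t ht q hq).2.1.2 t (key t ht q hq).2.1.1
    have hz : Ψ (0, (φ q, 0)) = (φ q, 0) := hΨ0 _ (key 0 h0 q hq).2.1.2
    refine ⟨?_, ?_, ?_, ?_⟩
    · simp only [hz]
      exact φ.left_inv (key 0 h0 q hq).1
    · simp only [hz]
    · intro t ht
      obtain ⟨-, -, h1, h2, -⟩ := key t ht q hq
      have h3 := (hd t ht).fst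
      simp only [w, h2] at h3
      exact (hasMFDerivAt_extChartAt_symm_comp X p₀ (c := fun s => (Ψ (s, (φ q, 0))).1) h1
        h3).hasMFDerivWithinAt
    · intro t ht
      obtain ⟨-, -, h1, h2, h4⟩ := key t ht q hq
      have h3 := (hd t ht).snd
      simp only [w, h4] at h3
      exact h3

end

/-! ### Integral curves and the solution of the transport equation -/

section

variable {m : ℕ} {M : Type*} [TopologicalSpace M] [ChartedSpace (EuclideanSpace ℝ (Fin m)) M]
  [IsManifold (𝓡 m) ∞ M]

theorem hasDerivAt_comp_integralCurve {X : VField m M} {c : ℝ → M} {a b t : ℝ}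
    (hc : IsMIntegralCurveOn (I := 𝓡 m) c X (Ioo a b)) (ht : t ∈ Ioo a b) {f : M → ℝ}
    (hf : MDifferentiableAt (𝓡 m) 𝓘(ℝ) f (c t)) :
    HasDerivAt (fun s => f (c s)) (dif m f (c t) (X (c t))) t := by
  have h1 := (hc t ht).hasMFDerivAt (Ioo_mem_nhds ht.1 ht.2)
  have h2 := hf.hasMFDerivAt.comp t h1
  have h3 : HasFDerivAt (𝕜 := ℝ) (E := ℝ) (F := ℝ) (f ∘ c)
      ((dif m f (c t)).comp ((1 : ℝ →L[ℝ] ℝ).smulRight (X (c t)))) t := h2.hasFDerivAt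
  exact h3.hasDerivAt.congr_deriv (by simp)

theorem eq_add_const_of_hasDerivAt {f g f' : ℝ → ℝ} {a b s t : ℝ}
    (hf : ∀ r ∈ Ioo a b, HasDerivAt f (f' r) r) (hg : ∀ r ∈ Ioo a b, HasDerivAt g (f' r) r)
    (hs : s ∈ Ioo a b) (ht : t ∈ Ioo a b) : f t - f s = g t - g s := by
  have h := (convex_Ioo a b).is_const_of_fderivWithin_eq_zero (𝕜 := ℝ) (f := fun r => f r - g r)
    (fun r hr => ((hf r hr).sub (hg r hr)).differentiableAt.differentiableWithinAt)
    (fun r hr => by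
      have h1 := ((hf r hr).sub (hg r hr)).hasFDerivAt.hasFDerivWithinAt (s := Ioo a b)
      have h2 := h1.fderivWithin (isOpen_Ioo.uniqueDiffWithinAt hr)
      rw [sub_self] at h2
      refine h2.trans ?_
      ext; simp) hs ht
  linarith

theorem exists_primitive_on_Ioo {f : ℝ → ℝ} {a b : ℝ} (hf : ContinuousOn f (Ioo a b)) :
    ∃ g : ℝ → ℝ, ∀ t ∈ Ioo a b, HasDerivAt g (f t) t := by
  rcases (Ioo a b).eq_empty_or_nonempty with h | ⟨s, hs⟩
  · exact ⟨0, fun t ht => by simp [h] at ht⟩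
  · refine ⟨fun t => ∫ r in s..t, f r, fun t ht => ?_⟩
    refine intervalIntegral.integral_hasDerivAt_right ?_ ?_ ?_
    · exact (hf.mono (ordConnected_Ioo.uIcc_subset hs ht)).intervalIntegrable
    · exact hf.stronglyMeasurableAtFilter isOpen_Ioo t ht
    · exact hf.continuousAt (Ioo_mem_nhds ht.1 ht.2)

variable [T2Space M]

theorem VField.Smooth.contMDiff_one {X : VField m M} (hX : X.Smooth) :
    ContMDiff (𝓡 m) (𝓡 m).tangent 1 (fun p => (⟨p, X p⟩ : TangentBundle (𝓡 m) M)) :=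
  ContMDiff.of_le hX (mod_cast le_top)

/-- Two integral curves through a common point extend to a common integral curve. -/
theorem exists_glue_integralCurve {X : VField m M} (hX : X.Smooth) {c c' : ℝ → M}
    {a b a' b' t₀ : ℝ} (hc : IsMIntegralCurveOn (I := 𝓡 m) c X (Ioo a b))
    (hc' : IsMIntegralCurveOn (I := 𝓡 m) c' X (Ioo a' b')) (h : t₀ ∈ Ioo a b)
    (h' : t₀ ∈ Ioo a' b') (heq : c t₀ = c' t₀) :
    ∃ C : ℝ → M, IsMIntegralCurveOn (I := 𝓡 m) C X (Ioo (min a a') (max b b')) ∧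
      EqOn C c (Ioo a b) ∧ EqOn C c' (Ioo a' b') := by
  classical
  refine ⟨piecewise (Ioo a b) c c', ?_, piecewise_eqOn _ _ _, ?_⟩
  · have := isMIntegralCurveOn_piecewise hX.contMDiff_one hc hc' ⟨h, h'⟩ heq
    rwa [Ioo_union_Ioo' (h'.1.trans h.2) (h.1.trans h'.2)] at this
  · exact eqOn_piecewise_of_isMIntegralCurveOn_Ioo hX.contMDiff_one hc hc' ⟨h, h'⟩ heq

theorem isMIntegralCurveOn_shift {X : VField m M} {c : ℝ → M} {a b : ℝ}
    (hc : IsMIntegralCurveOn (I := 𝓡 m) c X (Ioo a b)) (r : ℝ) :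
    IsMIntegralCurveOn (I := 𝓡 m) (fun s => c (s + r)) X (Ioo (a - r) (b - r)) := by
  refine (hc.comp_add r).mono fun t ht => ?_
  exact ⟨by linarith [ht.1], by linarith [ht.2]⟩

namespace HData

/-- `y` is the value at `p` of the solution `f` of `n(f) = h` with `f = f₀` on `S`, computed along
an integral curve of `n`. -/
def IsTransportValue (D : HData m M) (S : Set M) (h f₀ : M → ℝ) (p : M) (y : ℝ) : Prop :=
  ∃ (c : ℝ → M) (a b s t : ℝ) (g : ℝ → ℝ), s ∈ Ioo a b ∧ t ∈ Ioo a b ∧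
    IsMIntegralCurveOn (I := 𝓡 m) c D.n (Ioo a b) ∧
    (∀ r ∈ Ioo a b, HasDerivAt g (h (c r)) r) ∧ c s = p ∧ c t ∈ S ∧ y = f₀ (c t) - (g t - g s)

variable {D : HData m M} {S : Set M}

/-- The curve from `meets`, shifted in time so that both pass through `c s` at time `s`, is glued on
to reach `S`. -/
theorem IsSection.exists_extend (hS : D.IsSection S) (hn : D.n.Smooth) {c : ℝ → M} {a b s : ℝ}
    (hc : IsMIntegralCurveOn (I := 𝓡 m) c D.n (Ioo a b)) (hs : s ∈ Ioo a b) :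
    ∃ (C : ℝ → M) (A B t : ℝ), Ioo a b ⊆ Ioo A B ∧ t ∈ Ioo A B ∧
      IsMIntegralCurveOn (I := 𝓡 m) C D.n (Ioo A B) ∧ EqOn C c (Ioo a b) ∧ C t ∈ S := by
  obtain ⟨c', a', b', t, h0, ht, hc', hc0, hct⟩ := hS.meets (c s)
  have h1 := isMIntegralCurveOn_shift hc' (-s)
  have hs' : s ∈ Ioo (a' - -s) (b' - -s) := ⟨by linarith [h0.1], by linarith [h0.2]⟩
  obtain ⟨C, hC, hCc, hCc'⟩ := exists_glue_integralCurve hn hc h1 hs hs' (by simp [hc0])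
  have ht' : t + s ∈ Ioo (a' - -s) (b' - -s) := ⟨by linarith [ht.1], by linarith [ht.2]⟩
  refine ⟨C, _, _, t + s, Ioo_subset_Ioo (min_le_left _ _) (le_max_left _ _),
    Ioo_subset_Ioo (min_le_right _ _) (le_max_right _ _) ht', hC, hCc, ?_⟩
  rw [hCc' ht']
  simpa using hct

/-- After a time shift both curves are pieces of one integral curve. It meets `S` only once, so the
hitting points agree, and two primitives of `h` along it differ by a constant. -/
theorem IsSection.transportValue_unique (hS : D.IsSection S) (hn : D.n.Smooth) {h f₀ : M → ℝ}
    {p : M} {y y' : ℝ} (hy : D.IsTransportValue S h f₀ p y)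
    (hy' : D.IsTransportValue S h f₀ p y') : y = y' := by
  obtain ⟨c, a, b, s, t, g, hs, ht, hc, hg, hcs, hct, rfl⟩ := hy
  obtain ⟨c', a', b', s', t', g', hs', ht', hc', hg', hcs', hct', rfl⟩ := hy'
  have h1 := isMIntegralCurveOn_shift hc' (s' - s)
  have h2 : s ∈ Ioo (a' - (s' - s)) (b' - (s' - s)) := ⟨by linarith [hs'.1], by linarith [hs'.2]⟩
  have h3 : t' - (s' - s) ∈ Ioo (a' - (s' - s)) (b' - (s' - s)) :=
    ⟨by linarith [ht'.1], by linarith [ht'.2]⟩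
  obtain ⟨C, hC, hCc, hCc'⟩ := exists_glue_integralCurve hn hc h1 hs h2 (by simp [hcs, hcs'])
  have e1 := hCc ht
  have e2 := hCc' h3
  simp only [sub_add_cancel] at e2
  have htt : t = t' - (s' - s) := hS.meets_once C _ _ t (t' - (s' - s))
    (Ioo_subset_Ioo (min_le_left _ _) (le_max_left _ _) ht)
    (Ioo_subset_Ioo (min_le_right _ _) (le_max_right _ _) h3) hC (by rwa [e1]) (by rwa [e2])
  have e3 : c t = c' t' := by rw [← e1, ← e2, htt]
  have e4 : g t - g s = g' (t + (s' - s)) - g' (s + (s' - s)) := by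
    refine eq_add_const_of_hasDerivAt (f' := fun r => h (C r)) (f := g)
      (g := fun r => g' (r + (s' - s))) (a := max a (a' - (s' - s))) (b := min b (b' - (s' - s)))
      (fun r hr => ?_) (fun r hr => ?_)
      ⟨max_lt hs.1 h2.1, lt_min hs.2 h2.2⟩ ⟨max_lt ht.1 (htt ▸ h3.1), lt_min ht.2 (htt ▸ h3.2)⟩
    · have hr1 : r ∈ Ioo a b := ⟨(le_max_left _ _).trans_lt hr.1, hr.2.trans_le (min_le_left _ _)⟩
      rw [hCc hr1]
      exact hg r hr1
    · have hr1 : r ∈ Ioo (a' - (s' - s)) (b' - (s' - s)) :=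
        ⟨(le_max_right _ _).trans_lt hr.1, hr.2.trans_le (min_le_right _ _)⟩
      rw [hCc' hr1]
      exact (hg' _ ⟨by linarith [hr1.1], by linarith [hr1.2]⟩).comp_add_const r (s' - s)
  rw [e3, e4]
  congr 3 <;> linarith

open Classical in
/-- The solution of `n(f) = h` with `f = f₀` on the section `S`. -/
noncomputable def transport (D : HData m M) (S : Set M) (h f₀ : M → ℝ) (p : M) : ℝ :=
  if H : ∃ y, D.IsTransportValue S h f₀ p y then H.choose else 0

theorem IsSection.transport_eq (hS : D.IsSection S) (hn : D.n.Smooth) {h f₀ : M → ℝ}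
    {p : M} {y : ℝ} (hy : D.IsTransportValue S h f₀ p y) : D.transport S h f₀ p = y := by
  unfold transport
  rw [dif_pos ⟨y, hy⟩]
  exact hS.transportValue_unique hn (Exists.choose_spec ⟨y, hy⟩) hy

/-- The integrated form of `n(f) = h`. It presupposes no differentiability of the solution, and both
the differential equation and the regularity are deduced from it. -/
theorem IsSection.transport_curve (hS : D.IsSection S) (hn : D.n.Smooth) {h : M → ℝ}
    (hh : Continuous h) (f₀ : M → ℝ) {c : ℝ → M} {a b s t : ℝ} {g : ℝ → ℝ}
    (hc : IsMIntegralCurveOn (I := 𝓡 m) c D.n (Ioo a b))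
    (hg : ∀ r ∈ Ioo a b, HasDerivAt g (h (c r)) r) (hs : s ∈ Ioo a b) (ht : t ∈ Ioo a b) :
    D.transport S h f₀ (c t) = D.transport S h f₀ (c s) + (g t - g s) := by
  obtain ⟨C, A, B, r, hsub, hr, hC, hCc, hCr⟩ := hS.exists_extend hn hc hs
  obtain ⟨G, hG⟩ := exists_primitive_on_Ioo (hh.comp_continuousOn hC.continuousOn)
  rw [hS.transport_eq hn (p := c t) ⟨C, A, B, t, r, G, hsub ht, hr, hC, hG, hCc ht, hCr, rfl⟩,
    hS.transport_eq hn (p := c s) ⟨C, A, B, s, r, G, hsub hs, hr, hC, hG, hCc hs, hCr, rfl⟩,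
    eq_add_const_of_hasDerivAt hg (fun q hq => by
      have := hG q (hsub hq)
      simp only [Function.comp_apply, hCc hq] at this
      exact this) hs ht]
  ring

theorem IsSection.transport_of_mem (hS : D.IsSection S) (hn : D.n.Smooth) {h : M → ℝ}
    (hh : Continuous h) (f₀ : M → ℝ) {p : M} (hp : p ∈ S) : D.transport S h f₀ p = f₀ p := by
  obtain ⟨c, a, b, t, h0, ht, hc, hc0, hct⟩ := hS.meets p
  obtain ⟨g, hg⟩ := exists_primitive_on_Ioo (hh.comp_continuousOn hc.continuousOn)
  rw [hS.transport_eq hn (p := p) ⟨c, a, b, 0, 0, g, h0, h0, hc, hg, hc0, by rwa [hc0], rfl⟩]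
  simp [hc0]

theorem IsSection.transport_hasDeriv (hS : D.IsSection S) (hn : D.n.Smooth) {h : M → ℝ}
    (hh : SmoothFun m h) (f₀ : M → ℝ) {p : M}
    (hf : MDifferentiableAt (𝓡 m) 𝓘(ℝ) (D.transport S h f₀) p) :
    dif m (D.transport S h f₀) p (D.n p) = h p := by
  obtain ⟨c, a, b, t, h0, ht, hc, rfl, hct⟩ := hS.meets p
  obtain ⟨g, hg⟩ := exists_primitive_on_Ioo (hh.continuous.comp_continuousOn hc.continuousOn)
  have h1 := hasDerivAt_comp_integralCurve hc h0 hf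
  have h2 : (fun s => D.transport S h f₀ (c s)) =ᶠ[𝓝 0]
      fun s => D.transport S h f₀ (c 0) + (g s - g 0) := by
    filter_upwards [Ioo_mem_nhds h0.1 h0.2] with s hs
    exact hS.transport_curve hn hh.continuous f₀ hc hg h0 hs
  exact h1.unique ((((hg 0 h0).sub_const (g 0)).const_add _).congr_of_eventuallyEq h2)

/-- Functions with the same derivative along `n` and the same values on a section are equal. -/
theorem IsSection.eq_of_dif_eq (hS : D.IsSection S) {f g : M → ℝ} (hf : SmoothFun m f)
    (hg : SmoothFun m g) (hd : ∀ p, dif m f p (D.n p) = dif m g p (D.n p))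
    (h0 : ∀ p ∈ S, f p = g p) : f = g := by
  ext p
  obtain ⟨c, a, b, t, h1, ht, hc, rfl, hct⟩ := hS.meets p
  have h2 := eq_add_const_of_hasDerivAt (f' := fun r => dif m f (c r) (D.n (c r)))
    (fun r hr => hasDerivAt_comp_integralCurve hc hr ((hf (c r)).mdifferentiableAt (by simp)))
    (fun r hr => by
      rw [hd]
      exact hasDerivAt_comp_integralCurve hc hr ((hg (c r)).mdifferentiableAt (by simp))) h1 ht
  have h3 := h0 _ hct
  linarith

end HData

end

/-! ### Smoothness of the solution of the transport equation -/

section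

variable {m : ℕ} {M : Type*} [TopologicalSpace M] [ChartedSpace (EuclideanSpace ℝ (Fin m)) M]
  [IsManifold (𝓡 m) ∞ M]

/-- Implicit function theorem for the time variable on `ℝ × M`. -/
theorem exists_time_implicit {G : ℝ → M → ℝ} {p : M} {n : ℕ} (hn : n ≠ 0)
    (hG : ContMDiffAt (𝓘(ℝ, ℝ).prod (𝓡 m)) 𝓘(ℝ) n (fun q : ℝ × M => G q.1 q.2) (0, p))
    (hp : G 0 p = 0) {d : ℝ} (hd : d ≠ 0) (hG' : HasDerivAt (fun t => G t p) d 0) :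
    ∃ τ : M → ℝ, ContMDiffAt (𝓡 m) 𝓘(ℝ) n τ p ∧ τ p = 0 ∧ ∀ᶠ q in 𝓝 p, G (τ q) q = 0 := by
  set φ := extChartAt (𝓡 m) p with hφ
  have htgt : IsOpen φ.target := isOpen_extChartAt_target p
  have hpφ : p ∈ φ.source := mem_extChartAt_source p
  have hn' : (n : WithTop ℕ∞) ≠ 0 := by exact_mod_cast hn
  -- Time goes into the second factor, the variable for which the implicit function theorem solves.
  let f : EuclideanSpace ℝ (Fin m) × ℝ → ℝ := fun y => G y.2 (φ.symm y.1)
  have hf : ContDiffAt ℝ n f (φ p, 0) := by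
    rw [← contMDiffAt_iff_contDiffAt]
    have h1 : ContMDiffAt 𝓘(ℝ, EuclideanSpace ℝ (Fin m) × ℝ) (𝓡 m) n
        (fun y : EuclideanSpace ℝ (Fin m) × ℝ => φ.symm y.1) (φ p, 0) := by
      have h2 : ContMDiffAt (𝓡 m) (𝓡 m) n φ.symm (φ p) :=
        ((contMDiffOn_extChartAt_symm (n := ∞) p).contMDiffAt
          (htgt.mem_nhds (φ.map_source hpφ))).of_le (mod_cast le_top)
      exact ContMDiffAt.comp (f := Prod.fst) (φ p, (0 : ℝ)) h2 contDiff_fst.contMDiff.contMDiffAt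
    have h3 : ContMDiffAt 𝓘(ℝ, EuclideanSpace ℝ (Fin m) × ℝ) (𝓘(ℝ, ℝ).prod (𝓡 m)) n
        (fun y : EuclideanSpace ℝ (Fin m) × ℝ => (y.2, φ.symm y.1)) (φ p, 0) :=
      (contDiff_snd.contMDiff.contMDiffAt).prodMk h1
    have h4 : (((φ p, (0 : ℝ)).2, φ.symm (φ p, (0 : ℝ)).1) : ℝ × M) = (0, p) := by
      simp only [φ.left_inv hpφ]
    rw [← h4] at hG
    exact ContMDiffAt.comp (g := fun q : ℝ × M => G q.1 q.2) (φ p, (0 : ℝ)) hG h3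
  have hinv : (fderiv ℝ f (φ p, 0) ∘L .inr ℝ _ _).IsInvertible := by
    have h1 : HasFDerivAt (fun t => f (φ p, t)) (fderiv ℝ f (φ p, 0) ∘L .inr ℝ _ _) 0 :=
      (hf.differentiableAt hn').hasFDerivAt.comp (0 : ℝ) (hasFDerivAt_prodMk_right (φ p) (0 : ℝ))
    have h2 : HasDerivAt (fun t => f (φ p, t)) d 0 := by
      simpa only [f, φ.left_inv hpφ] using hG'
    rw [h1.unique h2.hasFDerivAt]
    refine ⟨ContinuousLinearEquiv.unitsEquivAut ℝ (Units.mk0 d hd), ?_⟩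
    ext
    simp
  refine ⟨fun q => hf.implicitFunction hn' hinv (φ q), ?_, ?_, ?_⟩
  · have h1 : ContMDiffAt (𝓡 m) (𝓡 m) n φ p :=
      (contMDiffAt_extChartAt (n := ∞)).of_le (mod_cast le_top)
    exact (hf.contDiffAt_implicitFunction hn' hinv).contMDiffAt.comp p h1
  · exact hf.implicitFunction_apply_self hn' hinv
  · have h1 := (continuousAt_extChartAt (I := 𝓡 m) p).eventually
      (hf.eventually_apply_implicitFunction hn' hinv)
    filter_upwards [h1, extChartAt_source_mem_nhds (I := 𝓡 m) p] with q hq hq'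
    simp only [f, φ.left_inv hpφ, hp] at hq
    rwa [φ.left_inv hq'] at hq

variable [T2Space M]

namespace HData

variable {D : HData m M} {S : Set M}

/-- By transversality the time `τ` needed to reach `S` is of class `C^k` near `p`, and the solution
is `q ↦ f₀(Φ (τ q) q) - H (τ q) q`. -/
theorem IsSection.transport_contMDiffAt_of_mem (hS : D.IsSection S) (hn : D.n.Smooth)
    {h : M → ℝ} (hh : SmoothFun m h) {f₀ : M → ℝ} (hf₀ : ContMDiffOn (𝓡 m) 𝓘(ℝ) ∞ f₀ S) {p : M}
    (hp : p ∈ S) {k : ℕ} (hk : k ≠ 0) :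
    ContMDiffAt (𝓡 m) 𝓘(ℝ) k (D.transport S h f₀) p := by
  obtain ⟨W, g, hW, hpW, hg, hSW, hdg⟩ := hS.hypersurface p hp
  obtain ⟨δ, hδ, U, hU, hpU, Φ, H, hΦ, hH, hflow⟩ := exists_local_flow hn hh p hk
  have h0 : (0 : ℝ) ∈ Ioo (-δ) δ := ⟨by linarith, hδ⟩
  have hnhds : Ioo (-δ) δ ×ˢ U ∈ 𝓝 ((0 : ℝ), p) :=
    prod_mem_nhds (isOpen_Ioo.mem_nhds h0) (hU.mem_nhds hpU)
  have hΦp := hΦ.contMDiffAt hnhds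
  have hHp := hH.contMDiffAt hnhds
  have hΦ0 : Φ 0 p = p := (hflow p hpU).1
  have hgp : ContMDiffAt (𝓡 m) 𝓘(ℝ) k g p :=
    (hg.contMDiffAt (hW.mem_nhds hpW)).of_le (mod_cast le_top)
  have hgz : g p = 0 := by
    have : p ∈ {q ∈ W | g q = 0} := hSW ▸ ⟨hp, hpW⟩
    exact this.2
  obtain ⟨τ, hτ, hτp, hτ0⟩ := exists_time_implicit (G := fun t q => g (Φ t q)) (p := p) hk
    (by
      rw [← hΦ0] at hgp
      exact ContMDiffAt.comp (g := g) ((0 : ℝ), p) hgp hΦp)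
    (by simp only [hΦ0, hgz]) hdg (by
      have h1 := hasDerivAt_comp_integralCurve (f := g) (hflow p hpU).2.2.1 h0
        (by rw [hΦ0]; exact hgp.mdifferentiableAt (by exact_mod_cast hk))
      convert h1 using 2 <;> rw [hΦ0])
  have hpair : ContMDiffAt (𝓡 m) (𝓘(ℝ, ℝ).prod (𝓡 m)) k (fun q => (τ q, q)) p :=
    hτ.prodMk contMDiffAt_id
  have hΦτ : ContMDiffAt (𝓡 m) (𝓡 m) k (fun q => Φ (τ q) q) p := by
    rw [← hτp] at hΦp
    exact ContMDiffAt.comp (g := fun q : ℝ × M => Φ q.1 q.2) (f := fun q => (τ q, q)) p hΦp hpair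
  have hHτ : ContMDiffAt (𝓡 m) 𝓘(ℝ) k (fun q => H (τ q) q) p := by
    rw [← hτp] at hHp
    exact ContMDiffAt.comp (g := fun q : ℝ × M => H q.1 q.2) (f := fun q => (τ q, q)) p hHp hpair
  have hΦτp : Φ (τ p) p = p := by rw [hτp, hΦ0]
  have hmem : ∀ᶠ q in 𝓝 p, Φ (τ q) q ∈ S := by
    have h1 : ∀ᶠ q in 𝓝 p, Φ (τ q) q ∈ W :=
      hΦτ.continuousAt.eventually_mem (by rw [hΦτp]; exact hW.mem_nhds hpW)
    filter_upwards [h1, hτ0] with q hq hq'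
    have : Φ (τ q) q ∈ S ∩ W := hSW ▸ ⟨hq, hq'⟩
    exact this.1
  -- `f₀` is regular only along `S`, so the composition is taken within the set of points flowing
  -- into `S`; `hmem` says that this set is a neighbourhood of `p`.
  have hfτ : ContMDiffAt (𝓡 m) 𝓘(ℝ) k (fun q => f₀ (Φ (τ q) q)) p := by
    have h1 : ContMDiffWithinAt (𝓡 m) 𝓘(ℝ) k f₀ S (Φ (τ p) p) := by
      rw [hΦτp]
      exact (hf₀ p hp).of_le (mod_cast le_top)
    exact (ContMDiffWithinAt.comp (g := f₀) (f := fun q => Φ (τ q) q) (t := S)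
      (s := {q | Φ (τ q) q ∈ S}) p h1
      hΦτ.contMDiffWithinAt fun q hq => hq).contMDiffAt hmem
  refine (hfτ.sub hHτ).congr_of_eventuallyEq ?_
  have hτδ : ∀ᶠ q in 𝓝 p, τ q ∈ Ioo (-δ) δ :=
    hτ.continuousAt.eventually_mem (by rw [hτp]; exact isOpen_Ioo.mem_nhds h0)
  filter_upwards [hmem, hτδ, hU.mem_nhds hpU] with q hq hqδ hqU
  have h1 := hS.transport_curve hn hh.continuous f₀ (hflow q hqU).2.2.1 (hflow q hqU).2.2.2 h0 hqδ
  rw [hS.transport_of_mem hn hh.continuous f₀ hq, (hflow q hqU).1, (hflow q hqU).2.1] at h1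
  change _ = f₀ (Φ (τ q) q) - H (τ q) q
  linarith

/-- Near `p` the solution is its own composition with the flow for time `s - t`, minus `H`, so
regularity travels from `c s` to `p`. The reach `ε` does not depend on `s`; hence limits of good
parameters are good. -/
theorem IsSection.transport_contMDiffAt_of_flow (hS : D.IsSection S) (hn : D.n.Smooth)
    {h : M → ℝ} (hh : SmoothFun m h) (f₀ : M → ℝ) (p : M) {k : ℕ} (hk : k ≠ 0)
    {c : ℝ → M} {a b t : ℝ} (hc : IsMIntegralCurveOn (I := 𝓡 m) c D.n (Ioo a b))
    (ht : t ∈ Ioo a b) (hct : c t = p) :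
    ∃ ε > 0, ∀ s ∈ Ioo a b, |s - t| < ε →
      (∀ᶠ q in 𝓝 (c s), ContMDiffAt (𝓡 m) 𝓘(ℝ) k (D.transport S h f₀) q) →
      ∀ᶠ q in 𝓝 p, ContMDiffAt (𝓡 m) 𝓘(ℝ) k (D.transport S h f₀) q := by
  obtain ⟨δ, hδ, U, hU, hpU, Φ, H, hΦ, hH, hflow⟩ := exists_local_flow hn hh p hk
  have h0 : (0 : ℝ) ∈ Ioo (-δ) δ := ⟨by linarith, hδ⟩
  refine ⟨δ, hδ, fun s hs hst hev => ?_⟩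
  have hr : s - t ∈ Ioo (-δ) δ := abs_lt.1 hst
  have hΦs : Φ (s - t) p = c s := by
    have h1 := isMIntegralCurveOn_shift (hflow p hpU).2.2.1 (-t)
    have h2 : t ∈ Ioo (-δ - -t) (δ - -t) := ⟨by linarith, by linarith⟩
    obtain ⟨C, -, hC1, hC2⟩ := exists_glue_integralCurve hn hc h1 ht h2
      (by simp [hct, (hflow p hpU).1])
    have h3 : s ∈ Ioo (-δ - -t) (δ - -t) := ⟨by linarith [hr.1], by linarith [hr.2]⟩
    rw [← hC1 hs, hC2 h3, sub_eq_add_neg]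
  have hΦr : ∀ q ∈ U, ContMDiffAt (𝓡 m) (𝓡 m) k (fun q => Φ (s - t) q) q := fun q hq =>
    ContMDiffAt.comp (g := fun q : ℝ × M => Φ q.1 q.2) q
      (hΦ.contMDiffAt (prod_mem_nhds (isOpen_Ioo.mem_nhds hr) (hU.mem_nhds hq)))
      (contMDiffAt_const.prodMk contMDiffAt_id)
  have hHr : ∀ q ∈ U, ContMDiffAt (𝓡 m) 𝓘(ℝ) k (fun q => H (s - t) q) q := fun q hq =>
    ContMDiffAt.comp (g := fun q : ℝ × M => H q.1 q.2) q
      (hH.contMDiffAt (prod_mem_nhds (isOpen_Ioo.mem_nhds hr) (hU.mem_nhds hq)))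
      (contMDiffAt_const.prodMk contMDiffAt_id)
  rw [← hΦs] at hev
  filter_upwards [(hΦr p hpU).continuousAt.eventually hev, hU.mem_nhds hpU] with q hq hqU
  refine ((ContMDiffAt.comp q hq (hΦr q hqU)).sub (hHr q hqU)).congr_of_eventuallyEq ?_
  filter_upwards [hU.mem_nhds hqU] with q' hq'
  have h1 := hS.transport_curve hn hh.continuous f₀ (hflow q' hq').2.2.1 (hflow q' hq').2.2.2 h0 hr
  rw [(hflow q' hq').1, (hflow q' hq').2.1] at h1
  change _ = D.transport S h f₀ (Φ (s - t) q') - H (s - t) q'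
  linarith

/-- For each finite order, the good parameters along a curve from the point to `S` form a nonempty,
open and relatively closed subset of an interval. The flow domains may shrink as the order grows,
which is harmless since each order is a pointwise statement. -/
theorem IsSection.transport_smooth (hS : D.IsSection S) (hn : D.n.Smooth)
    {h : M → ℝ} (hh : SmoothFun m h) {f₀ : M → ℝ} (hf₀ : ContMDiffOn (𝓡 m) 𝓘(ℝ) ∞ f₀ S) :
    SmoothFun m (D.transport S h f₀) := by
  suffices H : ∀ k : ℕ, k ≠ 0 → ContMDiff (𝓡 m) 𝓘(ℝ) k (D.transport S h f₀) by
    refine contMDiff_infty.2 fun k => ?_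
    exact (H (k + 1) (by omega)).of_le (by exact_mod_cast Nat.le_succ k)
  intro k hk p
  obtain ⟨c, a, b, t, h0, ht, hc, rfl, hct⟩ := hS.meets p
  let G : Set ℝ := {s | ∀ᶠ q in 𝓝 (c s), ContMDiffAt (𝓡 m) 𝓘(ℝ) k (D.transport S h f₀) q}
  have hsub : Ioo a b ⊆ G ∩ Ioo a b := by
    refine isPreconnected_Ioo.subset_of_closure_inter_subset (u := G ∩ Ioo a b) ?_ ?_ ?_
    · rw [isOpen_iff_mem_nhds]
      rintro s ⟨hs, hs'⟩
      have h1 := ((hc.continuousOn.continuousAt (isOpen_Ioo.mem_nhds hs')).eventually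
        (eventually_eventually_nhds.2 hs))
      exact h1.and (isOpen_Ioo.mem_nhds hs')
    · refine ⟨t, ht, ?_, ht⟩
      exact contMDiffAt_iff_contMDiffAt_nhds (by simp) |>.1
        (hS.transport_contMDiffAt_of_mem hn hh hf₀ hct hk)
    · rintro s ⟨hs, hs'⟩
      obtain ⟨ε, hε, hε'⟩ := hS.transport_contMDiffAt_of_flow hn hh f₀ (c s) hk hc hs' rfl
      obtain ⟨r, hr, hrs⟩ := Metric.mem_closure_iff.1 hs ε hε
      refine ⟨hε' r hr.2 ?_ hr.1, hs'⟩
      rwa [dist_comm, Real.dist_eq] at hrs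
  exact (hsub h0).1.self_of_nhds

end HData

end

/-! ### Calculus of smooth functions and of their differentials -/

section

variable {m : ℕ} {M : Type*} [TopologicalSpace M] [ChartedSpace (EuclideanSpace ℝ (Fin m)) M]

theorem SmoothFun.mdiff {f : M → ℝ} (hf : SmoothFun m f) (p : M) :
    MDifferentiableAt (𝓡 m) 𝓘(ℝ) f p :=
  (hf p).mdifferentiableAt (by simp)

theorem SmoothFun.add {f g : M → ℝ} (hf : SmoothFun m f) (hg : SmoothFun m g) :
    SmoothFun m (fun p => f p + g p) :=
  ContMDiff.add hf hg

theorem SmoothFun.sub {f g : M → ℝ} (hf : SmoothFun m f) (hg : SmoothFun m g) :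
    SmoothFun m (fun p => f p - g p) :=
  ContMDiff.sub hf hg

theorem SmoothFun.mul {f g : M → ℝ} (hf : SmoothFun m f) (hg : SmoothFun m g) :
    SmoothFun m (fun p => f p * g p) :=
  ContMDiff.mul hf hg

theorem SmoothFun.const (c : ℝ) : SmoothFun m (fun _ : M => c) :=
  contMDiff_const

theorem SmoothFun.sum {ι : Type*} {s : Finset ι} {f : ι → M → ℝ} (hf : ∀ i, SmoothFun m (f i)) :
    SmoothFun m (fun p => ∑ i ∈ s, f i p) :=
  contMDiff_finsetSum fun i _ => hf i

theorem SmoothFun.prod {ι : Type*} {s : Finset ι} {f : ι → M → ℝ} (hf : ∀ i, SmoothFun m (f i)) :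
    SmoothFun m (fun p => ∏ i ∈ s, f i p) :=
  contMDiff_finsetProd fun i _ => hf i

theorem SmoothFun.inv {f : M → ℝ} (hf : SmoothFun m f) (h : ∀ p, f p ≠ 0) :
    SmoothFun m (fun p => (f p)⁻¹) :=
  fun p => ((contDiffAt_inv ℝ (h p)).contMDiffAt).comp p (hf p)

theorem SmoothFun.exp {f : M → ℝ} (hf : SmoothFun m f) : SmoothFun m (fun p => Real.exp (f p)) :=
  Real.contDiff_exp.contMDiff.comp hf

theorem SmoothFun.det {ι : Type*} [Fintype ι] [DecidableEq ι] {B : M → Matrix ι ι ℝ}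
    (hB : ∀ i j, SmoothFun m (fun p => B p i j)) : SmoothFun m (fun p => (B p).det) := by
  simp_rw [Matrix.det_apply']
  exact .sum fun σ => (SmoothFun.const _).mul (.prod fun i => hB _ _)

/-- Cramer's rule. -/
theorem SmoothFun.matrix_inv {ι : Type*} [Fintype ι] [DecidableEq ι] {B : M → Matrix ι ι ℝ}
    (hB : ∀ i j, SmoothFun m (fun p => B p i j)) (h : ∀ p, (B p).det ≠ 0) (i j : ι) :
    SmoothFun m (fun p => (B p)⁻¹ i j) := by
  have : (fun p => (B p)⁻¹ i j)
      = fun p => ((B p).det)⁻¹ * ((B p).updateRow j (Pi.single i 1)).det := by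
    ext p
    rw [Matrix.inv_def, Matrix.smul_apply, Matrix.adjugate_apply, Ring.inverse_eq_inv', smul_eq_mul]
  rw [this]
  refine ((SmoothFun.det hB).inv h).mul (.det fun k l => ?_)
  simp only [Matrix.updateRow_apply]
  split_ifs
  · exact .const _
  · exact hB _ _

theorem dif_const (c : ℝ) (p : M) : dif m (fun _ : M => c) p = 0 :=
  mvfderiv_const c

theorem dif_add {f g : M → ℝ} {p : M} (hf : MDifferentiableAt (𝓡 m) 𝓘(ℝ) f p)
    (hg : MDifferentiableAt (𝓡 m) 𝓘(ℝ) g p) (v : TS m p) :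
    dif m (fun q => f q + g q) p v = dif m f p v + dif m g p v := by
  have := mvfderiv_fun_add hf hg
  simp only [dif, this]
  rfl

theorem dif_mul {f g : M → ℝ} {p : M} (hf : MDifferentiableAt (𝓡 m) 𝓘(ℝ) f p)
    (hg : MDifferentiableAt (𝓡 m) 𝓘(ℝ) g p) (v : TS m p) :
    dif m (fun q => f q * g q) p v = f p * dif m g p v + g p * dif m f p v := by
  have := mvfderiv_fun_mul hf hg
  simp only [dif, this]
  simp

theorem mdifferentiableAt_finset_sum {ι : Type*} (s : Finset ι) {f : ι → M → ℝ} {p : M}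
    (hf : ∀ i, MDifferentiableAt (𝓡 m) 𝓘(ℝ) (f i) p) :
    MDifferentiableAt (𝓡 m) 𝓘(ℝ) (fun q => ∑ i ∈ s, f i q) p := by
  classical
  induction s using Finset.induction_on with
  | empty => simpa using mdifferentiableAt_const
  | insert i s hi ih =>
    simp only [Finset.sum_insert hi]
    exact (hf i).add ih

theorem dif_sum {ι : Type*} (s : Finset ι) {f : ι → M → ℝ} {p : M}
    (hf : ∀ i, MDifferentiableAt (𝓡 m) 𝓘(ℝ) (f i) p) (v : TS m p) :
    dif m (fun q => ∑ i ∈ s, f i q) p v = ∑ i ∈ s, dif m (f i) p v := by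
  classical
  induction s using Finset.induction_on with
  | empty => simp [dif_const]
  | insert i s hi ih =>
    simp only [Finset.sum_insert hi]
    rw [dif_add (hf i) (mdifferentiableAt_finset_sum s hf) v, ih]

variable [IsManifold (𝓡 m) ∞ M]

theorem Form1.Smooth.apply {α : Form1 m M} (hα : α.Smooth) {Z : VField m M} (hZ : Z.Smooth) :
    SmoothFun m (fun q => α q (Z q)) := by
  have h := ContMDiff.clm_bundle_apply hα hZ
  intro p
  simpa [Bundle.contMDiffAt_section] using h p

theorem Form1.Smooth.applyOn {α : Form1 m M} (hα : α.Smooth) {Z : VField m M} {S : Set M}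
    (hZ : Z.SmoothOn S) : ContMDiffOn (𝓡 m) 𝓘(ℝ) ∞ (fun q => α q (Z q)) S := by
  have h := ContMDiffOn.clm_bundle_apply hα.contMDiffOn hZ
  intro p hp
  simpa [Bundle.contMDiffWithinAt_section] using h p hp

theorem Tensor2.Smooth.apply {T : Tensor2 m M} (hT : T.Smooth) {Z W : VField m M}
    (hZ : Z.Smooth) (hW : W.Smooth) : SmoothFun m (fun q => T q (Z q) (W q)) := by
  have h := ContMDiff.clm_bundle_apply₂ hT hZ hW
  intro p
  simpa [Bundle.contMDiffAt_section] using h p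

theorem dif_smooth {f : M → ℝ} (hf : SmoothFun m f) : Form1.Smooth (dif m f) := by
  intro p
  rw [contMDiffAt_hom_bundle]
  refine ⟨contMDiffAt_id, ?_⟩
  have h := (hf p).mfderiv_const (m := ∞) (by simp)
  refine h.congr_of_eventuallyEq (Eventually.of_forall fun q => ?_)
  ext v
  have h1 : (trivializationAt ℝ (Bundle.Trivial M ℝ) p).continuousLinearMapAt ℝ q
      = ContinuousLinearMap.id ℝ ℝ := Bundle.Trivial.continuousLinearMapAt_trivialization ..
  simp only [inTangentCoordinates, ContinuousLinearMap.inCoordinates,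
    TangentBundle.continuousLinearMapAt_model_space]
  rw [h1]
  rfl

theorem dif_apply_smooth {f : M → ℝ} (hf : SmoothFun m f) {X : VField m M} (hX : X.Smooth) :
    SmoothFun m (fun p => dif m f p (X p)) :=
  (dif_smooth hf).apply hX

end

/-! ### The commuting frame dual to the differentials of the given functions -/

section

variable {m : ℕ} {M : Type*} [TopologicalSpace M] [ChartedSpace (EuclideanSpace ℝ (Fin m)) M]

/-- The map `M → ℝᵐ` with components `x¹, …, xᵐ`. -/
noncomputable def coordMap (x : Fin m → M → ℝ) (p : M) : EuclideanSpace ℝ (Fin m) :=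
  WithLp.toLp 2 fun a => x a p

/-- The constant vector field `u` on `ℝᵐ`. -/
def constField (u : EuclideanSpace ℝ (Fin m)) : VField m (EuclideanSpace ℝ (Fin m)) :=
  fun _ => u

/-- The vector field whose components `dxᵃ` are the constants `u a`. -/
noncomputable def frame (x : Fin m → M → ℝ) (u : EuclideanSpace ℝ (Fin m)) : VField m M :=
  VectorField.mpullback (𝓡 m) 𝓘(ℝ, EuclideanSpace ℝ (Fin m)) (coordMap x) (constField u)

/-- The coordinate vector fields dual to `dx¹, …, dxᵐ`. -/
noncomputable def basisField (x : Fin m → M → ℝ) (a : Fin m) : VField m M :=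
  frame x (EuclideanSpace.single a 1)

namespace HData.IsIndep

variable {x : Fin m → M → ℝ} (hx : HData.IsIndep x)
include hx

theorem contMDiff_coordMap :
    ContMDiff (𝓡 m) 𝓘(ℝ, EuclideanSpace ℝ (Fin m)) ∞ (coordMap x) := by
  have h : ContMDiff (𝓡 m) 𝓘(ℝ, Fin m → ℝ) ∞ (fun p a => x a p) :=
    contMDiff_pi_space.2 hx.1
  exact (EuclideanSpace.equiv (Fin m) ℝ).symm.contDiff.contMDiff.comp h

theorem mfderiv_coordMap {p : M} (v : TS m p) (a : Fin m) :
    (EuclideanSpace.proj a : EuclideanSpace ℝ (Fin m) →L[ℝ] ℝ)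
      (mfderiv (𝓡 m) 𝓘(ℝ, EuclideanSpace ℝ (Fin m)) (coordMap x) p v)
      = dif m (x a) p v := by
  have h1 := ((hx.contMDiff_coordMap p).mdifferentiableAt (by simp)).hasMFDerivAt
  have h2 := ((EuclideanSpace.proj a : EuclideanSpace ℝ (Fin m) →L[ℝ] ℝ).hasMFDerivAt
    (x := coordMap x p)).comp p h1
  have h3 := h2.mfderiv
  have h4 : (EuclideanSpace.proj a : EuclideanSpace ℝ (Fin m) →L[ℝ] ℝ) ∘ coordMap x = x a := by
    ext; simp [coordMap]
  rw [h4] at h3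
  simp only [dif, mvfderiv, h3]
  rfl

/-- By dimension, `m` independent covectors span the cotangent space and therefore separate vectors.
-/
theorem ext_comps {p : M} {v w : TS m p} (h : ∀ a, dif m (x a) p v = dif m (x a) p w) :
    v = w := by
  have hfd : FiniteDimensional ℝ (TS m p) :=
    inferInstanceAs (FiniteDimensional ℝ (EuclideanSpace ℝ (Fin m)))
  have hT2 : T2Space (TS m p) := inferInstanceAs (T2Space (EuclideanSpace ℝ (Fin m)))
  have hrank : Module.finrank ℝ (TS m p) = m :=
    (finrank_euclideanSpace_fin : Module.finrank ℝ (EuclideanSpace ℝ (Fin m)) = m)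
  have hd : Module.finrank ℝ (TS m p →L[ℝ] ℝ) = m := by
    rw [← LinearMap.toContinuousLinearMap.finrank_eq (R := ℝ)]
    exact Subspace.dual_finrank_eq.trans hrank
  have hspan : Submodule.span ℝ (Set.range fun a => dif m (x a) p) = ⊤ :=
    (hx.2 p).span_eq_top_of_card_eq_finrank' (by simp [hd])
  have hall : ∀ α : TS m p →L[ℝ] ℝ, α v = α w := by
    intro α
    have hα : α ∈ Submodule.span ℝ (Set.range fun a => dif m (x a) p) := hspan ▸ Submodule.mem_top
    induction hα using Submodule.span_induction with
    | mem α hα => obtain ⟨a, rfl⟩ := hα; exact h a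
    | zero => rfl
    | add α β _ _ h1 h2 => simp [h1, h2]
    | smul c α _ h1 => simp [h1]
  refine PiLp.ext (p := 2) (x := (v : EuclideanSpace ℝ (Fin m))) (y := w) fun i => ?_
  exact hall (EuclideanSpace.proj i : EuclideanSpace ℝ (Fin m) →L[ℝ] ℝ)

theorem isInvertible_mfderiv (p : M) :
    (mfderiv (𝓡 m) 𝓘(ℝ, EuclideanSpace ℝ (Fin m)) (coordMap x) p).IsInvertible := by
  let L : EuclideanSpace ℝ (Fin m) →L[ℝ] EuclideanSpace ℝ (Fin m) :=
    mfderiv (𝓡 m) 𝓘(ℝ, EuclideanSpace ℝ (Fin m)) (coordMap x) p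
  have hinj : Function.Injective L.toLinearMap := fun v w h => by
    refine hx.ext_comps (p := p) fun a => ?_
    exact (hx.mfderiv_coordMap v a).symm.trans
      ((congrArg (fun z : EuclideanSpace ℝ (Fin m) => z a) h).trans (hx.mfderiv_coordMap w a))
  exact ⟨(LinearEquiv.ofInjectiveEndo L.toLinearMap hinj).toContinuousLinearEquiv, by ext; rfl⟩

theorem mfderiv_frame (u : EuclideanSpace ℝ (Fin m)) (p : M) :
    mfderiv (𝓡 m) 𝓘(ℝ, EuclideanSpace ℝ (Fin m)) (coordMap x) p (frame x u p)
      = constField u (coordMap x p) := by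
  obtain ⟨e, he⟩ := hx.isInvertible_mfderiv p
  rw [frame, VectorField.mpullback_apply, ← he, ContinuousLinearMap.inverse_equiv]
  exact e.apply_symm_apply _

theorem dif_frame (u : EuclideanSpace ℝ (Fin m)) (p : M) (a : Fin m) :
    dif m (x a) p (frame x u p) = u a := by
  rw [← hx.mfderiv_coordMap, hx.mfderiv_frame]
  rfl

theorem dif_basisField (a b : Fin m) (p : M) :
    dif m (x a) p (basisField x b p) = if a = b then 1 else 0 := by
  rw [basisField, hx.dif_frame]; simp

theorem sum_comps {p : M} (v : TS m p) : ∑ a, dif m (x a) p v • basisField x a p = v :=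
  hx.ext_comps fun a => by simp [hx.dif_basisField, map_sum]

theorem dif_sum_basisField (c : Fin m → ℝ) (p : M) (a : Fin m) :
    dif m (x a) p (∑ b, c b • basisField x b p) = c a := by
  simp [hx.dif_basisField, map_sum]

variable [IsManifold (𝓡 m) ∞ M]

theorem frame_smooth (u : EuclideanSpace ℝ (Fin m)) : (frame x u).Smooth := by
  refine ContMDiff.mpullback_vectorField (n := ∞) (m := ∞) ?_ hx.contMDiff_coordMap
    hx.isInvertible_mfderiv (by simp)
  exact contMDiff_vectorSpace_iff_contDiff.2 contDiff_const

theorem basisField_smooth (a : Fin m) : (basisField x a).Smooth := hx.frame_smooth _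

/-- Pullback by the local diffeomorphism `coordMap x` commutes with brackets, and constant fields on
`ℝᵐ` commute. -/
theorem bracket_frame (u w : EuclideanSpace ℝ (Fin m)) (p : M) :
    VectorField.mlieBracket (𝓡 m) (frame x u) (frame x w) p = 0 := by
  have hc (u y : EuclideanSpace ℝ (Fin m)) : (constField u).DiffAt y :=
    (contMDiffAt_vectorSpace_iff_contDiffAt (n := 1).2 contDiffAt_const).mdifferentiableAt (by simp)
  have h2 : IsManifold (𝓡 m) (minSmoothness ℝ 2) M := by
    rw [minSmoothness_of_isRCLikeNormedField]; infer_instance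
  have h3 : IsManifold (𝓡 m) (minSmoothness ℝ 3) M := by
    rw [minSmoothness_of_isRCLikeNormedField]
    exact IsManifold.of_le (n := ∞) (ENat.LEInfty.out)
  have h := VectorField.mpullback_mlieBracket (f := coordMap x) (x₀ := p) (n := ∞)
    (hc u _) (hc w _) (hx.contMDiff_coordMap p)
    (by rw [minSmoothness_of_isRCLikeNormedField]; exact ENat.LEInfty.out)
  have h4 : VectorField.mlieBracket (𝓡 m) (constField u) (constField w) (coordMap x p) = 0 := by
    rw [← VectorField.mlieBracketWithin_univ, VectorField.mlieBracketWithin_eq_lieBracketWithin]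
    have (u : EuclideanSpace ℝ (Fin m)) : fderivWithin ℝ (fun _ : EuclideanSpace ℝ (Fin m) => u)
        univ (coordMap x p) = 0 := by simp
    change fderivWithin ℝ (fun _ => w) univ (coordMap x p) u
      - fderivWithin ℝ (fun _ => u) univ (coordMap x p) w = 0
    rw [this, this]
    simp
  rw [frame, frame, ← h, VectorField.mpullback_apply, h4, map_zero]

theorem smooth_of_comps {X : VField m M} (h : ∀ a, SmoothFun m (fun p => dif m (x a) p (X p))) :
    X.Smooth := by
  have h1 : X = fun p => ∑ a, (fun q => dif m (x a) q (X q)) p • basisField x a p := by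
    ext p : 1
    exact (hx.sum_comps _).symm
  rw [h1]
  exact ContMDiff.sum_section fun a _ => ContMDiff.smul_section (h a) (hx.basisField_smooth a)

theorem dif_comp_mdiff {Z : VField m M} {p : M} (hZ : Z.DiffAt p) (a : Fin m) :
    MDifferentiableAt (𝓡 m) 𝓘(ℝ) (fun q => dif m (x a) q (Z q)) p :=
  (dif_smooth (hx.1 a)).apply_mdiff hZ

end HData.IsIndep

end

/-! ### Pointwise algebra of degenerate data and its gauge behaviour -/

section

variable {m : ℕ} {M : Type*} [TopologicalSpace M] [ChartedSpace (EuclideanSpace ℝ (Fin m)) M]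

instance (p : M) : FiniteDimensional ℝ (TS m p) :=
  inferInstanceAs (FiniteDimensional ℝ (EuclideanSpace ℝ (Fin m)))

/-- The one-form `v ↦ T(v, u)`. -/
noncomputable def slotRight {p : M} (T : TS m p →L[ℝ] TS m p →L[ℝ] ℝ) (u : TS m p) : TS m p →ₗ[ℝ] ℝ where
  toFun v := T v u
  map_add' v w := by simp
  map_smul' c v := by simp

namespace HData

/-- The algebraic part of the definition of characteristic data: `γ` is symmetric with a radical,
and `𝒜` is non-degenerate. -/
structure IsNull (D : HData m M) : Prop where
  symm_γ : ∀ p v w, D.γ p v w = D.γ p w v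
  nondeg : ∀ p, (D.A p).Nondegenerate
  rad_ne : ∀ p, ∃ v : TS m p, v ≠ 0 ∧ D.γ p v = 0

theorem A_apply (D : HData m M) (p : M) (v w : TS m p × ℝ) :
    D.A p v w = D.γ p v.1 w.1 + v.2 * D.ℓ p w.1 + w.2 * D.ℓ p v.1 + v.2 * w.2 * D.ℓ2 p :=
  rfl

theorem nondegenerate_of (D : HData m M) {p : M} (hs : ∀ v w, D.γ p v w = D.γ p w v)
    (h : ∀ (u : TS m p) (s : ℝ), (∀ w, D.γ p u w + s * D.ℓ p w = 0) →
      D.ℓ p u + s * D.ℓ2 p = 0 → u = 0 ∧ s = 0) : (D.A p).Nondegenerate := by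
  have key : ∀ v : TS m p × ℝ, (∀ w, D.A p v w = 0) → v = 0 := by
    rintro ⟨u, s⟩ hv
    have h1 := h u s (fun w => by simpa [A_apply] using hv (w, 0))
      (by simpa [A_apply] using hv (0, 1))
    exact Prod.ext h1.1 h1.2
  refine ⟨key, fun v hv => key v fun w => ?_⟩
  rw [← hv w, A_apply, A_apply, hs]
  ring

variable {D : HData m M}

theorem Asharp_apply {p : M} (h : (D.A p).Nondegenerate) (φ : Module.Dual ℝ (TS m p × ℝ))
    (w : TS m p × ℝ) : D.A p (D.Asharp p φ) w = φ w := by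
  unfold Asharp
  rw [dif_pos h]
  exact LinearMap.BilinForm.apply_toDual_symm_apply φ w

theorem eq_Asharp {p : M} (h : (D.A p).Nondegenerate) {φ : Module.Dual ℝ (TS m p × ℝ)}
    {u : TS m p × ℝ} (hu : ∀ w, D.A p u w = φ w) : D.Asharp p φ = u :=
  sub_eq_zero.1 <| h.1 _ fun w => by
    rw [map_sub, LinearMap.sub_apply, Asharp_apply h, hu, sub_self]

theorem covec_apply {p : M} (α : TS m p →L[ℝ] ℝ) (a : ℝ) (w : TS m p × ℝ) :
    covec α a w = α w.1 + a * w.2 := by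
  simp [covec]

/-- The degenerate direction of `γ`, normalized by `ℓ`, is `n`; and then `n⁽²⁾ = 0`. -/
theorem Asharp_zero_one {p : M} (h : (D.A p).Nondegenerate) {u : TS m p} (hγ : D.γ p u = 0)
    (hℓ : D.ℓ p u = 1) : D.Asharp p (covec 0 1) = (u, 0) :=
  eq_Asharp h fun w => by simp [A_apply, covec_apply, hγ, hℓ]

theorem n_eq {p : M} (h : (D.A p).Nondegenerate) {u : TS m p} (hγ : D.γ p u = 0)
    (hℓ : D.ℓ p u = 1) : D.n p = u := by
  rw [n, Asharp_zero_one h hγ hℓ]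

theorem P_eq {p : M} (h : (D.A p).Nondegenerate) {α : TS m p →L[ℝ] ℝ} {u : TS m p} {s : ℝ}
    (hγ : ∀ w, D.γ p u w + s * D.ℓ p w = α w) (hℓ : D.ℓ p u + s * D.ℓ2 p = 0) :
    D.P p α = u := by
  have : D.Asharp p (covec α 0) = (u, s) := eq_Asharp h fun w => by
    rw [A_apply, covec_apply, ← hγ]
    linear_combination w.2 * hℓ
  change (D.Asharp p (covec α 0)).1 = u
  rw [this]

namespace IsNull

variable (hD : D.IsNull) {p : M}
include hD

/-- A radical vector with `ℓ(v) = 0` would lie in the kernel of `𝒜`; so `ℓ(v) ≠ 0` and `v` can be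
normalized. -/
theorem exists_n (p : M) : ∃ u : TS m p, D.γ p u = 0 ∧ D.ℓ p u = 1 := by
  obtain ⟨v, hv, hγ⟩ := hD.rad_ne p
  have hℓ : D.ℓ p v ≠ 0 := fun h => hv <| by
    have := (hD.nondeg p).1 (v, 0) fun w => by simp [A_apply, hγ, h]
    exact congrArg Prod.fst this
  exact ⟨(D.ℓ p v)⁻¹ • v, by simp [hγ], by simp [hℓ]⟩

theorem γ_n : D.γ p (D.n p) = 0 := by
  obtain ⟨u, hγ, hℓ⟩ := hD.exists_n p
  rwa [n_eq (hD.nondeg p) hγ hℓ]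

theorem γ_n_right (v : TS m p) : D.γ p v (D.n p) = 0 := by
  rw [hD.symm_γ, hD.γ_n]
  rfl

theorem ℓ_n : D.ℓ p (D.n p) = 1 := by
  obtain ⟨u, hγ, hℓ⟩ := hD.exists_n p
  rwa [n_eq (hD.nondeg p) hγ hℓ]

theorem n2_eq_zero : D.n2 = 0 := by
  ext p
  obtain ⟨u, hγ, hℓ⟩ := hD.exists_n p
  rw [n2, Asharp_zero_one (hD.nondeg p) hγ hℓ]
  rfl

/-- Testing against `n` identifies the scalar part of `𝒜♯(α, 0)` as `α(n)`. -/
theorem P_spec (α : TS m p →L[ℝ] ℝ) : (∀ w, D.γ p (D.P p α) w + α (D.n p) * D.ℓ p w = α w) ∧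
    D.ℓ p (D.P p α) + α (D.n p) * D.ℓ2 p = 0 := by
  have h := Asharp_apply (hD.nondeg p) (covec α 0)
  have h1 : ∀ w, D.γ p (D.P p α) w + (D.Asharp p (covec α 0)).2 * D.ℓ p w = α w := fun w => by
    simpa [A_apply, covec_apply, P] using h (w, 0)
  have h2 : (D.Asharp p (covec α 0)).2 = α (D.n p) := by
    have := h1 (D.n p)
    rwa [hD.γ_n_right, hD.ℓ_n, zero_add, mul_one] at this
  refine ⟨fun w => by rw [← h2, h1], ?_⟩
  rw [← h2]
  simpa [A_apply, covec_apply, P] using h (0, 1)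

theorem γ_P (α : TS m p →L[ℝ] ℝ) (w : TS m p) :
    D.γ p (D.P p α) w = α w - α (D.n p) * D.ℓ p w := by
  linear_combination (hD.P_spec α).1 w

theorem ℓ_P (α : TS m p →L[ℝ] ℝ) : D.ℓ p (D.P p α) = -(α (D.n p) * D.ℓ2 p) := by
  linear_combination (hD.P_spec α).2

/-- A vector is determined by its `γ`- and `ℓ`-products. -/
theorem ext_γ_ℓ {u v : TS m p} (hγ : ∀ w, D.γ p u w = D.γ p v w) (hℓ : D.ℓ p u = D.ℓ p v) :
    u = v := by
  have := (hD.nondeg p).1 (u - v, 0) fun w => by simp [A_apply, hγ, hℓ]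
  exact sub_eq_zero.1 (congrArg Prod.fst this)

theorem P_ℓ : D.P p (D.ℓ p) = -D.ℓ2 p • D.n p :=
  P_eq (hD.nondeg p) (s := 1) (fun w => by simp [hD.γ_n]) (by simp [hD.ℓ_n])

theorem P_γ (u : TS m p) : D.P p (D.γ p u) = u - D.ℓ p u • D.n p :=
  P_eq (hD.nondeg p) (s := 0) (fun w => by simp [hD.γ_n]) (by simp [hD.ℓ_n])

end IsNull

variable [IsManifold (𝓡 m) ∞ M]

section Gauge

variable {z : M → ℝ} {ζ : VField m M}

@[simp] theorem gauge_γ : (D.gauge z ζ).γ = D.γ := rfl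

theorem gauge_ℓ_apply (p : M) (v : TS m p) :
    (D.gauge z ζ).ℓ p v = z p * (D.ℓ p v + D.γ p (ζ p) v) := rfl

theorem gauge_ℓ2_apply (p : M) : (D.gauge z ζ).ℓ2 p
    = z p ^ 2 * (D.ℓ2 p + 2 * D.ℓ p (ζ p) + D.γ p (ζ p) (ζ p)) := rfl

/-- Testing a kernel vector of the new `𝒜` against `n` kills its scalar part; what is left is a
kernel vector of the old `𝒜`. -/
theorem IsNull.gauge (hD : D.IsNull) (hz : ∀ p, z p ≠ 0) : (D.gauge z ζ).IsNull where
  symm_γ := hD.symm_γ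
  rad_ne := hD.rad_ne
  nondeg p := by
    refine nondegenerate_of _ (hD.symm_γ p) fun u s h1 h2 => ?_
    simp only [gauge_γ, gauge_ℓ_apply, gauge_ℓ2_apply] at h1 h2
    have hs : s = 0 := by
      have := h1 (D.n p)
      rw [hD.γ_n_right, hD.γ_n_right, hD.ℓ_n] at this
      simpa [hz p] using this
    subst hs
    have h3 : ∀ w, D.γ p u w = 0 := fun w => by simpa using h1 w
    have h4 : D.ℓ p u = 0 := by
      rw [hD.symm_γ, h3] at h2
      simpa [hz p] using h2
    exact ⟨hD.ext_γ_ℓ (by simpa using h3) (by simpa using h4), rfl⟩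

theorem IsNull.gauge_n (hD : D.IsNull) (hz : ∀ p, z p ≠ 0) (p : M) :
    (D.gauge z ζ).n p = (z p)⁻¹ • D.n p :=
  n_eq ((hD.gauge hz).nondeg p) (by simp [hD.γ_n])
    (by simp [gauge_ℓ_apply, hD.γ_n_right, hD.ℓ_n, hz p])

theorem IsNull.gauge_P (hD : D.IsNull) (hz : ∀ p, z p ≠ 0) (p : M) (α : TS m p →L[ℝ] ℝ) :
    (D.gauge z ζ).P p α = D.P p α - α (ζ p) • D.n p - α (D.n p) • ζ p := by
  -- The scalar part is `α(n')` with `n' = z⁻¹ n`, as `P_spec` for the transformed data requires.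
  refine P_eq ((hD.gauge hz).nondeg p) (s := (z p)⁻¹ * α (D.n p)) (fun w => ?_) ?_
  · simp only [gauge_γ, gauge_ℓ_apply, map_sub, map_smul, sub_apply, smul_apply, hD.γ_P, hD.γ_n,
      smul_eq_mul]
    have := hz p
    field_simp
    simp
    ring
  · have h1 : D.γ p (ζ p) (D.P p α) = α (ζ p) - α (D.n p) * D.ℓ p (ζ p) := by
      rw [hD.symm_γ, hD.γ_P]
    simp only [gauge_ℓ_apply, gauge_ℓ2_apply, map_sub, map_smul, hD.ℓ_P, hD.ℓ_n,
      hD.γ_n_right, smul_eq_mul, h1]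
    have := hz p
    field_simp
    ring

theorem IsNull.gauge_trP (hD : D.IsNull) (hz : ∀ p, z p ≠ 0) (p : M)
    (T : TS m p →L[ℝ] TS m p →L[ℝ] ℝ) :
    (D.gauge z ζ).trP p T = D.trP p T - T (D.n p) (ζ p) - T (ζ p) (D.n p) := by
  have h : ((D.gauge z ζ).P p).comp T.toLinearMap = (D.P p).comp T.toLinearMap
      - (slotRight T (ζ p)).smulRight (D.n p) - (slotRight T (D.n p)).smulRight (ζ p) := by
    refine LinearMap.ext fun v => ?_
    exact hD.gauge_P hz p (T v)
  rw [trP, h, map_sub, map_sub, LinearMap.trace_smulRight, LinearMap.trace_smulRight]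
  simp [trP, slotRight, sub_right_comm]

end Gauge

theorem trP_add (p : M) (T T' : TS m p →L[ℝ] TS m p →L[ℝ] ℝ) :
    D.trP p (T + T') = D.trP p T + D.trP p T' := by
  rw [trP, trP, trP, ← map_add, ← LinearMap.comp_add]
  rfl

theorem trP_smul (p : M) (c : ℝ) (T : TS m p →L[ℝ] TS m p →L[ℝ] ℝ) :
    D.trP p (c • T) = c * D.trP p T := by
  rw [trP, trP, ← smul_eq_mul, ← map_smul, ← LinearMap.comp_smul]
  rfl

/-- Independence of the `dxᵃ` makes `Xi x p` bijective, so the default value in `V` never occurs. -/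
theorem V_eq {x : Fin m → M → ℝ} (hx : IsIndep x) (D : HData m M) (N : Conn m M) (p : M)
    (a : Fin m) : dif m (x a) p (D.V N x p) = D.box N (x a) p := by
  have h : Function.Bijective (Xi x p) := by
    have hinj : Function.Injective (Xi x p) := fun v w h =>
      hx.ext_comps fun a => congrFun h a
    refine ⟨hinj, (LinearMap.injective_iff_surjective_of_finrank_eq_finrank ?_).1 hinj⟩
    exact (finrank_euclideanSpace_fin : Module.finrank ℝ (EuclideanSpace ℝ (Fin m)) = m).trans
      (by simp)
  rw [V, dif_pos h]
  exact congrFun ((LinearEquiv.ofBijective (Xi x p) h).apply_symm_apply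
    fun a => D.box N (x a) p) a

end HData

end

/-! ### Smoothness of `n`, `P` and traces through the Gram matrix -/

section

variable {m : ℕ} {M : Type*} [TopologicalSpace M] [ChartedSpace (EuclideanSpace ℝ (Fin m)) M]

theorem Matrix.det_ne_zero_of_vecMul {ι : Type*} [Fintype ι] [DecidableEq ι] {B : Matrix ι ι ℝ}
    (h : ∀ c : ι → ℝ, Matrix.vecMul c B = 0 → c = 0) : B.det ≠ 0 := by
  intro h0
  obtain ⟨v, hv, hB⟩ := Matrix.exists_vecMul_eq_zero_iff.2 h0
  exact hv (h v hB)

namespace HData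

section Gram

variable {x : Fin m → M → ℝ}

/-- The basis of `T_p M × ℝ` made of the coordinate vector fields and `(0, 1)`. -/
noncomputable def gramVec (x : Fin m → M → ℝ) (p : M) (i : Fin m ⊕ Unit) : TS m p × ℝ :=
  Sum.elim (fun a => (basisField x a p, 0)) (fun _ => (0, 1)) i

/-- The Gram matrix of `𝒜` in the basis `gramVec`. -/
noncomputable def gram (D : HData m M) (x : Fin m → M → ℝ) (p : M) :
    Matrix (Fin m ⊕ Unit) (Fin m ⊕ Unit) ℝ :=
  fun i j => D.A p (gramVec x p i) (gramVec x p j)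

variable {D : HData m M}

theorem IsIndep.sum_gramVec (hx : IsIndep x) {p : M} (u : TS m p × ℝ) :
    ∑ i, Sum.elim (fun a => dif m (x a) p u.1) (fun _ => u.2) i • gramVec x p i = u := by
  rw [Fintype.sum_sum_type]
  refine Prod.ext ?_ ?_
  · simp [gramVec, Prod.fst_sum, hx.sum_comps]
  · simp [gramVec, Prod.snd_sum]

theorem IsIndep.ext_gramVec (hx : IsIndep x) {p : M} {φ ψ : Module.Dual ℝ (TS m p × ℝ)}
    (h : ∀ i, φ (gramVec x p i) = ψ (gramVec x p i)) : φ = ψ := by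
  refine LinearMap.ext fun u => ?_
  rw [← hx.sum_gramVec u, map_sum, map_sum]
  simp only [map_smul, h]

theorem vecMul_gram (p : M) (c : Fin m ⊕ Unit → ℝ) (j : Fin m ⊕ Unit) :
    (Matrix.vecMul c (D.gram x p)) j = D.A p (∑ i, c i • gramVec x p i) (gramVec x p j) := by
  simp [Matrix.vecMul, dotProduct, gram, map_sum, LinearMap.sum_apply]

theorem IsIndep.gram_det_ne (hx : IsIndep x) {p : M} (h : (D.A p).Nondegenerate) :
    (D.gram x p).det ≠ 0 := by
  refine Matrix.det_ne_zero_of_vecMul fun c hc => ?_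
  have h0 : ∑ i, c i • gramVec x p i = 0 := by
    refine h.1 _ fun w => ?_
    have : D.A p (∑ i, c i • gramVec x p i) = 0 := hx.ext_gramVec fun j => by
      rw [← vecMul_gram, hc]
      rfl
    rw [this]
    rfl
  rw [Fintype.sum_sum_type] at h0
  ext i
  rcases i with a | u
  · have h1 := congrArg (fun w : TS m p × ℝ => dif m (x a) p w.1) h0
    simpa [gramVec, Prod.fst_sum, hx.dif_sum_basisField] using h1
  · have h1 := congrArg (fun w : TS m p × ℝ => w.2) h0
    simpa [gramVec, Prod.snd_sum] using h1

variable [IsManifold (𝓡 m) ∞ M]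

/-- Smoothness of the solution of a linear system with matrix `𝒜`. -/
theorem IsIndep.Asharp_smooth (hx : IsIndep x) (hD : ∀ p, (D.A p).Nondegenerate)
    (hγ : D.γ.Smooth) (hℓ : D.ℓ.Smooth) (hℓ2 : SmoothFun m D.ℓ2)
    {φ : ∀ p : M, Module.Dual ℝ (TS m p × ℝ)}
    (h1 : ∀ a, SmoothFun m (fun p => φ p (basisField x a p, 0)))
    (h2 : SmoothFun m (fun p => φ p (0, 1))) :
    VField.Smooth (fun p => (D.Asharp p (φ p)).1) := by
  have hφ (i) : SmoothFun m (fun p => φ p (gramVec x p i)) := by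
    rcases i with a | u
    · exact h1 a
    · exact h2
  have hB (i j) : SmoothFun m (fun p => D.gram x p i j) := by
    rcases i with a | u <;> rcases j with b | w
    · simpa [gram, gramVec, A_apply] using
        hγ.apply (hx.basisField_smooth a) (hx.basisField_smooth b)
    · simpa [gram, gramVec, A_apply] using hℓ.apply (hx.basisField_smooth a)
    · simpa [gram, gramVec, A_apply] using hℓ.apply (hx.basisField_smooth b)
    · simpa [gram, gramVec, A_apply] using hℓ2
  refine hx.smooth_of_comps fun a => ?_
  have key (p) : dif m (x a) p (D.Asharp p (φ p)).1
      = ∑ i, φ p (gramVec x p i) * (D.gram x p)⁻¹ i (Sum.inl a) := by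
    set u := D.Asharp p (φ p)
    set c : Fin m ⊕ Unit → ℝ := Sum.elim (fun a => dif m (x a) p u.1) (fun _ => u.2)
    -- The coordinates `c` of `𝒜♯ φ` solve a linear system with the Gram matrix, hence are smooth by
    -- Cramer's rule.
    have h3 : Matrix.vecMul c (D.gram x p) = fun i => φ p (gramVec x p i) := by
      ext j
      rw [vecMul_gram, hx.sum_gramVec, Asharp_apply (hD p)]
    have h4 : c = Matrix.vecMul (fun i => φ p (gramVec x p i)) (D.gram x p)⁻¹ := by
      rw [← h3, Matrix.vecMul_vecMul, Matrix.mul_nonsing_inv _ (hx.gram_det_ne (hD p)).isUnit,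
        Matrix.vecMul_one]
    exact congrFun h4 (Sum.inl a)
  simp_rw [key]
  exact .sum fun i => (hφ i).mul (.matrix_inv hB (fun p => hx.gram_det_ne (hD p)) _ _)

end Gram

variable [IsManifold (𝓡 m) ∞ M] {D : HData m M} {x : Fin m → M → ℝ}

theorem IsIndep.n_smooth (hx : IsIndep x) (hD : D.IsHypersurfaceData) : D.n.Smooth :=
  hx.Asharp_smooth hD.nondeg hD.smooth_γ hD.smooth_ℓ hD.smooth_ℓ2
    (by simpa [covec_apply] using fun _ => .const 0) (by simpa [covec_apply] using .const 1)

theorem IsIndep.P_smooth (hx : IsIndep x) (hD : D.IsHypersurfaceData) {α : Form1 m M}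
    (hα : ∀ a, SmoothFun m (fun p => α p (basisField x a p))) :
    VField.Smooth (fun p => D.P p (α p)) :=
  hx.Asharp_smooth hD.nondeg hD.smooth_γ hD.smooth_ℓ hD.smooth_ℓ2
    (by simpa [covec_apply] using hα) (by simpa [covec_apply] using .const 0)

theorem IsIndep.trP_eq (hx : IsIndep x) (p : M) (T : TS m p →L[ℝ] TS m p →L[ℝ] ℝ) :
    D.trP p T = ∑ a, dif m (x a) p (D.P p (T (basisField x a p))) := by
  have h : (D.P p).comp T.toLinearMap = ∑ a, (dif m (x a) p).toLinearMap.smulRight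
      (D.P p (T (basisField x a p))) := by
    refine LinearMap.ext fun v => ?_
    conv_lhs => rw [← hx.sum_comps v]
    simp [map_sum, LinearMap.sum_apply]
  rw [trP, h, map_sum]
  simp [LinearMap.trace_smulRight]

theorem IsIndep.trP_smooth (hx : IsIndep x) (hD : D.IsHypersurfaceData) {T : Tensor2 m M}
    (hT : ∀ a b, SmoothFun m (fun p => T p (basisField x a p) (basisField x b p))) :
    SmoothFun m (fun p => D.trP p (T p)) := by
  simp_rw [hx.trP_eq]
  exact .sum fun a => (dif_smooth (hx.1 a)).apply (hx.P_smooth hD (hT a))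

theorem IsIndep.ext_tensor2 (hx : IsIndep x) {p : M} {T T' : TS m p →L[ℝ] TS m p →L[ℝ] ℝ}
    (h : ∀ a b, T (basisField x a p) (basisField x b p) = T' (basisField x a p) (basisField x b p)) :
    T = T' := by
  ext v w
  rw [← hx.sum_comps v, ← hx.sum_comps w]
  simp [map_sum, h]

end HData

end

/-! ### Connections, Lie derivatives, and the tensors `K` and `F` -/

section

variable {m : ℕ} {M : Type*} [TopologicalSpace M] [ChartedSpace (EuclideanSpace ℝ (Fin m)) M]
  [IsManifold (𝓡 m) ∞ M]

/-- Turns an identity between tensors at a point into one between differentiable fields, where the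
defining formulas apply. -/
theorem exists_field {p : M} (v : TS m p) : ∃ Z : VField m M, Z.DiffAt p ∧ Z p = v :=
  ⟨FiberBundle.extend (EuclideanSpace ℝ (Fin m)) v,
    FiberBundle.mdifferentiableAt_extend (𝓡 m) (EuclideanSpace ℝ (Fin m)) v, by simp⟩

theorem VField.Smooth.bracket {X Y : VField m M} (hX : X.Smooth) (hY : Y.Smooth) :
    VField.Smooth (VectorField.mlieBracket (𝓡 m) X Y) := by
  have h2 : IsManifold (𝓡 m) (minSmoothness ℝ 2) M := by
    rw [minSmoothness_of_isRCLikeNormedField]; infer_instance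
  have h3 : IsManifold (𝓡 m) (minSmoothness ℝ 3) M := by
    rw [minSmoothness_of_isRCLikeNormedField]
    exact IsManifold.of_le (n := ∞) ENat.LEInfty.out
  have h4 : IsManifold (𝓡 m) (∞ + 1) M := inferInstanceAs (IsManifold (𝓡 m) ∞ M)
  exact ContDiff.mlieBracket_vectorField (m := ⊤) (n := ⊤) hX hY
    (by rw [minSmoothness_of_isRCLikeNormedField]; simp)

theorem VField.Smooth.smul {X : VField m M} (hX : X.Smooth) {f : M → ℝ} (hf : SmoothFun m f) :
    VField.Smooth (fun p => f p • X p) :=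
  ContMDiff.smul_section hf hX

theorem VField.Smooth.add {X Y : VField m M} (hX : X.Smooth) (hY : Y.Smooth) :
    VField.Smooth (fun p => X p + Y p) :=
  ContMDiff.add_section hX hY

theorem VField.DiffAt.smul {X : VField m M} {p : M} (hX : X.DiffAt p) {f : M → ℝ}
    (hf : MDifferentiableAt (𝓡 m) 𝓘(ℝ) f p) : VField.DiffAt (fun q => f q • X q) p :=
  MDifferentiableAt.smul_section hf hX

/-- A function which is tensorial in a vector field vanishes if it vanishes on the coordinate
fields. -/
theorem HData.IsIndep.tensorial_eq_zero {x : Fin m → M → ℝ} (hx : HData.IsIndep x) {p : M}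
    {Φ : VField m M → ℝ} (hΦ : TensorialAt (𝓡 m) (EuclideanSpace ℝ (Fin m)) Φ p)
    (h : ∀ a, Φ (basisField x a) = 0) {Z : VField m M} (hZ : Z.DiffAt p) : Φ Z = 0 := by
  -- Only the value `Z p` matters, so `Z` is replaced by the combination of frame fields with
  -- coefficients frozen at `p`.
  have hc (a : Fin m) : MDifferentiableAt (𝓡 m) 𝓘(ℝ) (fun _ : M => dif m (x a) p (Z p)) p :=
    mdifferentiableAt_const
  have hd (a : Fin m) : VField.DiffAt
      ((fun _ : M => dif m (x a) p (Z p)) • basisField x a) p :=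
    VField.DiffAt.smul ((hx.basisField_smooth a).diffAt p) (hc a)
  have hsum : VField.DiffAt (fun q => ∑ a, ((fun _ : M => dif m (x a) p (Z p)) •
      basisField x a) q) p := MDifferentiableAt.sum_section fun a _ => hd a
  rw [hΦ.pointwise hZ hsum (hx.sum_comps (Z p)).symm, hΦ.sum _ fun a _ => hd a]
  refine Finset.sum_eq_zero fun a _ => ?_
  rw [hΦ.smul (hc a) ((hx.basisField_smooth a).diffAt p), h, smul_zero]

section Connection

variable {N : Conn m M} {p : M}

theorem Conn.smul (N : Conn m M) {f : M → ℝ} (hf : MDifferentiableAt (𝓡 m) 𝓘(ℝ) f p)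
    {Z : VField m M} (hZ : Z.DiffAt p) (v : TS m p) :
    N (f • Z) p v = f p • N Z p v + dif m f p v • Z p := by
  have h := N.isCovariantDerivativeOnUniv.leibniz hZ hf (Set.mem_univ p)
  rw [h]
  rfl

theorem Conn.add (N : Conn m M) {Z Z' : VField m M} (hZ : Z.DiffAt p) (hZ' : Z'.DiffAt p)
    (v : TS m p) : N (Z + Z') p v = N Z p v + N Z' p v := by
  have h := N.isCovariantDerivativeOnUniv.add hZ hZ' (Set.mem_univ p)
  rw [h]
  rfl

theorem Conn.bracket_eq (hN : N.torsion = 0) {X Y : VField m M} (hX : X.DiffAt p)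
    (hY : Y.DiffAt p) : VectorField.mlieBracket (𝓡 m) X Y p = N Y p (X p) - N X p (Y p) :=
  (N.torsion_eq_zero_iff.1 hN hX hY).symm

theorem covTensor_tensorial_left (N : Conn m M) {T : Tensor2 m M} (hT : T.Smooth) (v : TS m p)
    {W : VField m M} (hW : W.DiffAt p) :
    TensorialAt (𝓡 m) (EuclideanSpace ℝ (Fin m)) (fun Z => covTensor N T p v Z W) p where
  smul {f Z} hf hZ := by
    have h := dif_mul hf (hT.apply_mdiff hZ hW) v
    simp only [covTensor, N.smul hf hZ, Pi.smul_apply', map_smul, map_add, smul_apply, add_apply,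
      smul_eq_mul, h]
    ring
  add {Z Z'} hZ hZ' := by
    have h := dif_add (hT.apply_mdiff hZ hW) (hT.apply_mdiff hZ' hW) v
    simp only [covTensor, N.add hZ hZ', Pi.add_apply, map_add, add_apply, h]
    ring

theorem covTensor_tensorial_right (N : Conn m M) {T : Tensor2 m M} (hT : T.Smooth) (v : TS m p)
    {Z : VField m M} (hZ : Z.DiffAt p) :
    TensorialAt (𝓡 m) (EuclideanSpace ℝ (Fin m)) (fun W => covTensor N T p v Z W) p where
  smul {f W} hf hW := by
    have h := dif_mul hf (hT.apply_mdiff hZ hW) v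
    simp only [covTensor, N.smul hf hW, Pi.smul_apply', map_smul, map_add, smul_eq_mul, h]
    ring
  add {W W'} hW hW' := by
    have h := dif_add (hT.apply_mdiff hZ hW) (hT.apply_mdiff hZ hW') v
    simp only [covTensor, N.add hW hW', Pi.add_apply, map_add, h]
    ring

theorem lieDeriv_eq (hN : N.torsion = 0) {X Z W : VField m M} {T : Tensor2 m M} (hT : T.Smooth)
    (hX : X.DiffAt p) (hZ : Z.DiffAt p) (hW : W.DiffAt p) :
    lieDeriv X T p (Z p) (W p) = covTensor N T p (X p) Z W + T p (N X p (Z p)) (W p)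
      + T p (Z p) (N X p (W p)) := by
  rw [lieDeriv_apply hT hZ hW, Conn.bracket_eq hN hX hZ, Conn.bracket_eq hN hX hW, covTensor]
  simp only [map_sub, sub_apply]
  ring

theorem extD_eq (hN : N.torsion = 0) {α : Form1 m M} (hα : α.Smooth) (v w : TS m p) :
    extD α p v w = covForm N α p v w - covForm N α p w v := by
  obtain ⟨Z, hZ, rfl⟩ := exists_field v
  obtain ⟨W, hW, rfl⟩ := exists_field w
  rw [extD_apply hα hZ hW, covForm_apply N hα hZ hW, covForm_apply N hα hW hZ,
    Conn.bracket_eq hN hZ hW, map_sub]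
  ring

theorem extD_antisymm {α : Form1 m M} (hα : α.Smooth) (v w : TS m p) :
    extD α p v w = -extD α p w v := by
  obtain ⟨Z, hZ, rfl⟩ := exists_field v
  obtain ⟨W, hW, rfl⟩ := exists_field w
  rw [extD_apply hα hZ hW, extD_apply hα hW hZ, VectorField.mlieBracket_swap_apply, map_neg]
  ring

theorem lieDeriv_symm {X : VField m M} {T : Tensor2 m M} (hT : T.Smooth)
    (hs : ∀ p v w, T p v w = T p w v) (v w : TS m p) :
    lieDeriv X T p v w = lieDeriv X T p w v := by
  obtain ⟨Z, hZ, rfl⟩ := exists_field v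
  obtain ⟨W, hW, rfl⟩ := exists_field w
  rw [lieDeriv_apply hT hZ hW, lieDeriv_apply hT hW hZ]
  simp only [hs _ (W _), hs _ (VectorField.mlieBracket (𝓡 m) X W p)]
  ring

end Connection

namespace HData

variable {D : HData m M} {p : M}

theorem IsNull.K_eq (hD : D.IsNull) (p : M) : D.K p = (1 / 2 : ℝ) • lieDeriv D.n D.γ p := by
  have h : dif m D.n2 p = 0 := by
    rw [hD.n2_eq_zero]
    exact dif_const 0 p
  have h0 : D.n2 p = 0 := congrFun hD.n2_eq_zero p
  refine ContinuousLinearMap.ext fun v => ContinuousLinearMap.ext fun w => ?_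
  change D.n2 p * D.Y p v w + 1 / 2 * lieDeriv D.n D.γ p v w
    + 1 / 2 * (D.ℓ p v * dif m D.n2 p w + dif m D.n2 p v * D.ℓ p w)
    = 1 / 2 * lieDeriv D.n D.γ p v w
  rw [h0, h]
  simp

theorem IsNull.K_apply (hD : D.IsNull) (hγ : D.γ.Smooth) {Z W : VField m M} (hZ : Z.DiffAt p)
    (hW : W.DiffAt p) : D.K p (Z p) (W p) = 1 / 2 * (dif m (fun q => D.γ q (Z q) (W q)) p (D.n p)
      - D.γ p (VectorField.mlieBracket (𝓡 m) D.n Z p) (W p)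
      - D.γ p (Z p) (VectorField.mlieBracket (𝓡 m) D.n W p)) := by
  rw [hD.K_eq, ← lieDeriv_apply hγ hZ hW]
  rfl

theorem IsNull.K_symm (hD : D.IsNull) (hγ : D.γ.Smooth) (v w : TS m p) :
    D.K p v w = D.K p w v := by
  simp only [hD.K_eq, smul_apply, lieDeriv_symm hγ hD.symm_γ v w]

/-- `γ(·, n)` vanishes identically and `[n, n] = 0`, so every term of `ℒ_n γ` drops out. -/
theorem IsNull.K_n_right (hD : D.IsNull) (hγ : D.γ.Smooth) (hn : D.n.Smooth) (v : TS m p) :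
    D.K p v (D.n p) = 0 := by
  obtain ⟨Z, hZ, rfl⟩ := exists_field v
  rw [hD.K_apply hγ hZ (hn.diffAt p)]
  simp [hD.γ_n_right, dif_const]

theorem IsNull.K_n (hD : D.IsNull) (hγ : D.γ.Smooth) (hn : D.n.Smooth) (v : TS m p) :
    D.K p (D.n p) v = 0 := by
  rw [hD.K_symm hγ, hD.K_n_right hγ hn]

theorem IsNull.K_smooth (hD : D.IsNull) (hγ : D.γ.Smooth) (hn : D.n.Smooth) {Z W : VField m M}
    (hZ : Z.Smooth) (hW : W.Smooth) : SmoothFun m (fun p => D.K p (Z p) (W p)) := by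
  simp_rw [hD.K_apply hγ (hZ.diffAt _) (hW.diffAt _)]
  exact (SmoothFun.const _).mul (((dif_apply_smooth (hγ.apply hZ hW) hn).sub
    (hγ.apply (hn.bracket hZ) hW)).sub (hγ.apply hZ (hn.bracket hW)))

theorem F_antisymm (hℓ : D.ℓ.Smooth) (v w : TS m p) : D.F p v w = -D.F p w v := by
  have := extD_antisymm hℓ v w
  simp only [F, smul_apply, smul_eq_mul, this]
  ring

theorem F_self (hℓ : D.ℓ.Smooth) (v : TS m p) : D.F p v v = 0 := by
  linarith [F_antisymm hℓ v v]

theorem F_smooth (hℓ : D.ℓ.Smooth) {Z W : VField m M} (hZ : Z.Smooth) (hW : W.Smooth) :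
    SmoothFun m (fun p => D.F p (Z p) (W p)) := by
  have h (p) : D.F p (Z p) (W p) = 1 / 2 * extD D.ℓ p (Z p) (W p) := rfl
  simp_rw [h, extD_apply hℓ (hZ.diffAt _) (hW.diffAt _)]
  exact (SmoothFun.const _).mul (((dif_apply_smooth (hℓ.apply hW) hZ).sub
    (dif_apply_smooth (hℓ.apply hZ) hW)).sub (hℓ.apply (hZ.bracket hW)))

end HData

end

/-! ### Existence and uniqueness of the hypersurface data connection -/

section

variable {m : ℕ} {M : Type*} [TopologicalSpace M] [ChartedSpace (EuclideanSpace ℝ (Fin m)) M]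
  [IsManifold (𝓡 m) ∞ M]

/-- Absorbs a pointwise right-hand side, so that an equation becomes the vanishing of a tensorial
expression. -/
theorem TensorialAt.add_linear {p : M} {Φ : VField m M → ℝ}
    (hΦ : TensorialAt (𝓡 m) (EuclideanSpace ℝ (Fin m)) Φ p) (L : TS m p →L[ℝ] ℝ) :
    TensorialAt (𝓡 m) (EuclideanSpace ℝ (Fin m)) (fun Z => Φ Z + L (Z p)) p where
  smul {f Z} hf hZ := by simp [hΦ.smul hf hZ, mul_add]
  add {Z Z'} hZ hZ' := by simp [hΦ.add hZ hZ', add_add_add_comm]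

theorem HData.IsIndep.covTensor_sum {x : Fin m → M → ℝ} (hx : HData.IsIndep x) (N : Conn m M)
    (T : Tensor2 m M) (p : M) (v : TS m p) (Z W : VField m M) : covTensor N T p v Z W
      = ∑ a, dif m (x a) p v * covTensor N T p (basisField x a p) Z W := by
  conv_lhs => rw [← hx.sum_comps v]
  simp [covTensor, map_sum, mul_sub, Finset.sum_sub_distrib]

namespace HData

variable {D : HData m M} {x : Fin m → M → ℝ} {N : Conn m M}

theorem IsIndep.bracket_basisField (hx : IsIndep x) (a b : Fin m) (p : M) :
    VectorField.mlieBracket (𝓡 m) (basisField x a) (basisField x b) p = 0 :=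
  hx.bracket_frame _ _ p

/-- `e_a(γ(e_b, e_d)) + ℓ(e_b) K(e_a, e_d) + ℓ(e_d) K(e_a, e_b)`. -/
noncomputable def preKoszul (D : HData m M) (x : Fin m → M → ℝ) (a b d : Fin m) (p : M) : ℝ :=
  dif m (fun q => D.γ q (basisField x b q) (basisField x d q)) p (basisField x a p)
    + D.ℓ p (basisField x b p) * D.K p (basisField x a p) (basisField x d p)
    + D.ℓ p (basisField x d p) * D.K p (basisField x a p) (basisField x b p)

/-- The Koszul expression for `γ(∇̄_{e_a} e_b, e_d)`. -/
noncomputable def koszul (D : HData m M) (x : Fin m → M → ℝ) (a b d : Fin m) (p : M) : ℝ :=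
  1 / 2 * (D.preKoszul x a b d p + D.preKoszul x b a d p - D.preKoszul x d a b p)

/-- The value of `ℓ(∇̄_{e_a} e_b)`. -/
noncomputable def koszulℓ (D : HData m M) (x : Fin m → M → ℝ) (a b : Fin m) (p : M) : ℝ :=
  dif m (fun q => D.ℓ q (basisField x b q)) p (basisField x a p)
    - (D.Y p (basisField x a p) (basisField x b p) + D.F p (basisField x a p) (basisField x b p)
      - D.ℓ2 p * D.K p (basisField x a p) (basisField x b p))

theorem IsIndep.conn_comm (hx : IsIndep x) (hN : N.torsion = 0) (a b : Fin m) (p : M) :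
    N (basisField x b) p (basisField x a p) = N (basisField x a) p (basisField x b p) := by
  have h := Conn.bracket_eq hN ((hx.basisField_smooth a).diffAt p)
    ((hx.basisField_smooth b).diffAt p)
  rw [hx.bracket_basisField] at h
  exact (sub_eq_zero.1 h.symm)

/-- The usual Koszul argument: `preKoszul` absorbs the `K`-terms of `∇̄γ`, and torsion-freeness with
a commuting frame makes `∇̄_{e_a} e_b` symmetric in `a`, `b`. -/
theorem IsConnection.γ_basis (hN : D.IsConnection N) (hx : IsIndep x) (hD : D.IsNull)
    (a b d : Fin m) (p : M) :
    D.γ p (N (basisField x b) p (basisField x a p)) (basisField x d p) = D.koszul x a b d p := by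
  have h (a b d : Fin m) : D.preKoszul x a b d p
      = D.γ p (N (basisField x b) p (basisField x a p)) (basisField x d p)
        + D.γ p (N (basisField x d) p (basisField x a p)) (basisField x b p) := by
    have := hN.nabla_γ p (basisField x a p) (basisField x b) (basisField x d)
      ((hx.basisField_smooth b).diffAt p) ((hx.basisField_smooth d).diffAt p)
    rw [covTensor, hD.symm_γ p (basisField x b p)] at this
    rw [preKoszul]
    linarith
  rw [koszul, h, h, h, hx.conn_comm hN.torsion_free a b, hx.conn_comm hN.torsion_free a d,
    hx.conn_comm hN.torsion_free b d]
  ring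

theorem IsConnection.ℓ_basis (hN : D.IsConnection N) (hx : IsIndep x) (hℓ : D.ℓ.Smooth)
    (a b : Fin m) (p : M) :
    D.ℓ p (N (basisField x b) p (basisField x a p)) = D.koszulℓ x a b p := by
  have h := hN.nabla_ℓ p (basisField x a p) (basisField x b p)
  rw [covForm_apply N hℓ ((hx.basisField_smooth a).diffAt p)
    ((hx.basisField_smooth b).diffAt p)] at h
  rw [koszulℓ]
  linarith

theorem IsNull.ext_basis (hD : D.IsNull) (hx : IsIndep x) {p : M} {u v : TS m p}
    (hγ : ∀ d, D.γ p u (basisField x d p) = D.γ p v (basisField x d p))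
    (hℓ : D.ℓ p u = D.ℓ p v) : u = v := by
  refine hD.ext_γ_ℓ (fun w => ?_) hℓ
  rw [← hx.sum_comps w]
  simp [map_sum, hγ]

/-- The hypersurface data connection is unique. -/
theorem IsConnection.eq_basis {N' : Conn m M} (hN : D.IsConnection N) (hN' : D.IsConnection N')
    (hx : IsIndep x) (hD : D.IsNull) (hℓ : D.ℓ.Smooth) (a b : Fin m) (p : M) :
    N (basisField x b) p (basisField x a p) = N' (basisField x b) p (basisField x a p) :=
  hD.ext_basis hx (fun d => by rw [hN.γ_basis hx hD, hN'.γ_basis hx hD])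
    (by rw [hN.ℓ_basis hx hℓ, hN'.ℓ_basis hx hℓ])

/-- A Hessian sees the connection only through its values on frame fields. Uniqueness is claimed
only there, since a connection is not constrained on non-differentiable fields. -/
theorem IsConnection.box_eq {N' : Conn m M} (hN : D.IsConnection N) (hN' : D.IsConnection N')
    (hx : IsIndep x) (hD : D.IsNull) (hℓ : D.ℓ.Smooth) {f : M → ℝ} (hf : SmoothFun m f) :
    D.box N f = D.box N' f := by
  ext p
  have : covForm N (dif m f) p = covForm N' (dif m f) p := hx.ext_tensor2 fun a b => by
    rw [covForm_apply N (dif_smooth hf) ((hx.basisField_smooth a).diffAt p)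
        ((hx.basisField_smooth b).diffAt p), covForm_apply N' (dif_smooth hf)
        ((hx.basisField_smooth a).diffAt p) ((hx.basisField_smooth b).diffAt p),
      hN.eq_basis hN' hx hD hℓ]
  rw [box, box, this]

theorem IsIndep.preKoszul_smooth (hx : IsIndep x) (hD : D.IsNull) (hD' : D.IsHypersurfaceData)
    (a b d : Fin m) : SmoothFun m (D.preKoszul x a b d) :=
  ((dif_apply_smooth (hD'.smooth_γ.apply (hx.basisField_smooth b) (hx.basisField_smooth d))
    (hx.basisField_smooth a)).add ((hD'.smooth_ℓ.apply (hx.basisField_smooth b)).mul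
      (hD.K_smooth hD'.smooth_γ (hx.n_smooth hD') (hx.basisField_smooth a)
        (hx.basisField_smooth d)))).add ((hD'.smooth_ℓ.apply (hx.basisField_smooth d)).mul
      (hD.K_smooth hD'.smooth_γ (hx.n_smooth hD') (hx.basisField_smooth a)
        (hx.basisField_smooth b)))

theorem IsIndep.koszul_smooth (hx : IsIndep x) (hD : D.IsNull) (hD' : D.IsHypersurfaceData)
    (a b d : Fin m) : SmoothFun m (D.koszul x a b d) :=
  (SmoothFun.const _).mul (((hx.preKoszul_smooth hD hD' a b d).add
    (hx.preKoszul_smooth hD hD' b a d)).sub (hx.preKoszul_smooth hD hD' d a b))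

theorem IsIndep.koszulℓ_smooth (hx : IsIndep x) (hD : D.IsNull) (hD' : D.IsHypersurfaceData)
    (a b : Fin m) : SmoothFun m (D.koszulℓ x a b) :=
  (dif_apply_smooth (hD'.smooth_ℓ.apply (hx.basisField_smooth b)) (hx.basisField_smooth a)).sub
    (((hD'.smooth_Y.apply (hx.basisField_smooth a) (hx.basisField_smooth b)).add
      (F_smooth hD'.smooth_ℓ (hx.basisField_smooth a) (hx.basisField_smooth b))).sub
    (hD'.smooth_ℓ2.mul (hD.K_smooth hD'.smooth_γ (hx.n_smooth hD') (hx.basisField_smooth a)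
      (hx.basisField_smooth b))))

/-- The one-form with components `koszul`. -/
noncomputable def koszulForm (D : HData m M) (x : Fin m → M → ℝ) (a b : Fin m) : Form1 m M :=
  fun p => ∑ d, D.koszul x a b d p • dif m (x d) p

theorem IsIndep.koszulForm_apply (hx : IsIndep x) (a b d : Fin m) (p : M) :
    D.koszulForm x a b p (basisField x d p) = D.koszul x a b d p := by
  simp [koszulForm, hx.dif_basisField]

/-- The vector field `∇̄_{e_a} e_b`. -/
noncomputable def christoffel (D : HData m M) (x : Fin m → M → ℝ) (a b : Fin m) : VField m M :=
  fun p => (D.Asharp p (covec (D.koszulForm x a b p) (D.koszulℓ x a b p))).1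

theorem IsIndep.christoffel_smooth (hx : IsIndep x) (hD : D.IsNull) (hD' : D.IsHypersurfaceData)
    (a b : Fin m) : (D.christoffel x a b).Smooth := by
  refine hx.Asharp_smooth hD'.nondeg hD'.smooth_γ hD'.smooth_ℓ hD'.smooth_ℓ2 (fun d => ?_) ?_
  · simpa [covec_apply, hx.koszulForm_apply] using hx.koszul_smooth hD hD' a b d
  · simpa [covec_apply] using hx.koszulℓ_smooth hD hD' a b

/-- The flat connection for which the coordinate fields are parallel. -/
noncomputable def IsIndep.flatConn (hx : IsIndep x) : Conn m M where
  toFun Z p := ∑ b, (dif m (fun q => dif m (x b) q (Z q)) p).smulRight (basisField x b p)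
  isCovariantDerivativeOnUniv :=
    { add := fun {Z Z' p} hZ hZ' _ => by
        refine ContinuousLinearMap.ext fun v => ?_
        have h (b : Fin m) := dif_add (hx.dif_comp_mdiff hZ b) (hx.dif_comp_mdiff hZ' b) v
        simp only [sum_apply, ContinuousLinearMap.smulRight_apply, add_apply,
          Pi.add_apply, map_add, h, add_smul, Finset.sum_add_distrib]
      leibniz := fun {Z f p} hZ hf _ => by
        refine ContinuousLinearMap.ext fun v => ?_
        have h (b : Fin m) := dif_mul hf (hx.dif_comp_mdiff hZ b) v
        simp only [sum_apply, ContinuousLinearMap.smulRight_apply, add_apply,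
          smul_apply, Pi.smul_apply', map_smul, smul_eq_mul, h, add_smul, Finset.sum_add_distrib,
          Finset.smul_sum, mul_smul]
        congr 1
        simp only [smul_comm (dif m (x _) p (Z p)), ← Finset.smul_sum, hx.sum_comps]
        rfl }

theorem IsIndep.flatConn_apply (hx : IsIndep x) (Z : VField m M) (p : M) (v : TS m p) :
    hx.flatConn Z p v = ∑ b, dif m (fun q => dif m (x b) q (Z q)) p v • basisField x b p := by
  change (∑ b, (dif m (fun q => dif m (x b) q (Z q)) p).smulRight (basisField x b p)) v = _
  simp

theorem IsIndep.flatConn_basisField (hx : IsIndep x) (a : Fin m) (p : M) (v : TS m p) :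
    hx.flatConn (basisField x a) p v = 0 := by
  simp only [hx.flatConn_apply, hx.dif_basisField, dif_const]
  simp

theorem IsIndep.torsion_eq_zero (hx : IsIndep x) (N : Conn m M)
    (h : ∀ a b p, N (basisField x b) p (basisField x a p) = N (basisField x a) p (basisField x b p)) :
    N.torsion = 0 := by
  ext p v w
  rw [← hx.sum_comps v, ← hx.sum_comps w]
  have h' (a b : Fin m) : N.torsion p (basisField x a p) (basisField x b p) = 0 := by
    rw [N.torsion_apply ((hx.basisField_smooth a).diffAt p) ((hx.basisField_smooth b).diffAt p),
      h, hx.bracket_basisField, sub_self, sub_self]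
  simp [map_sum, h']

theorem IsIndep.flatConn_torsion (hx : IsIndep x) : hx.flatConn.torsion = 0 :=
  hx.torsion_eq_zero _ fun a b p => by rw [hx.flatConn_basisField, hx.flatConn_basisField]

theorem IsIndep.bracket_right (hx : IsIndep x) {X : VField m M} {p : M} (hX : X.DiffAt p)
    (a : Fin m) : VectorField.mlieBracket (𝓡 m) X (basisField x a) p
      = -∑ b, dif m (fun q => dif m (x b) q (X q)) p (basisField x a p) • basisField x b p := by
  rw [Conn.bracket_eq hx.flatConn_torsion hX ((hx.basisField_smooth a).diffAt p),
    hx.flatConn_basisField, hx.flatConn_apply, zero_sub]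

/-- The `e_a`-derivative of `γ(e_b, n) = 0`. -/
theorem IsNull.sum_dif_γ_n (hD : D.IsNull) (hx : IsIndep x) (hD' : D.IsHypersurfaceData)
    (a b : Fin m) (p : M) :
    ∑ d, dif m (x d) p (D.n p) * dif m (fun q => D.γ q (basisField x b q) (basisField x d q)) p
      (basisField x a p)
      = D.γ p (basisField x b p) (VectorField.mlieBracket (𝓡 m) D.n (basisField x a) p) := by
  have hn := (hx.n_smooth hD').diffAt p
  have h1 : (fun q => D.γ q (basisField x b q) (D.n q)) = fun q => ∑ d, dif m (x d) q (D.n q)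
      * D.γ q (basisField x b q) (basisField x d q) := by
    ext q
    conv_lhs => rw [← hx.sum_comps (D.n q)]
    simp [map_sum]
  have h2 : dif m (fun q => D.γ q (basisField x b q) (D.n q)) p (basisField x a p) = 0 := by
    simp [hD.γ_n_right, dif_const]
  have h3 (d : Fin m) := hD'.smooth_γ.apply_mdiff ((hx.basisField_smooth b).diffAt p)
    ((hx.basisField_smooth d).diffAt p)
  have h5 (d : Fin m) : MDifferentiableAt (𝓡 m) 𝓘(ℝ) (fun q => dif m (x d) q (D.n q)
      * D.γ q (basisField x b q) (basisField x d q)) p := (hx.dif_comp_mdiff hn d).mul (h3 d)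
  rw [h1, dif_sum _ h5] at h2
  simp only [dif_mul (hx.dif_comp_mdiff hn _) (h3 _), Finset.sum_add_distrib] at h2
  rw [hx.bracket_right hn, map_neg, map_sum]
  simp only [map_smul, smul_eq_mul]
  have h4 := eq_neg_of_add_eq_zero_left h2
  rw [h4]
  simp only [mul_comm]

/-- The solvability condition for the Christoffel symbols: a form `γ(u, ·)` annihilates `n`.
Contraction with `n` leaves `½ (γ(e_b, [n, e_a]) + γ(e_a, [n, e_b]) + 2 K_ab - n(γ_ab))`, which is
zero because `2K = ℒ_n γ`. -/
theorem IsNull.koszulForm_n (hD : D.IsNull) (hx : IsIndep x) (hD' : D.IsHypersurfaceData)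
    (a b : Fin m) (p : M) : D.koszulForm x a b p (D.n p) = 0 := by
  have hn := hx.n_smooth hD'
  have hlin (α : TS m p →L[ℝ] ℝ) :
      ∑ d, dif m (x d) p (D.n p) * α (basisField x d p) = α (D.n p) := by
    conv_rhs => rw [← hx.sum_comps (D.n p)]
    simp [map_sum]
  have h1 (a b : Fin m) : ∑ d, dif m (x d) p (D.n p) * D.preKoszul x a b d p
      = D.γ p (basisField x b p) (VectorField.mlieBracket (𝓡 m) D.n (basisField x a) p)
        + D.K p (basisField x a p) (basisField x b p) := by
    have hK := hlin (D.ℓ p (basisField x b p) • D.K p (basisField x a p))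
    have hℓ := hlin (D.K p (basisField x a p) (basisField x b p) • D.ℓ p)
    simp only [smul_apply, smul_eq_mul, hD.K_n_right hD'.smooth_γ hn, hD.ℓ_n] at hK hℓ
    rw [← hD.sum_dif_γ_n hx hD' a b p]
    simp only [preKoszul, mul_add, Finset.sum_add_distrib, hK]
    simp only [mul_comm (D.ℓ p (basisField x _ p)) (D.K p (basisField x a p) (basisField x b p)),
      hℓ]
    ring
  have h2 : ∑ d, dif m (x d) p (D.n p) * D.preKoszul x d a b p
      = dif m (fun q => D.γ q (basisField x a q) (basisField x b q)) p (D.n p) := by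
    have hlin2 (c : ℝ) (w : TS m p) :
        ∑ d, dif m (x d) p (D.n p) * (c * D.K p (basisField x d p) w) = 0 := by
      simp only [hD.K_symm hD'.smooth_γ _ w]
      have := hlin (c • D.K p w)
      simpa only [smul_apply, smul_eq_mul, hD.K_n_right hD'.smooth_γ hn, mul_zero] using this
    simp only [preKoszul, mul_add, Finset.sum_add_distrib, hlin2, hlin]
    ring
  have h3 : D.koszulForm x a b p (D.n p) = 1 / 2 *
      (∑ d, dif m (x d) p (D.n p) * D.preKoszul x a b d p
      + ∑ d, dif m (x d) p (D.n p) * D.preKoszul x b a d p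
      - ∑ d, dif m (x d) p (D.n p) * D.preKoszul x d a b p) := by
    rw [← Finset.sum_add_distrib, ← Finset.sum_sub_distrib, Finset.mul_sum, koszulForm,
      sum_apply]
    refine Finset.sum_congr rfl fun d _ => ?_
    simp only [smul_apply, smul_eq_mul, koszul]
    ring
  rw [h3, h1, h1, h2, hD.K_symm hD'.smooth_γ (basisField x b p),
    hD.K_apply hD'.smooth_γ ((hx.basisField_smooth a).diffAt p)
      ((hx.basisField_smooth b).diffAt p), hD.symm_γ p (basisField x b p)]
  ring

/-- By `koszulForm_n` the scalar part of the `𝒜♯`-image vanishes, and so its vector part has exactly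
the prescribed products. -/
theorem IsNull.γ_christoffel (hD : D.IsNull) (hx : IsIndep x) (hD' : D.IsHypersurfaceData)
    (a b d : Fin m) (p : M) :
    D.γ p (D.christoffel x a b p) (basisField x d p) = D.koszul x a b d p ∧
      D.ℓ p (D.christoffel x a b p) = D.koszulℓ x a b p := by
  have h := Asharp_apply (hD.nondeg p) (covec (D.koszulForm x a b p) (D.koszulℓ x a b p))
  have h1 : (D.Asharp p (covec (D.koszulForm x a b p) (D.koszulℓ x a b p))).2 = 0 := by
    simpa [A_apply, covec_apply, hD.γ_n_right, hD.ℓ_n, hD.koszulForm_n hx hD'] using h (D.n p, 0)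
  refine ⟨?_, ?_⟩
  · rw [← hx.koszulForm_apply]
    simpa [A_apply, covec_apply, h1, christoffel] using h (basisField x d p, 0)
  · simpa [A_apply, covec_apply, h1, christoffel] using h (0, 1)

/-- The hypersurface data connection, in terms of its Christoffel symbols. -/
noncomputable def IsIndep.hypersurfaceConn (hx : IsIndep x) (D : HData m M) : Conn m M :=
  -- The added form takes the differentiated field first and the direction second.
  hx.flatConn.addOneForm fun p => ∑ a, ∑ b,
    (dif m (x b) p).smulRight ((dif m (x a) p).smulRight (D.christoffel x a b p))

theorem IsIndep.hypersurfaceConn_basis (hx : IsIndep x) (D : HData m M) (a b : Fin m) (p : M) :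
    hx.hypersurfaceConn D (basisField x b) p (basisField x a p) = D.christoffel x a b p := by
  change hx.flatConn (basisField x b) p (basisField x a p) + (∑ a, ∑ b,
    (dif m (x b) p).smulRight ((dif m (x a) p).smulRight (D.christoffel x a b p)))
      (basisField x b p) (basisField x a p) = _
  rw [hx.flatConn_basisField]
  simp [hx.dif_basisField]

theorem koszul_comm (D : HData m M) (hK : ∀ p v w, D.K p v w = D.K p w v)
    (hs : ∀ p v w, D.γ p v w = D.γ p w v) (a b d : Fin m) (p : M) :
    D.koszul x a b d p = D.koszul x b a d p := by
  simp only [koszul, preKoszul, hK p (basisField x a p), hs _ (basisField x a _)]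
  ring

theorem koszulℓ_comm (D : HData m M) (hx : IsIndep x) (hK : ∀ p v w, D.K p v w = D.K p w v)
    (hY : ∀ p v w, D.Y p v w = D.Y p w v) (hℓ : D.ℓ.Smooth) (a b : Fin m) (p : M) :
    D.koszulℓ x a b p = D.koszulℓ x b a p := by
  have hF (a b : Fin m) : D.F p (basisField x a p) (basisField x b p) = 1 / 2 *
      (dif m (fun q => D.ℓ q (basisField x b q)) p (basisField x a p)
        - dif m (fun q => D.ℓ q (basisField x a q)) p (basisField x b p)) := by
    have := extD_apply hℓ ((hx.basisField_smooth a).diffAt p) ((hx.basisField_smooth b).diffAt p)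
    rw [hx.bracket_basisField, map_zero, sub_zero] at this
    rw [← this]
    rfl
  rw [koszulℓ, koszulℓ, hF, hF, hK p (basisField x a p), hY p (basisField x a p)]
  ring

/-- Existence of the hypersurface data connection. -/
theorem IsNull.isConnection (hD : D.IsNull) (hx : IsIndep x) (hD' : D.IsHypersurfaceData) :
    D.IsConnection (hx.hypersurfaceConn D) := by
  have hK : ∀ p v w, D.K p v w = D.K p w v := fun p => hD.K_symm hD'.smooth_γ
  have hsymm (a b : Fin m) (p : M) : D.christoffel x a b p = D.christoffel x b a p := by
    refine hD.ext_basis hx (fun d => ?_) ?_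
    · rw [(hD.γ_christoffel hx hD' a b d p).1, (hD.γ_christoffel hx hD' b a d p).1,
        koszul_comm D hK hD.symm_γ]
    · rw [(hD.γ_christoffel hx hD' a b a p).2, (hD.γ_christoffel hx hD' b a a p).2,
        koszulℓ_comm D hx hK hD'.symm_Y hD'.smooth_ℓ]
  refine ⟨hx.torsion_eq_zero _ fun a b p => ?_, fun p v Z W hZ hW => ?_, fun p v w => ?_⟩
  · rw [hx.hypersurfaceConn_basis, hx.hypersurfaceConn_basis, hsymm]
  · have hγ := hD'.smooth_γ
    set N := hx.hypersurfaceConn D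
    have hb (a : Fin m) := (hx.basisField_smooth a).diffAt p
    have key (a b d : Fin m) : covTensor N D.γ p (basisField x a p) (basisField x b)
        (basisField x d) + D.ℓ p (basisField x b p) * D.K p (basisField x a p) (basisField x d p)
        + D.ℓ p (basisField x d p) * D.K p (basisField x a p) (basisField x b p) = 0 := by
      have h1 := (hD.γ_christoffel hx hD' a b d p).1
      have h2 := (hD.γ_christoffel hx hD' a d b p).1
      rw [covTensor, hx.hypersurfaceConn_basis, hx.hypersurfaceConn_basis, h1,
        hD.symm_γ p (basisField x b p), h2]
      simp only [koszul, preKoszul, hK p (basisField x d p), hK p (basisField x b p)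
        (basisField x a p), hD.symm_γ _ (basisField x d _)]
      ring
    have key2 (b d : Fin m) : covTensor N D.γ p v (basisField x b)
        (basisField x d) + (D.ℓ p (basisField x b p) * D.K p v (basisField x d p)
        + D.ℓ p (basisField x d p) * D.K p v (basisField x b p)) = 0 := by
      have hsum (w : TS m p) : D.K p v w = ∑ a, dif m (x a) p v * D.K p (basisField x a p) w := by
        conv_lhs => rw [← hx.sum_comps v]
        simp [map_sum]
      rw [hx.covTensor_sum, hsum, hsum, Finset.mul_sum, Finset.mul_sum, ← Finset.sum_add_distrib,
        ← Finset.sum_add_distrib]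
      refine Finset.sum_eq_zero fun a _ => ?_
      linear_combination dif m (x a) p v * key a b d
    -- Tensoriality extends the identity from frame fields to `Z`, and then to `W`.
    have key3 (d : Fin m) := hx.tensorial_eq_zero ((covTensor_tensorial_left N hγ v (hb d)).add_linear
      (D.K p v (basisField x d p) • D.ℓ p + D.ℓ p (basisField x d p) • D.K p v))
      (fun b => by simpa [mul_comm (D.K p v _)] using key2 b d) hZ
    have key4 := hx.tensorial_eq_zero ((covTensor_tensorial_right N hγ v hZ).add_linear
      (D.ℓ p (Z p) • D.K p v + D.K p v (Z p) • D.ℓ p))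
      (fun b => by
        have := key3 b
        simp only [add_apply, smul_apply, smul_eq_mul] at this ⊢
        linarith) hW
    simp only [add_apply, smul_apply, smul_eq_mul] at key4
    linarith
  · have : covForm (hx.hypersurfaceConn D) D.ℓ p = D.Y p + D.F p - D.ℓ2 p • D.K p := by
      refine hx.ext_tensor2 fun a b => ?_
      rw [covForm_apply _ hD'.smooth_ℓ ((hx.basisField_smooth a).diffAt p)
        ((hx.basisField_smooth b).diffAt p), hx.hypersurfaceConn_basis,
        (hD.γ_christoffel hx hD' a b a p).2, koszulℓ]
      change _ = D.Y p (basisField x a p) (basisField x b p)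
        + D.F p (basisField x a p) (basisField x b p)
        - D.ℓ2 p * D.K p (basisField x a p) (basisField x b p)
      ring
    rw [this]
    rfl

end HData

end

/-! ### Gauge transformation of `K` and of the connection -/

section

variable {m : ℕ} {M : Type*} [TopologicalSpace M] [ChartedSpace (EuclideanSpace ℝ (Fin m)) M]
  [IsManifold (𝓡 m) ∞ M]

theorem Form1.Smooth.gauge {α : Form1 m M} (hα : α.Smooth) {T : Tensor2 m M} (hT : T.Smooth)
    {z : M → ℝ} (hz : SmoothFun m z) {ζ : VField m M} (hζ : ζ.Smooth) :
    Form1.Smooth (fun p => z p • (α p + T p (ζ p))) := by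
  have h1 : Form1.Smooth (fun p => T p (ζ p)) := ContMDiff.clm_bundle_apply
    (E₂ := fun q : M => TS m q →L[ℝ] Bundle.Trivial M ℝ q) hT hζ
  exact ContMDiff.smul_section (V := fun q : M => TS m q →L[ℝ] Bundle.Trivial M ℝ q) hz
    (ContMDiff.add_section hα h1)

theorem HData.IsIndep.extD_dif {x : Fin m → M → ℝ} (hx : HData.IsIndep x) (a : Fin m) (p : M) :
    extD (dif m (x a)) p = 0 := by
  refine hx.ext_tensor2 fun b c => ?_
  rw [extD_apply (dif_smooth (hx.1 a)) ((hx.basisField_smooth b).diffAt p)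
    ((hx.basisField_smooth c).diffAt p), hx.bracket_basisField]
  simp only [hx.dif_basisField, dif_const]
  simp

namespace HData

variable {D : HData m M} {x : Fin m → M → ℝ} {N : Conn m M} {p : M} {z : M → ℝ} {ζ : VField m M}

theorem IsConnection.nabla_ℓ_n_n (hN : D.IsConnection N) (hD : D.IsNull) (hγ : D.γ.Smooth)
    (hℓ : D.ℓ.Smooth) (hn : D.n.Smooth) : covForm N D.ℓ p (D.n p) (D.n p) = 2 * D.omega p := by
  rw [hN.nabla_ℓ, F_self hℓ, hD.K_n hγ hn, omega]
  ring

theorem IsHypersurfaceData.gauge_ℓ_smooth (hD' : D.IsHypersurfaceData) (hg : IsGaugeParam z ζ) :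
    (D.gauge z ζ).ℓ.Smooth :=
  hD'.smooth_ℓ.gauge hD'.smooth_γ hg.smooth_z hg.smooth_ζ

theorem IsNull.gauge_n_smooth (hD : D.IsNull) (hn : D.n.Smooth) (hg : IsGaugeParam z ζ) :
    (D.gauge z ζ).n.Smooth := by
  have : (D.gauge z ζ).n = fun p => (z p)⁻¹ • D.n p := funext fun p => hD.gauge_n hg.ne_zero p
  rw [this]
  exact hn.smul (hg.smooth_z.inv hg.ne_zero)

/-- In `ℒ_{fn} γ` the derivatives of `f` are multiplied by `γ(n, ·) = 0`, so rescaling `n` only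
rescales `K`. -/
theorem IsNull.gauge_K (hD : D.IsNull) (hN : N.torsion = 0) (hγ : D.γ.Smooth) (hn : D.n.Smooth)
    (hg : IsGaugeParam z ζ) (v w : TS m p) :
    (D.gauge z ζ).K p v w = (z p)⁻¹ * D.K p v w := by
  obtain ⟨Z, hZ, rfl⟩ := exists_field v
  obtain ⟨W, hW, rfl⟩ := exists_field w
  have hzi := (hg.smooth_z.inv hg.ne_zero).mdiff p
  have h : (D.gauge z ζ).n = (fun p => (z p)⁻¹) • D.n := funext fun p => hD.gauge_n hg.ne_zero p
  rw [(hD.gauge hg.ne_zero).K_eq, hD.K_eq]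
  change 1 / 2 * lieDeriv (D.gauge z ζ).n D.γ p (Z p) (W p)
    = (z p)⁻¹ * (1 / 2 * lieDeriv D.n D.γ p (Z p) (W p))
  rw [lieDeriv_eq hN hγ ((hD.gauge_n_smooth hn hg).diffAt p) hZ hW,
    lieDeriv_eq hN hγ (hn.diffAt p) hZ hW, h, Conn.smul N hzi (hn.diffAt p),
    Conn.smul N hzi (hn.diffAt p)]
  simp only [covTensor, Pi.smul_apply', map_add, map_smul, add_apply, smul_apply, smul_eq_mul,
    hD.γ_n, hD.γ_n_right, zero_apply]
  ring

theorem IsConnection.covTensor_n (hN : D.IsConnection N) (hD : D.IsNull) (hγ : D.γ.Smooth)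
    (hn : D.n.Smooth) {Z W : VField m M} (hZ : Z.DiffAt p) (hW : W.DiffAt p) :
    covTensor N D.γ p (D.n p) Z W = 0 := by
  rw [hN.nabla_γ p _ Z W hZ hW, hD.K_n hγ hn, hD.K_n hγ hn]
  ring

theorem IsConnection.covForm_gauge_ℓ (hN : D.IsConnection N) (hD' : D.IsHypersurfaceData)
    (hg : IsGaugeParam z ζ) (v w : TS m p) :
    covForm N (D.gauge z ζ).ℓ p v w = dif m z p v * (D.ℓ p w + D.γ p (ζ p) w)
      + z p * (covForm N D.ℓ p v w - D.ℓ p (ζ p) * D.K p v w - D.ℓ p w * D.K p v (ζ p)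
        + D.γ p (N ζ p v) w) := by
  obtain ⟨Z, hZ, rfl⟩ := exists_field v
  obtain ⟨W, hW, rfl⟩ := exists_field w
  have hζ := hg.smooth_ζ.diffAt p
  have hz := hg.smooth_z.mdiff p
  have h1 := hD'.smooth_ℓ.apply_mdiff hW
  have h2 := hD'.smooth_γ.apply_mdiff hζ hW
  have h3 := hN.nabla_γ p (Z p) ζ W hζ hW
  have h4 : dif m (fun q => (D.gauge z ζ).ℓ q (W q)) p (Z p)
      = z p * (dif m (fun q => D.ℓ q (W q)) p (Z p) + dif m (fun q => D.γ q (ζ q) (W q)) p (Z p))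
        + (D.ℓ p (W p) + D.γ p (ζ p) (W p)) * dif m z p (Z p) := by
    rw [← dif_add h1 h2]
    exact dif_mul hz (h1.add h2) (Z p)
  rw [covForm_apply N (hD'.gauge_ℓ_smooth hg) hZ hW, h4,
    covForm_apply N hD'.smooth_ℓ hZ hW, gauge_ℓ_apply]
  rw [covTensor] at h3
  linear_combination z p * h3

theorem gauge_Y_apply (v w : TS m p) : (D.gauge z ζ).Y p v w = z p * D.Y p v w
    + 1 / 2 * (D.ℓ p v * dif m z p w + dif m z p v * D.ℓ p w)
    + 1 / 2 * lieDeriv (fun q => z q • ζ q) D.γ p v w := rfl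

theorem IsConnection.lieDeriv_smul (hN : D.IsConnection N) (hD : D.IsNull)
    (hD' : D.IsHypersurfaceData) (hg : IsGaugeParam z ζ) (v w : TS m p) :
    lieDeriv (fun q => z q • ζ q) D.γ p v w
      = z p * (-D.ℓ p v * D.K p (ζ p) w - D.ℓ p w * D.K p (ζ p) v + D.γ p (N ζ p v) w
        + D.γ p (N ζ p w) v) + dif m z p v * D.γ p (ζ p) w + dif m z p w * D.γ p (ζ p) v := by
  obtain ⟨Z, hZ, rfl⟩ := exists_field v
  obtain ⟨W, hW, rfl⟩ := exists_field w
  have hζ := hg.smooth_ζ.diffAt p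
  have hz := hg.smooth_z.mdiff p
  have h1 : (fun q => z q • ζ q) = z • ζ := rfl
  have h2 := hN.nabla_γ p (ζ p) Z W hZ hW
  have h3 : (z • ζ).DiffAt p := hζ.smul hz
  rw [h1, lieDeriv_eq hN.torsion_free hD'.smooth_γ h3 hZ hW, Conn.smul N hz hζ,
    Conn.smul N hz hζ]
  simp only [covTensor, Pi.smul_apply', map_add, map_smul, add_apply, smul_apply, smul_eq_mul,
    hD.symm_γ p (Z p) (ζ p), hD.symm_γ p (Z p) (N ζ p (W p))] at h2 ⊢
  linear_combination z p * h2

/-- The connection of the gauge transformed data. -/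
noncomputable def gaugeConn (D : HData m M) (x : Fin m → M → ℝ) (N : Conn m M)
    (ζ : VField m M) : Conn m M :=
  N.addOneForm fun p => ∑ b, (dif m (x b) p).smulRight
    ((D.K p (basisField x b p)).smulRight (ζ p))

theorem IsIndep.gaugeConn_apply (hx : IsIndep x) (hK : ∀ p v w, D.K p v w = D.K p w v)
    (Z : VField m M) (v : TS m p) :
    D.gaugeConn x N ζ Z p v = N Z p v + D.K p v (Z p) • ζ p := by
  have h : (∑ b, (dif m (x b) p).smulRight ((D.K p (basisField x b p)).smulRight (ζ p))) (Z p) v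
      = D.K p (Z p) v • ζ p := by
    conv_rhs => rw [← hx.sum_comps (Z p)]
    simp [map_sum, Finset.sum_smul, mul_smul]
  rw [hK, ← h]
  rfl

theorem IsIndep.gaugeConn_covForm (hx : IsIndep x) (hK : ∀ p v w, D.K p v w = D.K p w v)
    {α : Form1 m M} (hα : α.Smooth) (v w : TS m p) :
    covForm (D.gaugeConn x N ζ) α p v w = covForm N α p v w - D.K p v w * α p (ζ p) := by
  obtain ⟨Z, hZ, rfl⟩ := exists_field v
  obtain ⟨W, hW, rfl⟩ := exists_field w
  rw [covForm_apply _ hα hZ hW, covForm_apply _ hα hZ hW, hx.gaugeConn_apply hK, map_add,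
    map_smul, smul_eq_mul]
  ring

/-- Adding `K ⊗ ζ` changes `∇̄γ` by `-K(X, Z) γ(ζ, W) - K(X, W) γ(ζ, Z)`, which is what replacing
`ℓ` by `ℓ + γ(ζ, ·)` demands; the factors `z` of `ℓ'` and `z⁻¹` of `K'` cancel. -/
theorem IsConnection.gauge (hN : D.IsConnection N) (hx : IsIndep x) (hD : D.IsNull)
    (hD' : D.IsHypersurfaceData) (hg : IsGaugeParam z ζ) :
    (D.gauge z ζ).IsConnection (D.gaugeConn x N ζ) := by
  have hK : ∀ p v w, D.K p v w = D.K p w v := fun p => hD.K_symm hD'.smooth_γ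
  have hn := hx.n_smooth hD'
  have hℓ' := hD'.gauge_ℓ_smooth hg
  have htor : (D.gaugeConn x N ζ).torsion = 0 := hx.torsion_eq_zero _ fun a b p => by
    rw [hx.gaugeConn_apply hK, hx.gaugeConn_apply hK, hx.conn_comm hN.torsion_free a b, hK]
  refine ⟨htor, fun p v Z W hZ hW => ?_, fun p v w => ?_⟩
  · have h := hN.nabla_γ p v Z W hZ hW
    have hz := hg.ne_zero p
    rw [hD.gauge_K hN.torsion_free hD'.smooth_γ hn hg, hD.gauge_K hN.torsion_free hD'.smooth_γ hn hg,
      gauge_ℓ_apply, gauge_ℓ_apply]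
    simp only [covTensor, hx.gaugeConn_apply hK, gauge_γ, map_add, map_smul, add_apply, smul_apply,
      smul_eq_mul, hD.symm_γ p (Z p) (ζ p)] at h ⊢
    field_simp
    linear_combination h
  -- For a torsion-free connection `F'` is the antisymmetric part of `∇'ℓ'`, so only the symmetric
  -- part of the equation has content.
  · have hF : (D.gauge z ζ).F p v w = 1 / 2 * (covForm (D.gaugeConn x N ζ) (D.gauge z ζ).ℓ p v w
        - covForm (D.gaugeConn x N ζ) (D.gauge z ζ).ℓ p w v) := by
      rw [← extD_eq htor hℓ']
      rfl
    have h1 := hN.nabla_ℓ p v w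
    have h2 := hN.nabla_ℓ p w v
    rw [F_antisymm hD'.smooth_ℓ w v, hD'.symm_Y, hK] at h2
    have hz := hg.ne_zero p
    rw [hF, gauge_Y_apply, hN.lieDeriv_smul hD hD' hg, hD.gauge_K hN.torsion_free hD'.smooth_γ hn hg,
      hx.gaugeConn_covForm hK hℓ', hx.gaugeConn_covForm hK hℓ', hN.covForm_gauge_ℓ hD' hg,
      hN.covForm_gauge_ℓ hD' hg, gauge_ℓ_apply, gauge_ℓ2_apply, h1, h2, hK p w v, hK p (ζ p) v,
      hK p (ζ p) w]
    field_simp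
    ring

end HData

end

/-! ### The harmonic conditions in terms of the gauge parameters -/

section

variable {m : ℕ} {M : Type*} [TopologicalSpace M] [ChartedSpace (EuclideanSpace ℝ (Fin m)) M]
  [IsManifold (𝓡 m) ∞ M]

namespace HData

variable {D : HData m M} {x : Fin m → M → ℝ} {N : Conn m M} {p : M} {z : M → ℝ} {ζ : VField m M}

/-- The vector field `2 P(∇̄_n ℓ, ·) + n(ℓ⁽²⁾) n`. -/
noncomputable def ellVec (D : HData m M) (N : Conn m M) : VField m M := fun p =>
  (2 : ℝ) • D.P p (covForm N D.ℓ p (D.n p)) + dif m D.ℓ2 p (D.n p) • D.n p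

theorem IsHypersurfaceData.dif_ℓ (hD' : D.IsHypersurfaceData) (N : Conn m M)
    {Z : VField m M} (hZ : Z.DiffAt p) : dif m (fun q => D.ℓ q (Z q)) p (D.n p)
      = covForm N D.ℓ p (D.n p) (Z p) + D.ℓ p (N Z p (D.n p)) := by
  obtain ⟨W, hW, hWp⟩ := exists_field (D.n p)
  rw [← hWp, covForm_apply N hD'.smooth_ℓ hW hZ]
  ring

theorem IsConnection.dif_γ (hN : D.IsConnection N) (hD : D.IsNull) (hγ : D.γ.Smooth)
    (hn : D.n.Smooth) {Z W : VField m M} (hZ : Z.DiffAt p) (hW : W.DiffAt p) :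
    dif m (fun q => D.γ q (Z q) (W q)) p (D.n p)
      = D.γ p (N Z p (D.n p)) (W p) + D.γ p (Z p) (N W p (D.n p)) := by
  have h := hN.covTensor_n hD hγ hn hZ hW
  rw [covTensor] at h
  linarith

/-- The terms of `P' - P` contain a factor `n`, which `K` annihilates. -/
theorem IsNull.gauge_trP_K (hD : D.IsNull) (hN : N.torsion = 0) (hγ : D.γ.Smooth)
    (hn : D.n.Smooth) (hg : IsGaugeParam z ζ) :
    (D.gauge z ζ).trP p ((D.gauge z ζ).K p) = (z p)⁻¹ * D.trP p (D.K p) := by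
  have h : (D.gauge z ζ).K p = (z p)⁻¹ • D.K p :=
    ContinuousLinearMap.ext fun v => ContinuousLinearMap.ext fun w => hD.gauge_K hN hγ hn hg v w
  rw [h, trP_smul, hD.gauge_trP hg.ne_zero, hD.K_n hγ hn, hD.K_n_right hγ hn, sub_zero, sub_zero]

theorem IsConnection.gauge_omega (hN : D.IsConnection N) (hD : D.IsNull)
    (hD' : D.IsHypersurfaceData) (hn : D.n.Smooth) (hg : IsGaugeParam z ζ) :
    (D.gauge z ζ).omega p = (z p)⁻¹ * D.omega p + (z p)⁻¹ ^ 2 * (1 / 2 * dif m z p (D.n p)) := by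
  have hz := hg.ne_zero p
  rw [omega, hD.gauge_n hg.ne_zero]
  simp only [map_smul, smul_apply, smul_eq_mul]
  rw [gauge_Y_apply, hN.lieDeriv_smul hD hD' hg, hD.ℓ_n, hD.K_n_right hD'.smooth_γ hn,
    hD.γ_n_right, hD.γ_n_right, omega]
  field_simp
  ring

theorem IsConnection.gauge_covForm_n (hN : D.IsConnection N) (hx : IsIndep x) (hD : D.IsNull)
    (hD' : D.IsHypersurfaceData) (hg : IsGaugeParam z ζ) :
    covForm (D.gaugeConn x N ζ) (D.gauge z ζ).ℓ p ((D.gauge z ζ).n p)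
      = ((z p)⁻¹ * dif m z p (D.n p)) • (D.ℓ p + D.γ p (ζ p))
        + (covForm N D.ℓ p (D.n p) + D.γ p (N ζ p (D.n p))) := by
  have hn := hx.n_smooth hD'
  have hz := hg.ne_zero p
  refine ContinuousLinearMap.ext fun w => ?_
  rw [hD.gauge_n hg.ne_zero]
  simp only [map_smul, smul_apply, smul_eq_mul, add_apply]
  rw [hx.gaugeConn_covForm (fun p => hD.K_symm hD'.smooth_γ) (hD'.gauge_ℓ_smooth hg),
    hN.covForm_gauge_ℓ hD' hg, hD.K_n hD'.smooth_γ hn, hD.K_n hD'.smooth_γ hn]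
  field_simp
  ring

theorem IsConnection.gauge_dif_ℓ2 (hN : D.IsConnection N) (hD : D.IsNull)
    (hD' : D.IsHypersurfaceData) (hn : D.n.Smooth) (hg : IsGaugeParam z ζ) :
    dif m (D.gauge z ζ).ℓ2 p (D.n p)
      = z p ^ 2 * (dif m D.ℓ2 p (D.n p) + 2 * (covForm N D.ℓ p (D.n p) (ζ p)
          + D.ℓ p (N ζ p (D.n p))) + 2 * D.γ p (N ζ p (D.n p)) (ζ p))
        + 2 * z p * dif m z p (D.n p) * (D.ℓ2 p + 2 * D.ℓ p (ζ p) + D.γ p (ζ p) (ζ p)) := by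
  have hζ := hg.smooth_ζ.diffAt p
  have hz := hg.smooth_z.mdiff p
  have h1 := hD'.smooth_ℓ.apply_mdiff hζ
  have h2 := hD'.smooth_γ.apply_mdiff hζ hζ
  have h3 := hD'.smooth_ℓ2.mdiff p
  have hc : MDifferentiableAt (𝓡 m) 𝓘(ℝ) (fun _ : M => (2 : ℝ)) p := mdifferentiableAt_const
  have h4 : (D.gauge z ζ).ℓ2 = fun q => z q * z q * ((D.ℓ2 q + 2 * D.ℓ q (ζ q))
      + D.γ q (ζ q) (ζ q)) := by
    ext q
    rw [gauge_ℓ2_apply]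
    ring
  have h5 : MDifferentiableAt (𝓡 m) 𝓘(ℝ) (fun q => 2 * D.ℓ q (ζ q)) p := hc.mul h1
  have h6 : MDifferentiableAt (𝓡 m) 𝓘(ℝ) (fun q => D.ℓ2 q + 2 * D.ℓ q (ζ q)) p := h3.add h5
  have h7 : MDifferentiableAt (𝓡 m) 𝓘(ℝ) (fun q => (D.ℓ2 q + 2 * D.ℓ q (ζ q))
      + D.γ q (ζ q) (ζ q)) p := h6.add h2
  have h8 : MDifferentiableAt (𝓡 m) 𝓘(ℝ) (fun q => z q * z q) p := hz.mul hz
  rw [h4, dif_mul h8 h7, dif_mul hz hz, dif_add h6 h2, dif_add h3 h5, dif_mul hc h1, dif_const,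
    hD'.dif_ℓ N hζ, hN.dif_γ hD hD'.smooth_γ hn hζ hζ, hD.symm_γ p (ζ p) (N ζ p (D.n p))]
  simp only [zero_apply]
  ring

/-- The term `-α(n) ζ` of `P'` cancels `n(z)` in front of `ζ` and, as `(∇̄_n ℓ)(n) = 2ω`, leaves
`-4ω ζ`. The new multiples of `n` cancel against the change of `n(ℓ⁽²⁾) n`. -/
theorem IsConnection.gauge_ellVec (hN : D.IsConnection N) (hx : IsIndep x) (hD : D.IsNull)
    (hD' : D.IsHypersurfaceData) (hg : IsGaugeParam z ζ) :
    (D.gauge z ζ).ellVec (D.gaugeConn x N ζ) p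
      = D.ellVec N p + (2 : ℝ) • N ζ p (D.n p) - (4 * D.omega p) • ζ p := by
  have hn := hx.n_smooth hD'
  have hz := hg.ne_zero p
  have hnn := hN.nabla_ℓ_n_n (p := p) hD hD'.smooth_γ hD'.smooth_ℓ hn
  have hdℓ2 := hN.gauge_dif_ℓ2 (p := p) hD hD' hn hg
  rw [ellVec, ellVec, hN.gauge_covForm_n hx hD hD' hg, hD.gauge_P hg.ne_zero,
    hD.gauge_n hg.ne_zero]
  simp only [map_add, map_smul, add_apply, smul_apply, hD.P_ℓ, hD.P_γ, hD.ℓ_n, hD.γ_n_right, hnn,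
    hdℓ2, smul_eq_mul]
  have key (c : ℝ) : (z p)⁻¹ * (z p ^ 2 * c) = z p * c := by field_simp
  refine hx.ext_comps fun a => ?_
  simp only [map_add, map_sub, map_smul, smul_eq_mul]
  field_simp
  ring

theorem IsIndep.hessian_symm (hx : IsIndep x) (hN : N.torsion = 0) (a : Fin m) (v w : TS m p) :
    covForm N (dif m (x a)) p v w = covForm N (dif m (x a)) p w v := by
  have h := extD_eq hN (dif_smooth (hx.1 a)) v w
  rw [hx.extD_dif] at h
  exact (sub_eq_zero.1 h.symm)

/-- The change of `P` contributes `-2 (∇̄dxᵃ)(n, ζ) = -2 n(ζᵃ) + 2 dxᵃ(∇̄_n ζ)` by symmetry of the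
Hessian. The change of `∇̄` contributes `-ζᵃ K`, whose trace is the same for `P'` and `P`. -/
theorem IsConnection.gauge_box (hN : D.IsConnection N) (hx : IsIndep x) (hD : D.IsNull)
    (hD' : D.IsHypersurfaceData) (hg : IsGaugeParam z ζ) (a : Fin m) :
    (D.gauge z ζ).box (D.gaugeConn x N ζ) (x a) p
      = D.box N (x a) p - 2 * dif m (fun q => dif m (x a) q (ζ q)) p (D.n p)
        + 2 * dif m (x a) p (N ζ p (D.n p)) - D.trP p (D.K p) * dif m (x a) p (ζ p) := by
  have hn := hx.n_smooth hD'
  have hK : ∀ p v w, D.K p v w = D.K p w v := fun p => hD.K_symm hD'.smooth_γ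
  have hf := dif_smooth (hx.1 a)
  have h1 : covForm (D.gaugeConn x N ζ) (dif m (x a)) p
      = covForm N (dif m (x a)) p + (-dif m (x a) p (ζ p)) • D.K p := by
    refine ContinuousLinearMap.ext fun v => ContinuousLinearMap.ext fun w => ?_
    rw [hx.gaugeConn_covForm hK hf]
    simp only [add_apply, smul_apply, smul_eq_mul]
    ring
  have h2 := covForm_apply N hf (hn.diffAt p) (hg.smooth_ζ.diffAt p)
  rw [box, h1, trP_add, trP_smul, hD.gauge_trP hg.ne_zero, hD.gauge_trP hg.ne_zero,
    hD.K_n hD'.smooth_γ hn, hD.K_n_right hD'.smooth_γ hn,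
    hx.hessian_symm hN.torsion_free a (ζ p), h2, box]
  ring

/-- The harmonic gauge conditions as transport equations for the gauge parameters. -/
theorem IsConnection.gauge_isHarmonic_iff (hN : D.IsConnection N) (hx : IsIndep x)
    (hD : D.IsNull) (hD' : D.IsHypersurfaceData) (hg : IsGaugeParam z ζ) :
    (D.gauge z ζ).IsHarmonic x ↔
      (∀ p, dif m z p (D.n p) = 1 / 2 * (D.trP p (D.K p) - 4 * D.omega p) * z p) ∧
      ∀ p a, dif m (fun q => dif m (x a) q (ζ q)) p (D.n p)
        = 1 / 2 * (D.box N (x a) p - dif m (x a) p (D.ellVec N p))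
          - 1 / 2 * (D.trP p (D.K p) - 4 * D.omega p) * dif m (x a) p (ζ p) := by
  have hn := hx.n_smooth hD'
  have hN' := hN.gauge hx hD hD' hg
  have h1 (p : M) : (D.gauge z ζ).trP p ((D.gauge z ζ).K p) - 4 * (D.gauge z ζ).omega p = 0 ↔
      dif m z p (D.n p) = 1 / 2 * (D.trP p (D.K p) - 4 * D.omega p) * z p := by
    have hz := hg.ne_zero p
    rw [hD.gauge_trP_K hN.torsion_free hD'.smooth_γ hn hg, hN.gauge_omega hD hD' hn hg]
    field_simp
    constructor <;> intro h <;> linarith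
  have h2 (p : M) : (D.gauge z ζ).ellVec (D.gaugeConn x N ζ) p
        = (D.gauge z ζ).V (D.gaugeConn x N ζ) x p ↔
      ∀ a, dif m (fun q => dif m (x a) q (ζ q)) p (D.n p)
        = 1 / 2 * (D.box N (x a) p - dif m (x a) p (D.ellVec N p))
          - 1 / 2 * (D.trP p (D.K p) - 4 * D.omega p) * dif m (x a) p (ζ p) := by
    rw [hN.gauge_ellVec hx hD hD' hg]
    have h3 (a : Fin m) : dif m (x a) p (D.ellVec N p + (2 : ℝ) • N ζ p (D.n p)
        - (4 * D.omega p) • ζ p) = dif m (x a) p ((D.gauge z ζ).V (D.gaugeConn x N ζ) x p) ↔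
        dif m (fun q => dif m (x a) q (ζ q)) p (D.n p)
        = 1 / 2 * (D.box N (x a) p - dif m (x a) p (D.ellVec N p))
          - 1 / 2 * (D.trP p (D.K p) - 4 * D.omega p) * dif m (x a) p (ζ p) := by
      -- `dxᵃ(∇̄_n ζ)` has coefficient `2` on both sides and cancels; only the derivative `n(ζᵃ)` of
      -- the component survives.
      rw [V_eq hx, hN.gauge_box hx hD hD' hg]
      simp only [map_add, map_sub, map_smul, smul_eq_mul]
      constructor <;> intro h <;> linarith
    exact ⟨fun h a => (h3 a).1 (congrArg _ h), fun h => hx.ext_comps fun a => (h3 a).2 (h a)⟩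
  constructor
  -- The connection in `IsHarmonic` is an arbitrary one for the transformed data; neither `V` nor
  -- `∇'ℓ'` depends on the choice.
  · rintro ⟨N₁, hN₁, h3, h4⟩
    refine ⟨fun p => (h1 p).1 (h3 p), fun p => (h2 p).1 ?_⟩
    have hV : (D.gauge z ζ).V N₁ x p = (D.gauge z ζ).V (D.gaugeConn x N ζ) x p :=
      hx.ext_comps fun a => by
        rw [V_eq hx, V_eq hx, hN₁.box_eq hN' hx (hD.gauge hg.ne_zero) (hD'.gauge_ℓ_smooth hg)
          (hx.1 a)]
    have hℓ : covForm N₁ (D.gauge z ζ).ℓ p = covForm (D.gaugeConn x N ζ) (D.gauge z ζ).ℓ p :=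
      ContinuousLinearMap.ext fun v => ContinuousLinearMap.ext fun w => by
        rw [hN₁.nabla_ℓ, hN'.nabla_ℓ]
    rw [← hV, ← h4, ellVec, hℓ]
  · rintro ⟨h3, h4⟩
    exact ⟨_, hN', fun p => (h1 p).2 (h3 p), fun p => (h2 p).2 (h4 p)⟩

end HData

end

/-! ### Solving the transport equations -/

section

variable {m : ℕ} {M : Type*} [TopologicalSpace M] [ChartedSpace (EuclideanSpace ℝ (Fin m)) M]

theorem dif_exp {f : M → ℝ} {p : M} (hf : MDifferentiableAt (𝓡 m) 𝓘(ℝ) f p) (v : TS m p) :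
    dif m (fun q => Real.exp (f q)) p v = Real.exp (f p) * dif m f p v := by
  have h := ((Real.hasDerivAt_exp (f p)).hasFDerivAt.hasMFDerivAt.comp p hf.hasMFDerivAt).mfderiv
  have h1 : Real.exp ∘ f = fun q => Real.exp (f q) := rfl
  rw [h1] at h
  simp only [dif, mvfderiv, h]
  exact mul_comm _ _

variable [IsManifold (𝓡 m) ∞ M]

namespace HData

variable {D : HData m M} {x : Fin m → M → ℝ}

theorem IsCHD.isNull (hD : D.IsCHD) : D.IsNull := ⟨hD.symm_γ, hD.nondeg, hD.rad_ne⟩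

theorem IsIndep.rate_smooth (hx : IsIndep x) (hD : D.IsNull) (hD' : D.IsHypersurfaceData) :
    SmoothFun m (fun p => 1 / 2 * (D.trP p (D.K p) - 4 * D.omega p)) :=
  have hn := hx.n_smooth hD'
  (SmoothFun.const _).mul ((hx.trP_smooth hD' fun a b => hD.K_smooth hD'.smooth_γ hn
    (hx.basisField_smooth a) (hx.basisField_smooth b)).sub
      ((SmoothFun.const _).mul ((SmoothFun.const _).mul (hD'.smooth_Y.apply hn hn))))

theorem IsIndep.box_smooth (hx : IsIndep x) (hD : D.IsNull) (hD' : D.IsHypersurfaceData)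
    (a : Fin m) : SmoothFun m (D.box (hx.hypersurfaceConn D) (x a)) := by
  refine hx.trP_smooth hD' fun b c => ?_
  simp only [covForm_apply _ (dif_smooth (hx.1 a)) ((hx.basisField_smooth b).diffAt _)
    ((hx.basisField_smooth c).diffAt _), hx.hypersurfaceConn_basis]
  exact (dif_apply_smooth ((dif_smooth (hx.1 a)).apply (hx.basisField_smooth c))
    (hx.basisField_smooth b)).sub ((dif_smooth (hx.1 a)).apply (hx.christoffel_smooth hD hD' b c))

theorem IsConnection.ellVec_smooth {N : Conn m M} (hN : D.IsConnection N) (hx : IsIndep x)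
    (hD : D.IsNull) (hD' : D.IsHypersurfaceData) : (D.ellVec N).Smooth := by
  have hn := hx.n_smooth hD'
  refine VField.Smooth.add (VField.Smooth.smul (f := fun _ => 2) (hx.P_smooth hD'
    (α := fun p => covForm N D.ℓ p (D.n p)) fun a => ?_) (.const _))
    (hn.smul (dif_apply_smooth hD'.smooth_ℓ2 hn))
  simp only [hN.nabla_ℓ]
  have ha := hx.basisField_smooth a
  exact ((hD'.smooth_Y.apply hn ha).add (F_smooth hD'.smooth_ℓ hn ha)).sub
    (hD'.smooth_ℓ2.mul (hD.K_smooth hD'.smooth_γ hn hn ha))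

variable [T2Space M] {S : Set M}

/-- The transport equation `n(z) = λ z` has a unique solution with given non-vanishing values on a
section. -/
theorem IsSection.exists_rate_solution (hS : D.IsSection S) (hn : D.n.Smooth) {r : M → ℝ}
    (hr : SmoothFun m r) {z₀ : M → ℝ} (hz₀ : ContMDiffOn (𝓡 m) 𝓘(ℝ) ∞ z₀ S)
    (hne : ∀ p ∈ S, z₀ p ≠ 0) : ∃ z : M → ℝ, SmoothFun m z ∧ (∀ p, z p ≠ 0) ∧
      (∀ p, dif m z p (D.n p) = r p * z p) ∧ ∀ p ∈ S, z p = z₀ p := by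
  have h0 : SmoothFun m (fun _ : M => (0 : ℝ)) := .const 0
  -- The solution is `f exp(g)`: `g` integrates `r` from zero on `S`, and `f` is constant along
  -- integral curves, so it inherits non-vanishing from `z₀`.
  set g := D.transport S r (fun _ => 0)
  set f := D.transport S (fun _ => 0) z₀
  have hg : SmoothFun m g := hS.transport_smooth hn hr contMDiffOn_const
  have hf : SmoothFun m f := hS.transport_smooth hn h0 hz₀
  refine ⟨fun p => f p * Real.exp (g p), hf.mul hg.exp, fun p => ?_, fun p => ?_, fun p hp => ?_⟩
  · refine mul_ne_zero ?_ (Real.exp_ne_zero _)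
    obtain ⟨c, a, b, t, hs, ht, hc, rfl, hct⟩ := hS.meets p
    have h := hS.transport_curve hn h0.continuous z₀ (g := fun _ => 0) hc
      (fun s _ => hasDerivAt_const s 0) ht hs
    rw [hS.transport_of_mem hn h0.continuous z₀ hct, sub_self, add_zero] at h
    change D.transport S (fun _ => 0) z₀ (c 0) ≠ 0
    rw [h]
    exact hne _ hct
  · have hfn : dif m f p (D.n p) = 0 := hS.transport_hasDeriv hn h0 z₀ (hf.mdiff p)
    have hgn : dif m g p (D.n p) = r p := hS.transport_hasDeriv hn hr _ (hg.mdiff p)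
    rw [dif_mul (hf.mdiff p) (hg.exp.mdiff p), dif_exp (hg.mdiff p), hfn, hgn]
    ring
  · have h1 : f p = z₀ p := hS.transport_of_mem hn h0.continuous z₀ hp
    have h2 : g p = 0 := hS.transport_of_mem hn hr.continuous _ hp
    simp [h1, h2]

/-- The quotient `z' / z` is constant along `n` and equals `1` on `S`. -/
theorem IsSection.rate_solution_unique (hS : D.IsSection S) {r z z' : M → ℝ}
    (hz : SmoothFun m z) (hz' : SmoothFun m z') (hne : ∀ p, z p ≠ 0)
    (h : ∀ p, dif m z p (D.n p) = r p * z p) (h' : ∀ p, dif m z' p (D.n p) = r p * z' p)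
    (h0 : ∀ p ∈ S, z' p = z p) : z' = z := by
  have hq : SmoothFun m (fun p => z' p * (z p)⁻¹) := hz'.mul (hz.inv hne)
  have hz'q : z' = fun p => (z' p * (z p)⁻¹) * z p := by
    ext p
    field_simp [hne p]
  have hd (p : M) : dif m (fun p => z' p * (z p)⁻¹) p (D.n p) = 0 := by
    have h1 := dif_mul (hq.mdiff p) (hz.mdiff p) (D.n p)
    rw [← hz'q, h, h'] at h1
    have h2 : z' p * (z p)⁻¹ * (r p * z p) = r p * z' p := by
      have := hne p
      field_simp
    rw [h2] at h1
    exact (mul_eq_zero.1 (by linarith : z p * dif m (fun p => z' p * (z p)⁻¹) p (D.n p) = 0)).resolve_left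
      (hne p)
  have h1 := hS.eq_of_dif_eq hq (.const 1) (fun p => by rw [hd, dif_const]; rfl)
    (fun p hp => by rw [h0 p hp, mul_inv_cancel₀ (hne p)])
  ext p
  have h2 := congrFun h1 p
  have := hne p
  field_simp at h2
  exact h2

end HData

end

end

/-! ### Existence and uniqueness of the gauge parameters -/

theorem mainTheorem4 {m : ℕ} {M : Type*} [TopologicalSpace M] [T2Space M] [SigmaCompactSpace M]
    [ChartedSpace (EuclideanSpace ℝ (Fin m)) M] [IsManifold (𝓡 m) ∞ M]
    (D : HData m M) (hD : D.IsCHD)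
    (x : Fin m → M → ℝ) (hx : HData.IsIndep x)
    (S : Set M) (hS : D.IsSection S)
    (z₀ : M → ℝ) (hz₀ : ContMDiffOn (𝓡 m) 𝓘(ℝ) ∞ z₀ S) (hz₀_ne : ∀ p ∈ S, z₀ p ≠ 0)
    (ζ₀ : VField m M) (hζ₀ : ζ₀.SmoothOn S) :
    ∃! g : (M → ℝ) × VField m M,
      IsGaugeParam g.1 g.2 ∧
      (D.gauge g.1 g.2).IsHarmonic x ∧
      (∀ p ∈ S, g.1 p = z₀ p) ∧ (∀ p ∈ S, g.2 p = ζ₀ p) := by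
  have hN0 := hD.isNull
  have hD' := hD.toIsHypersurfaceData
  have hn := hx.n_smooth hD'
  have hN := hN0.isConnection hx hD'
  set N := hx.hypersurfaceConn D
  set r : M → ℝ := fun p => 1 / 2 * (D.trP p (D.K p) - 4 * D.omega p)
  have hr : SmoothFun m r := hx.rate_smooth hN0 hD'
  set k : Fin m → M → ℝ := fun a p => 1 / 2 * (D.box N (x a) p - dif m (x a) p (D.ellVec N p))
  have hk (a : Fin m) : SmoothFun m (k a) := (SmoothFun.const _).mul
    ((hx.box_smooth hN0 hD' a).sub
      ((dif_smooth (hx.1 a)).apply (hN.ellVec_smooth hx hN0 hD')))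
  obtain ⟨z, hz, hz_ne, hzn, hzS⟩ := hS.exists_rate_solution hn hr hz₀ hz₀_ne
  -- `z` is an integrating factor: `n(z) = r z` and `n(ζᵃ) = kᵃ - r ζᵃ` give `n(z ζᵃ) = z kᵃ`, whose
  -- right-hand side no longer involves `ζ`. So `y a` is to be `z ζᵃ`.
  set y : Fin m → M → ℝ := fun a => D.transport S (fun p => z p * k a p)
    (fun p => z₀ p * dif m (x a) p (ζ₀ p))
  have hzk (a : Fin m) : SmoothFun m (fun p => z p * k a p) := hz.mul (hk a)
  have hy (a : Fin m) : SmoothFun m (y a) := hS.transport_smooth hn (hzk a)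
    (hz₀.mul ((dif_smooth (hx.1 a)).applyOn hζ₀))
  have hyn (a : Fin m) (p : M) : dif m (y a) p (D.n p) = z p * k a p :=
    hS.transport_hasDeriv hn (hzk a) _ ((hy a).mdiff p)
  have hyS (a : Fin m) (p : M) (hp : p ∈ S) : y a p = z₀ p * dif m (x a) p (ζ₀ p) :=
    hS.transport_of_mem hn (hzk a).continuous _ hp
  set ζ : VField m M := fun p => ∑ a, (y a p * (z p)⁻¹) • basisField x a p
  have hζa (a : Fin m) (p : M) : dif m (x a) p (ζ p) = y a p * (z p)⁻¹ :=
    hx.dif_sum_basisField _ p a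
  have hζa_smooth (a : Fin m) : SmoothFun m (fun p => dif m (x a) p (ζ p)) := by
    simp_rw [hζa]
    exact (hy a).mul (hz.inv hz_ne)
  have hg : IsGaugeParam z ζ := ⟨hz, hz_ne, hx.smooth_of_comps hζa_smooth⟩
  have hzζ (a : Fin m) : (fun p => z p * dif m (x a) p (ζ p)) = y a := by
    ext p
    rw [hζa]
    have := hz_ne p
    field_simp
  refine ⟨(z, ζ), ⟨hg, (hN.gauge_isHarmonic_iff hx hN0 hD' hg).2 ⟨hzn, fun p a => ?_⟩, hzS,
    fun p hp => hx.ext_comps fun a => ?_⟩, ?_⟩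
  · have h := dif_mul (hz.mdiff p) ((hζa_smooth a).mdiff p) (D.n p)
    rw [hzζ, hyn, hzn] at h
    refine mul_left_cancel₀ (hz_ne p) ?_
    rw [← sub_eq_zero]
    simp only [k, r] at h
    linear_combination -h
  · have := hz₀_ne p hp
    change dif m (x a) p (ζ p) = _
    rw [hζa, hyS a p hp, hzS p hp]
    field_simp
  · rintro ⟨z', ζ'⟩ ⟨hg', hharm, hzS', hζS'⟩
    dsimp only at hg' hharm hzS' hζS'
    obtain ⟨h1, h2⟩ := (hN.gauge_isHarmonic_iff hx hN0 hD' hg').1 hharm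
    obtain rfl : z' = z := hS.rate_solution_unique hz hg'.smooth_z hz_ne hzn h1
      fun p hp => by rw [hzS' p hp, hzS p hp]
    have hζ'a (a : Fin m) : SmoothFun m (fun p => dif m (x a) p (ζ' p)) :=
      (dif_smooth (hx.1 a)).apply hg'.smooth_ζ
    -- Once `z' = z`, the products `z' ζ'ᵃ` obey the transport equation of `y a` with the same
    -- values on `S`.
    have key (a : Fin m) : (fun p => z' p * dif m (x a) p (ζ' p)) = y a := by
      refine hS.eq_of_dif_eq (hz.mul (hζ'a a)) (hy a) (fun p => ?_) (fun p hp => ?_)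
      · rw [dif_mul (hz.mdiff p) ((hζ'a a).mdiff p), h2, hzn, hyn]
        simp only [k, r]
        ring
      · rw [hζS' p hp, hzS p hp]
        exact (hyS a p hp).symm
    refine Prod.ext rfl (funext fun p => hx.ext_comps fun a => ?_)
    refine mul_left_cancel₀ (hz_ne p) ?_
    exact (congrFun (key a) p).trans (congrFun (hzζ a) p).symm
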